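/- **Setting.** Let $\mathcal S$ be the set of sentences of a first-order language, viewed propositionally: its *prime* sentences are the atomic and the quantified ones. A *world* is a map $\mathbb W:\mathcal S\to\{0,1\}$; it is *propositionally consistent* if it respects the Boolean connectives, and $\mathcal{PC}(S)$ is the set of propositionally consistent worlds in which every element of $S$ is true. Let $\Gamma\subseteq\mathcal S$ be a consistent theory that contains first-order logic (every logically valid sentence is provable from $\Gamma$ by modus ponens); $\Gamma\vdash$ denotes this provability. Finite objects $x$ (numbers, rationals, sentences) are named in the language by closed terms $\underline x$ that can be written down in polynomial time, and there are formulas for $<$ and $\cdot$ on rational numbers such that, for all rationals $q,r$, $\Gamma\vdash\underline q<\underline r$ if $q<r$, $\Gamma\vdash\neg(\underline q<\underline r)$ otherwise, and $\Gamma\vdash\forall\nu\,(\underline q\cdot\underline r=\nu\leftrightarrow\nu=\underline{qr})$. A formula $\gamma$ *represents* a function $g$ if $\Gamma\vdash\forall\nu\,(\gamma(\underline{x_1},\dots,\underline{x_k},\nu)\leftrightarrow\nu=\underline{g(x_1,\dots,x_k)})$ for all arguments. A sequence is *efficiently computable* (e.c.) if its $n$-th element is computed from $n\in\mathbb N^+$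 in time polynomial in $n$. Let $(D_n)$ be a computable nested sequence of finite sets of sentences with $\mathcal{PC}(\bigcup_n D_n)=\mathcal{PC}(\Gamma)$. Let $\overline{\mathbb P}=(\mathbb P_n)_{n\ge1}$ be a *market*, i.e. a computable sequence of maps $\mathbb P_n:\mathcal S\to\mathbb Q\cap[0,1]$. An *expressible feature of rank $\le n$* is a function of the price history, written as a straight-line program (with local variables) from prices $\mathbb P_i(\phi)$, $i\le n$, and rational constants by addition, multiplication, $\max$ and $x\mapsto 1/\max(1,x)$. A *trader* is a sequence of strategies $T_n=\sum_j\xi_j\cdot(\phi_j-\mathbb P_n(\phi_j))$ (finite sums) with $\xi_j$ expressible features of rank $\le n$. It *exploits* $\overline{\mathbb P}$ if the set of the values $\mathbb W(\sum_{i\le n}T_i(\overline{\mathbb P}))$, $n\in\mathbb N^+$, $\mathbb W\in\mathcal{PC}(D_n)$, is bounded below but not above. Assume that $\overline{\mathbb P}$ is a *logical inductor* over $(D_n)$: no e.c. trader exploits it. A sequence $(q_n)$ of rationals is *$\overline{\mathbb P}$-generable* if there is an e.c. sequence of expressible features $\xi_n$ of rank $\le n$ with $\xi_n(\overline{\mathbb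 P})=q_n$ for all $n$. For a formula $X(\nu)$ with one free variable, let $\mathbb E_n(X)=\sum_{i=0}^{n-1}\frac1n\,\mathbb P_n(\ulcorner X>i/n\urcorner)$, where $\ulcorner X>q\urcorner$ is the sentence $\forall x\,(X(x)\to\underline q<x)$. Let $\mathbf 1(\phi)$ be the formula $(\phi\wedge\nu=\underline 1)\vee(\neg\phi\wedge\nu=\underline 0)$, and let $\ulcorner X\cdot Y\urcorner$ be the formula $\forall x\,y\,(X(x)\wedge Y(y)\to x\cdot y=\nu)$. For rational $\delta>0$ let $\mathrm{Ind}_\delta(x>y)$ be $0$ if $x\le y$, $(x-y)/\delta$ if $y<x\le y+\delta$, and $1$ if $x>y+\delta$. Write $x_n\gtrsim_n y_n$ for $\liminf_{n\to\infty}(x_n-y_n)\ge0$. **Theorem (Self-Trust).** Let $f:\mathbb N^+\to\mathbb N^+$ be a deferral function, i.e. $f(n)>n$ and $f(n)$ is computable in time polynomial in $f(n)$. Let $(\phi_n)$ be an e.c. sequence of sentences, $(\delta_n)$ an e.c. sequence of positive rationals, and $(p_n)$ a $\overline{\mathbb P}$-generable sequence of rationals in $[0,1]$. Let $\gamma_f,\gamma_{\mathbb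 P},\gamma_p,\gamma_{\mathrm{Ind}}$ be any formulas that represent in $\Gamma$ the functions $n\mapsto f(n)$, $(n,\phi)\mapsto\mathbb P_n(\phi)$, $n\mapsto p_n$ and $(\delta,x,y)\mapsto\mathrm{Ind}_\delta(x>y)$ ($\delta>0$), and let $A_n(\nu)$, "$\mathrm{Ind}_{\delta_n}(\mathbb P_{f(n)}(\phi_n)>p_n)$", be the formula $$\forall m\,x\,r\;\bigl(\gamma_f(\underline n,m)\wedge\gamma_{\mathbb P}(m,\underline{\phi_n},x)\wedge\gamma_p(\underline n,r)\to\gamma_{\mathrm{Ind}}(\underline{\delta_n},x,r,\nu)\bigr).$$ Then $$\mathbb E_n\bigl(\ulcorner\mathbf 1(\phi_n)\cdot A_n\urcorner\bigr)\;\gtrsim_n\;p_n\cdot\mathbb E_n(A_n).$$ -/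

import Mathlib

open FirstOrder FirstOrder.Language Filter

namespace LogicalInduction

/-! ## A machine model with a step count

Programs manipulate binary trees.  Every elementary operation is charged the size of the data it
touches, so that a run of cost `t` is simulated by a Turing machine in time polynomial in `t`, and
conversely; the induced notions of "computable" and "polynomial time" are the usual ones. -/

/-- The data manipulated by programs: binary trees. -/
inductive Data where
  | nil : Data
  | cons (a b : Data) : Data

namespace Data

/-- The number of nodes, leaves included. -/
def size : Data → ℕ
  | nil => 1
  | cons a b => a.size + b.size + 1

def head : Data → Data
  | nil => nil
  | cons a _ => a

def tail : Data → Data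
  | nil => nil
  | cons _ b => b

/-- The number `n` written in unary. -/
def unary : ℕ → Data
  | 0 => nil
  | n + 1 => cons nil (unary n)

end Data

/-- Programs; `cond c f g` is "if `c` then `f` else `g`" and `loop c f` is "while `c` do `f`", where
the test `c` succeeds if its output is not `nil`. -/
inductive Prog where
  | id : Prog
  | nil : Prog
  | head : Prog
  | tail : Prog
  | pair (f g : Prog) : Prog
  | comp (g f : Prog) : Prog
  | cond (c f g : Prog) : Prog
  | loop (c f : Prog) : Prog

/-- `Run c x y t`: the program `c` on input `x` halts with output `y`, at cost `t`. -/
inductive Run : Prog → Data → Data → ℕ → Prop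
  | id (x : Data) : Run .id x x x.size
  | nil (x : Data) : Run .nil x .nil 1
  | head (x : Data) : Run .head x x.head x.size
  | tail (x : Data) : Run .tail x x.tail x.size
  | pair {f g : Prog} {x y z : Data} {s t : ℕ} :
      Run f x y s → Run g x z t → Run (.pair f g) x (.cons y z) (s + t + x.size)
  | comp {f g : Prog} {x y z : Data} {s t : ℕ} :
      Run f x y s → Run g y z t → Run (.comp g f) x z (s + t + 1)
  | cond_true {c f g : Prog} {x b y : Data} {r s : ℕ} :
      Run c x b r → b ≠ .nil → Run f x y s → Run (.cond c f g) x y (r + s + x.size)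
  | cond_false {c f g : Prog} {x y : Data} {r s : ℕ} :
      Run c x .nil r → Run g x y s → Run (.cond c f g) x y (r + s + x.size)
  | loop_done {c f : Prog} {x : Data} {r : ℕ} :
      Run c x .nil r → Run (.loop c f) x x (r + x.size)
  | loop_step {c f : Prog} {x b y z : Data} {r s t : ℕ} :
      Run c x b r → b ≠ .nil → Run f x y s → Run (.loop c f) y z t →
        Run (.loop c f) x z (r + s + t + x.size)

/-- The program `c` on input `x` halts with output `y` within `T` steps. -/
def RunsIn (c : Prog) (x y : Data) (T : ℕ) : Prop := ∃ t ≤ T, Run c x y t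

/-- The program `c` on input `x` halts with output `y`. -/
def Halts (c : Prog) (x y : Data) : Prop := ∃ t, Run c x y t

/-! ## Encodings of finite objects as data -/

/-- A fixed way to write the elements of `α` as data. -/
class Encode (α : Type) where
  enc : α → Data

open Encode (enc)

instance : Encode Bool where
  enc b := if b then .cons .nil .nil else .nil

def encList {α : Type} (e : α → Data) : List α → Data
  | [] => .nil
  | a :: l => .cons (e a) (encList e l)

instance {α : Type} [Encode α] : Encode (List α) where
  enc := encList enc

instance {α β : Type} [Encode α] [Encode β] : Encode (α × β) where
  enc x := .cons (enc x.1) (enc x.2)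

/-- Natural numbers are written in binary. -/
instance : Encode ℕ where
  enc n := enc n.bits

instance : Encode ℕ+ where
  enc n := enc (n : ℕ)

instance : Encode ℤ where
  enc z := enc (decide (z < 0), z.natAbs)

/-- Rational numbers are written as reduced fractions. -/
instance : Encode ℚ where
  enc q := enc (q.num, q.den)

/-! ## Computability and efficient computability -/

/-- A sequence is efficiently computable if some program outputs its `n`-th element on input `n`
in time polynomial in `n` (the input `n` is written in unary). -/
def EffComputable {α : Type} [Encode α] (x : ℕ+ → α) : Prop :=
  ∃ (c : Prog) (h : Polynomial ℕ), ∀ n : ℕ+, RunsIn c (.unary n) (enc (x n)) (h.eval (n : ℕ))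

/-- Deferral functions: `f n > n`, and `f n` can be computed in time polynomial in `f n`. -/
def IsDeferral (f : ℕ+ → ℕ+) : Prop :=
  (∀ n, n < f n) ∧
  ∃ (c : Prog) (h : Polynomial ℕ), ∀ n : ℕ+, RunsIn c (.unary n) (enc (f n)) (h.eval (f n : ℕ))

/-! ## Sentences as data

A variable is written as its de Bruijn index, i.e. the number of variables bound more recently. -/

section Encoding

variable {L : FirstOrder.Language.{0, 0}} [∀ k, Encodable (L.Functions k)] [∀ k, Encodable (L.Relations k)]

/-- The encoding of a term, where `v` numbers its variables. -/
def encTerm {α : Type} (v : α → ℕ) : L.Term α → Data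
  | .var a => .cons (.unary 0) (enc (v a))
  | .func f ts => .cons (.unary 1) (.cons (enc (Encodable.encode f))
      (encList (fun d => d) (List.ofFn fun i => encTerm v (ts i))))

/-- The de Bruijn indices of the variables of a formula with `n` bound variables in scope; the free
variables (numbered by `v`) count as bound further outside. -/
def varIndex {α : Type} (v : α → ℕ) (n : ℕ) : α ⊕ Fin n → ℕ :=
  Sum.elim (fun a => n + v a) (fun j => n - 1 - j)

/-- The encoding of a formula, where `v` numbers its free variables. -/
def encFormula {α : Type} (v : α → ℕ) : ∀ {n : ℕ}, L.BoundedFormula α n → Data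
  | _, .falsum => .cons (.unary 0) .nil
  | n, .equal s t => .cons (.unary 1)
      (.cons (encTerm (varIndex v n) s) (encTerm (varIndex v n) t))
  | n, .rel R ts => .cons (.unary 2) (.cons (enc (Encodable.encode R))
      (encList (fun d => d) (List.ofFn fun i => encTerm (varIndex v n) (ts i))))
  | _, .imp φ ψ => .cons (.unary 3) (.cons (encFormula v φ) (encFormula v ψ))
  | _, .all φ => .cons (.unary 4) (encFormula v φ)

instance : Encode (L.Term Empty) where
  enc := encTerm Empty.elim

instance : Encode L.Sentence where
  enc := encFormula Empty.elim

end Encoding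

/-! ## Propositional logic on first-order sentences

The prime sentences are the atomic and the quantified ones; the primitive connectives of Mathlib's
formulas are `⊥` and `⟹`, from which the others are defined. -/

section Logic

variable {L : FirstOrder.Language.{0, 0}}

/-- A world is any truth assignment to the sentences. -/
abbrev World (L : FirstOrder.Language.{0, 0}) : Type := L.Sentence → Bool

/-- Propositional consistency of a world. -/
def World.IsPC (W : World L) : Prop :=
  W ⊥ = false ∧ ∀ φ ψ : L.Sentence, W (φ ⟹ ψ) = (!(W φ) || W ψ)

/-- The propositionally consistent worlds in which all elements of `S` are true. -/
def pcWorlds (S : Set L.Sentence) : Set (World L) :=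
  {W | W.IsPC ∧ ∀ φ ∈ S, W φ = true}

/-- Provability from `Γ` by propositional logic, with modus ponens as the only rule. -/
inductive Proves (Γ : L.Theory) : L.Sentence → Prop
  | ax {φ : L.Sentence} : φ ∈ Γ → Proves Γ φ
  | taut {φ : L.Sentence} : (∀ W : World L, W.IsPC → W φ = true) → Proves Γ φ
  | mp {φ ψ : L.Sentence} : Proves Γ (φ ⟹ ψ) → Proves Γ φ → Proves Γ ψ

def IsConsistent (Γ : L.Theory) : Prop := ¬ Proves Γ ⊥

/-- The axioms of first-order logic are available in `Γ`: all logically valid sentences can be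
proven from `Γ` (by modus ponens). -/
def ContainsLogic (Γ : L.Theory) : Prop :=
  ∀ φ : L.Sentence, (∅ : L.Theory) ⊨ᵇ φ → Proves Γ φ

end Logic

/-! ## Expressible features and trading strategies -/

section Features

variable {S : Type}

/-- Feature expressions over the sentences `S`; `price φ i` is the price of `φ` on day `i`,
`var j` is the `j`-th local variable, and `recip e` is `1 / max (1, e)`. -/
inductive FeatureExpr (S : Type) : Type where
  | price (φ : S) (i : ℕ+) : FeatureExpr S
  | const (q : ℚ) : FeatureExpr S
  | var (j : ℕ) : FeatureExpr S
  | add (a b : FeatureExpr S) : FeatureExpr S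
  | mul (a b : FeatureExpr S) : FeatureExpr S
  | max (a b : FeatureExpr S) : FeatureExpr S
  | recip (a : FeatureExpr S) : FeatureExpr S

namespace FeatureExpr

/-- The expression uses only the first `k` variables and prices of days `≤ n`. -/
def WellFormed (n : ℕ+) (k : ℕ) : FeatureExpr S → Prop
  | price _ i => i ≤ n
  | const _ => True
  | var j => j < k
  | add a b => a.WellFormed n k ∧ b.WellFormed n k
  | mul a b => a.WellFormed n k ∧ b.WellFormed n k
  | max a b => a.WellFormed n k ∧ b.WellFormed n k
  | recip a => a.WellFormed n k

/-- The value of an expression on the valuation sequence `V`, for the values `env` of the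
variables. -/
noncomputable def eval (V : ℕ+ → S → ℝ) (env : List ℝ) : FeatureExpr S → ℝ
  | price φ i => V i φ
  | const q => q
  | var j => env.getD j 0
  | add a b => a.eval V env + b.eval V env
  | mul a b => a.eval V env * b.eval V env
  | max a b => Max.max (a.eval V env) (b.eval V env)
  | recip a => (Max.max 1 (a.eval V env))⁻¹

/-- The encoding of feature expressions. -/
def encode [Encode S] : FeatureExpr S → Data
  | price φ i => .cons (.unary 0) (enc (φ, i))
  | const q => .cons (.unary 1) (enc q)
  | var j => .cons (.unary 2) (enc j)
  | add a b => .cons (.unary 3) (.cons a.encode b.encode)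
  | mul a b => .cons (.unary 4) (.cons a.encode b.encode)
  | max a b => .cons (.unary 5) (.cons a.encode b.encode)
  | recip a => .cons (.unary 6) a.encode

instance [Encode S] : Encode (FeatureExpr S) where
  enc := encode

end FeatureExpr

/-- In the block `v₀ := e₀; v₁ := e₁; …` of local definitions, `eₖ` uses only the variables
`v₀, …, vₖ₋₁`, and prices of days `≤ n`. -/
def DefsWellFormed (n : ℕ+) (defs : List (FeatureExpr S)) : Prop :=
  ∀ (k : ℕ) (h : k < defs.length), (defs[k]).WellFormed n k

/-- The values of the variables defined by a block of local definitions, after those in `env`. -/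
noncomputable def evalDefs (V : ℕ+ → S → ℝ) : List (FeatureExpr S) → List ℝ → List ℝ
  | [], env => env
  | e :: es, env => evalDefs V es (env ++ [e.eval V env])

/-- Expressible features: a block of local definitions and a returned expression. -/
structure Feature (S : Type) where
  defs : List (FeatureExpr S)
  ret : FeatureExpr S

namespace Feature

/-- The feature is well-formed and has rank `≤ n`. -/
def HasRank (ξ : Feature S) (n : ℕ+) : Prop :=
  DefsWellFormed n ξ.defs ∧ ξ.ret.WellFormed n ξ.defs.length

noncomputable def eval (ξ : Feature S) (V : ℕ+ → S → ℝ) : ℝ :=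
  ξ.ret.eval V (evalDefs V ξ.defs [])

instance [Encode S] : Encode (Feature S) where
  enc ξ := enc (ξ.defs, ξ.ret)

end Feature

/-- A trading strategy `∑ ξᵢ · (φᵢ - price of φᵢ)`, given by a block of local definitions and the
list of the `(φᵢ, ξᵢ)`. -/
structure Strategy (S : Type) where
  defs : List (FeatureExpr S)
  trades : List (S × FeatureExpr S)

namespace Strategy

/-- The trading strategy is a strategy for day `n`. -/
def IsForDay (T : Strategy S) (n : ℕ+) : Prop :=
  DefsWellFormed n T.defs ∧ ∀ x ∈ T.trades, x.2.WellFormed n T.defs.length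

/-- The value according to `W` of the holdings that the strategy `T` acquires on day `n`, at the
prices `V`: `∑ ξᵢ(V) · (W(φᵢ) - Vₙ(φᵢ))`. -/
noncomputable def value (T : Strategy S) (V : ℕ+ → S → ℝ) (n : ℕ+) (W : S → ℝ) : ℝ :=
  (T.trades.map fun x => x.2.eval V (evalDefs V T.defs []) * (W x.1 - V n x.1)).sum

instance [Encode S] : Encode (Strategy S) where
  enc T := enc (T.defs, T.trades)

end Strategy

/-- A trader is a sequence of trading strategies, the `n`-th one being a strategy for day `n`. -/
def IsTrader (T : ℕ+ → Strategy S) : Prop := ∀ n, (T n).IsForDay n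

end Features

/-! ## Logical inductors -/

section Inductors

variable {L : FirstOrder.Language.{0, 0}}

/-- The prices `P` as a real-valued valuation sequence. -/
def realPrices (P : ℕ+ → L.Sentence → ℚ) : ℕ+ → L.Sentence → ℝ := fun n φ => (P n φ : ℝ)

/-- The truth values `0` and `1` as real numbers. -/
def World.toReal (W : World L) : L.Sentence → ℝ := fun φ => if W φ then 1 else 0

/-- The trader `T` exploits `V` relative to `D`: the set of plausible assessments of its net worth
is bounded below, but not above. -/
def Exploits (T : ℕ+ → Strategy L.Sentence) (V : ℕ+ → L.Sentence → ℝ)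
    (D : ℕ+ → Finset L.Sentence) : Prop :=
  let plausible : Set ℝ :=
    {x | ∃ n : ℕ+, ∃ W ∈ pcWorlds (D n : Set L.Sentence),
      x = ∑ i ∈ Finset.Icc 1 n, (T i).value V i W.toReal}
  BddBelow plausible ∧ ¬ BddAbove plausible

variable [∀ k, Encodable (L.Functions k)] [∀ k, Encodable (L.Relations k)]

/-- A market: a computable sequence of rational valuations with values in `[0, 1]`. -/
def IsMarket (P : ℕ+ → L.Sentence → ℚ) : Prop :=
  (∀ n φ, 0 ≤ P n φ ∧ P n φ ≤ 1) ∧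
  ∃ c : Prog, ∀ n φ, Halts c (enc (n, φ)) (enc (P n φ))

/-- A computable nested sequence of finite sets of sentences (a deductive sequence). -/
def IsDeductive (D : ℕ+ → Finset L.Sentence) : Prop :=
  Monotone D ∧
  ∃ l : ℕ+ → List L.Sentence, (∀ n φ, φ ∈ l n ↔ φ ∈ D n) ∧
    ∃ c : Prog, ∀ n : ℕ+, Halts c (enc n) (enc (l n))

/-- `D` is `Γ`-complete: it eventually rules out exactly the worlds inconsistent with `Γ`. -/
def IsCompleteFor (D : ℕ+ → Finset L.Sentence) (Γ : L.Theory) : Prop :=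
  pcWorlds (⋃ n, (D n : Set L.Sentence)) = pcWorlds Γ

/-- The logical induction criterion. -/
def IsLogicalInductor (P : ℕ+ → L.Sentence → ℚ) (D : ℕ+ → Finset L.Sentence) : Prop :=
  ∀ T : ℕ+ → Strategy L.Sentence, IsTrader T → EffComputable T → ¬ Exploits T (realPrices P) D

/-- The sequence `q` is generable from the market `P`: its elements are the values on `P` of an
efficiently computable progression of expressible features. -/
def IsGenerable (P : ℕ+ → L.Sentence → ℚ) (q : ℕ+ → ℚ) : Prop :=
  ∃ ξ : ℕ+ → Feature L.Sentence, EffComputable ξ ∧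
    ∀ n, (ξ n).HasRank n ∧ (ξ n).eval (realPrices P) = (q n : ℝ)

end Inductors

/-! ## Talking about computations inside a theory -/

section Quoting

variable {L : FirstOrder.Language.{0, 0}}

/-- The universal closure of a formula with one free variable. -/
def forallOne (X : L.Formula (Fin 1)) : L.Sentence :=
  (BoundedFormula.relabel (fun _ => Sum.inr 0 : Fin 1 → Empty ⊕ Fin 1) X).alls

/-- How finite objects are named in the language, and how the order and the multiplication of
rational numbers are written in it. -/
structure QuoteSystem (L : FirstOrder.Language.{0, 0}) where
  /-- a closed term naming a given (encoded) object -/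
  name : Data → L.Term Empty
  /-- the formula `v₀ < v₁` -/
  lt : L.Formula (Fin 2)
  /-- the formula `v₀ · v₁ = v₂` -/
  mul : L.Formula (Fin 3)

namespace QuoteSystem

variable (Q : QuoteSystem L)

/-- The closed term naming `x`, as a term in a context with variables `β`. -/
def quote {α β : Type} [Encode α] (x : α) : L.Term β := (Q.name (enc x)).relabel Empty.elim

/-- `Γ` proves `∀ ν, γ(d₁, …, dₖ, ν) ↔ ν = e`, where `d₁, …, dₖ, e` stand for their names. -/
def ProvesValue (Γ : L.Theory) {k : ℕ} (γ : L.Formula (Fin (k + 1))) (d : Fin k → Data)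
    (e : Data) : Prop :=
  Proves Γ (forallOne
    ((γ.subst (Fin.snoc (α := fun _ => L.Term (Fin 1))
        (fun i => (Q.name (d i)).relabel Empty.elim) (.var 0)) : L.Formula (Fin 1)) ⇔
      (Term.var 0).equal ((Q.name e).relabel Empty.elim)))

/-- The formula `γ` represents in `Γ` the function with values `val i` at the arguments `arg i`. -/
def Represents (Γ : L.Theory) {ι : Type} {k : ℕ} (γ : L.Formula (Fin (k + 1)))
    (arg : ι → Fin k → Data) (val : ι → Data) : Prop :=
  ∀ i, Q.ProvesValue Γ γ (arg i) (val i)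

/-- Names can be written down in polynomial time, and `Γ` proves the true facts about the order and
the products of (named) rational numbers. -/
structure Adequate [∀ k, Encodable (L.Functions k)] (Γ : L.Theory) : Prop where
  name_poly : ∃ (c : Prog) (h : Polynomial ℕ), ∀ d : Data,
    RunsIn c d (enc (Q.name d)) (h.eval d.size)
  lt_true : ∀ q r : ℚ, q < r → Proves Γ (Q.lt.subst ![Q.quote q, Q.quote r])
  lt_false : ∀ q r : ℚ, ¬ q < r → Proves Γ ∼(Q.lt.subst ![Q.quote q, Q.quote r])
  mul_rep : Q.Represents Γ Q.mul (fun x : ℚ × ℚ => ![enc x.1, enc x.2]) (fun x => enc (x.1 * x.2))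

/-- The sentence "`X > q`", i.e. `∀ x, X(x) → q < x`. -/
def gt (X : L.Formula (Fin 1)) (q : ℚ) : L.Sentence :=
  forallOne (X ⟹ Q.lt.subst ![Q.quote q, .var 0])

/-- The indicator of `φ`, i.e. the formula `(φ ∧ ν = 1) ∨ (¬ φ ∧ ν = 0)`. -/
def indicator (φ : L.Sentence) : L.Formula (Fin 1) :=
  (Formula.relabel Empty.elim φ ⊓ (Term.var 0).equal (Q.quote (1 : ℚ))) ⊔
    (∼(Formula.relabel Empty.elim φ) ⊓ (Term.var 0).equal (Q.quote (0 : ℚ)))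

/-- The variables `v₁, …, vₖ` of a formula are universally quantified; `v₀` is left free. -/
def forallTail {k : ℕ} (X : L.Formula (Fin (k + 1))) : L.Formula (Fin 1) :=
  (BoundedFormula.relabel (Fin.cases (Sum.inl 0) Sum.inr : Fin (k + 1) → Fin 1 ⊕ Fin k) X).alls

/-- The variable "`X · Y`", i.e. the formula `∀ x y, X(x) ∧ Y(y) → x · y = ν`. -/
def prod (X Y : L.Formula (Fin 1)) : L.Formula (Fin 1) :=
  forallTail (k := 2)
    ((Formula.relabel (fun _ => 1) X ⊓ Formula.relabel (fun _ => 2) Y) ⟹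
      Q.mul.subst ![.var 1, .var 2, .var 0])

variable [∀ k, Encodable (L.Functions k)] [∀ k, Encodable (L.Relations k)]

/-- The variable "`Ind_δ(P_{f(n)}(φ) > p(n))`", written with formulas `γf`, `γP`, `γp`, `γI` for
the functions `f`, `P`, `p`, `Ind`, i.e. the formula
`∀ m x r, γf(n, m) ∧ γP(m, φ, x) ∧ γp(n, r) → γI(δ, x, r, ν)`. -/
def futureIndicator (γf : L.Formula (Fin 2)) (γP : L.Formula (Fin 3)) (γp : L.Formula (Fin 2))
    (γI : L.Formula (Fin 4)) (n : ℕ+) (φ : L.Sentence) (δ : ℚ) : L.Formula (Fin 1) :=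
  forallTail (k := 3)
    ((γf.subst ![Q.quote n, .var 1] ⊓ γP.subst ![.var 1, Q.quote φ, .var 2] ⊓
        γp.subst ![Q.quote n, .var 3]) ⟹
      γI.subst ![Q.quote δ, .var 2, .var 3, .var 0])

/-- The approximate expectation of `X` with precision `k` according to the valuation `V`. -/
noncomputable def expectation (k : ℕ) (V : L.Sentence → ℝ) (X : L.Formula (Fin 1)) : ℝ :=
  ∑ i ∈ Finset.range k, (1 / (k : ℝ)) * V (Q.gt X ((i : ℚ) / (k : ℚ)))

/-- The expectation of `X` on day `n`, according to the market `P`. -/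
noncomputable def dayExpectation (P : ℕ+ → L.Sentence → ℚ) (n : ℕ+) (X : L.Formula (Fin 1)) : ℝ :=
  Q.expectation n (realPrices P n) X

end QuoteSystem

end Quoting

/-- The continuous threshold indicator `Ind_δ(x > y)`. -/
def ctsInd (δ x y : ℚ) : ℚ :=
  if x ≤ y then 0 else if x ≤ y + δ then (x - y) / δ else 1

/-- `x ≳ y`: the limit inferior of `x n - y n` is at least `0`. -/
def AsympGE (x y : ℕ+ → ℝ) : Prop :=
  0 ≤ liminf (fun n => ((x n - y n : ℝ) : EReal)) atTop

end LogicalInduction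

open LogicalInduction LogicalInduction.Encode

namespace LogicalInduction

/-! ## Polynomial-time functions -/

/-! Suppose the inequality fails. Then for some rational ε > 0 there are infinitely many days n on
which p·E_n(A_n) exceeds E_n(1(φ_n)·A_n) by at least 2ε, where p = p_n, and a single trader profits
from all of them. On day n it buys the average over i < n of the sentences "1(φ_n)·A_n > i/n", sells
p times the average of the sentences "A_n > i/n", and on day f(n) it sells the amount a =
Ind_δ(P_{f(n)}(φ_n) > p) of φ_n; by then a can be read off the prices. Let w be the truth value of
φ_n and v its price on day f(n). Since Γ proves that the value of A_n is a, every world that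
satisfies enough consequences of Γ values the second average at some c with a ≤ c ≤ a + 1/n, and the
first one at wc at least. Apart from the price advantage, a unit bet is then worth at least wc - pc
- a(w - v) = (c - a)(w - p) + a(v - p) ≥ -1/n, because a vanishes unless v > p. If the price
advantage is at least ε + 1/n, the bet earns at least ε, whether φ_n is true or not.

Before a bet is settled it may look like a loss, so the trader works with a budget of 1: the stake
is the excess of the price advantage over ε + 1/n, times the part of the budget not tied up in open
bets. Open bets lose at most twice their stakes and closed bets win, so the net worth stays above
-2. Every bet is closed eventually; if the stakes had a finite sum, at least half of the budget
would be free from some day on, and the recurring opportunities would force stakes bounded away from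
0 (`unbounded_stakes`). Hence the gains are unbounded (`BettingPlan.exploits`).

The rest is efficiency. Prices are never computed by the trader, only referred to by its features;
the stakes are local variables of a straight-line program that replays all earlier bets, since
unfolding their recursion would be exponential. Two tests remain for the machine. Whether f(k) = n
is decided by a clocked simulation (`IsDeferral.exists_due`). Whether a bet is settled is decided by
tableaux with a bounded number of steps, applied to a slowed-down version of (D_n)
(`IsDeductive.exists_polyTime`); completeness of tableaux (`exists_refutes`) and compactness of the
space of worlds ensure that this succeeds at some time (`exists_settled`).

The facts to be settled are that Γ decides "A_n > q" according to whether q < a, and that Γ proves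
φ_n → ("A_n > q" → "1(φ_n)·A_n > q"). They are verified in models of the provable sentences and
brought back to Γ by `Proves.of_models`. -/

theorem Data.one_le_size (d : Data) : 1 ≤ d.size := by
  cases d <;> simp [Data.size]

theorem Data.size_unary (n : ℕ) : (Data.unary n).size = 2 * n + 1 := by
  induction n with
  | zero => rfl
  | succ n ih => simp [Data.unary, Data.size, ih]; ring

/-- Each rule is charged for what it writes; the new root made by `pair` is paid for by `x.size ≥
1`. A time bound is therefore also a size bound, which is how the growth of intermediate results is
controlled. -/
theorem Run.size_le {c : Prog} {x y : Data} {t : ℕ} (h : Run c x y t) : y.size ≤ t := by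
  induction h with
  | id x => exact le_rfl
  | nil x => simp [Data.size]
  | head x => cases x <;> simp [Data.size, Data.head]; omega
  | tail x => cases x <;> simp [Data.size, Data.tail]; omega
  | @pair f g x y z s t _ _ ih1 ih2 =>
    have := x.one_le_size
    simp only [Data.size]; omega
  | comp => omega
  | cond_true => omega
  | cond_false => omega
  | loop_done => omega
  | loop_step => omega

theorem RunsIn.mono {c : Prog} {x y : Data} {s t : ℕ} (h : RunsIn c x y s) (hst : s ≤ t) :
    RunsIn c x y t := by
  obtain ⟨r, hr, h⟩ := h
  exact ⟨r, hr.trans hst, h⟩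

theorem RunsIn.size_le {c : Prog} {x y : Data} {t : ℕ} (h : RunsIn c x y t) : y.size ≤ t := by
  obtain ⟨r, hr, h⟩ := h
  exact h.size_le.trans hr

theorem eval_monotone_nat (h : Polynomial ℕ) : Monotone (fun n : ℕ => h.eval n) := by
  intro a b hab
  simp only [Polynomial.eval_eq_sum_range]
  exact Finset.sum_le_sum fun i _ => by gcongr

/-- The size of the encoding of an object. -/
abbrev encSize {α : Type} [Encode α] (a : α) : ℕ := (enc a).size

/-- Functions that are computed in time polynomial in the size of the input. -/
@[fun_prop]
def PolyTime {α β : Type} [Encode α] [Encode β] (f : α → β) : Prop :=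
  ∃ (c : Prog) (h : Polynomial ℕ), ∀ a, RunsIn c (enc a) (enc (f a)) (h.eval (encSize a))

def Data.isNil : Data → Bool
  | nil => true
  | cons _ _ => false

instance : Encode Data where
  enc d := d

instance : Encode Unit where
  enc _ := .nil

/-- A natural number, to be written in unary. -/
@[ext]
structure Unary where
  val : ℕ

instance : Encode Unary where
  enc n := .unary n.val

/-! ### Sizes of encodings -/

section Sizes

variable {α β : Type} [Encode α] [Encode β]

theorem enc_pair (a : α) (b : β) : enc (a, b) = .cons (enc a) (enc b) := rfl
theorem enc_nil : enc ([] : List α) = .nil := rfl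
theorem enc_cons (a : α) (l : List α) : enc (a :: l) = .cons (enc a) (enc l) := rfl
theorem enc_true : enc true = .cons .nil .nil := rfl
theorem enc_false : enc false = .nil := rfl
theorem enc_data (d : Data) : enc d = d := rfl

theorem encSize_pair (a : α) (b : β) : encSize (a, b) = encSize a + encSize b + 1 := rfl
theorem encSize_nil : encSize ([] : List α) = 1 := rfl
theorem encSize_cons (a : α) (l : List α) : encSize (a :: l) = encSize a + encSize l + 1 := rfl
theorem encSize_unary (n : Unary) : encSize n = 2 * n.val + 1 := Data.size_unary n.val

theorem encSize_bool_le (b : Bool) : encSize b ≤ 3 := by cases b <;> decide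

theorem one_le_encSize (a : α) : 1 ≤ encSize a := Data.one_le_size _

theorem encSize_le_of_mem {a : α} {l : List α} (h : a ∈ l) : encSize a + 2 ≤ encSize l := by
  induction l with
  | nil => simp at h
  | cons b l ih =>
    rw [encSize_cons]
    rcases List.mem_cons.1 h with rfl | h
    · have := one_le_encSize l; omega
    · have := ih h; omega

theorem two_mul_length_lt_encSize (l : List α) : 2 * l.length + 1 ≤ encSize l := by
  induction l with
  | nil => simp [encSize_nil]
  | cons b l ih =>
    rw [encSize_cons, List.length_cons]
    have := one_le_encSize b; omega

theorem encSize_append (l l' : List α) : encSize (l ++ l') + 1 = encSize l + encSize l' := by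
  induction l with
  | nil => simp [encSize_nil]; omega
  | cons b l ih => simp only [List.cons_append, encSize_cons]; omega

end Sizes

/-! ### Closure properties of polynomial time -/

namespace PolyTime

variable {α β γ σ α' β' : Type} [Encode α] [Encode β] [Encode γ] [Encode σ] [Encode α'] [Encode β']

/-- The second stage has to work on the values `g a` only, with its time measured by the size of
`a`. Loops need this form, since their bounds may fail on arbitrary states. -/
theorem of_relative {g : α → β} {f : α → γ} (hg : PolyTime g)
    (hf : ∃ (c : Prog) (h : Polynomial ℕ), ∀ a, RunsIn c (enc (g a)) (enc (f a))
      (h.eval (encSize a))) : PolyTime f := by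
  obtain ⟨c, h, hc⟩ := hg
  obtain ⟨c', h', hc'⟩ := hf
  refine ⟨.comp c' c, h + h' + 1, fun a => ?_⟩
  obtain ⟨s, hs, h1⟩ := hc a
  obtain ⟨t, ht, h2⟩ := hc' a
  refine ⟨s + t + 1, ?_, h1.comp h2⟩
  simp; omega

theorem encSize_le {f : α → β} (hf : PolyTime f) :
    ∃ h : Polynomial ℕ, ∀ a, encSize (f a) ≤ h.eval (encSize a) := by
  obtain ⟨c, h, hc⟩ := hf
  exact ⟨h, fun a => (hc a).size_le⟩

@[fun_prop]
theorem comp {f : β → γ} {g : α → β} (hf : PolyTime f) (hg : PolyTime g) :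
    PolyTime (fun a => f (g a)) := by
  obtain ⟨h, hh⟩ := hg.encSize_le
  refine of_relative hg ?_
  obtain ⟨c', h', hc'⟩ := hf
  refine ⟨c', h'.comp h, fun a => (hc' (g a)).mono ?_⟩
  rw [Polynomial.eval_comp]
  exact eval_monotone_nat h' (hh a)

/-- Programs see encodings only, so functions that agree on encodings share a program whatever their
types are. -/
theorem transfer {f : α → β} {f' : α' → β'} (hf : PolyTime f) (g : α' → α)
    (hg : ∀ a, enc (g a) = enc a) (h : ∀ a, enc (f (g a)) = enc (f' a)) : PolyTime f' := by
  obtain ⟨c, p, hc⟩ := hf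
  refine ⟨c, p, fun a => ?_⟩
  have := hc (g a)
  rwa [h, encSize, hg] at this

theorem congr {f g : α → β} (hf : PolyTime f) (h : ∀ a, f a = g a) : PolyTime g := by
  rwa [← funext h]

theorem of_enc {f : α → β} (hf : PolyTime (fun a => enc (f a))) : PolyTime f :=
  hf.transfer _root_.id (fun _ => rfl) (fun _ => rfl)

theorem to_enc {f : α → β} (hf : PolyTime f) : PolyTime (fun a => enc (f a)) :=
  hf.transfer _root_.id (fun _ => rfl) (fun _ => rfl)

@[fun_prop]
theorem id : PolyTime (fun a : α => a) := ⟨.id, .X, fun a => ⟨_, by simp, .id _⟩⟩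

@[fun_prop]
theorem fst : PolyTime (Prod.fst : α × β → α) := ⟨.head, .X, fun a => ⟨_, by simp, .head _⟩⟩

@[fun_prop]
theorem snd : PolyTime (Prod.snd : α × β → β) := ⟨.tail, .X, fun a => ⟨_, by simp, .tail _⟩⟩

@[fun_prop]
theorem pair {f : α → β} {g : α → γ} (hf : PolyTime f) (hg : PolyTime g) :
    PolyTime (fun a => (f a, g a)) := by
  obtain ⟨c, h, hc⟩ := hf
  obtain ⟨c', h', hc'⟩ := hg
  refine ⟨.pair c c', h + h' + .X, fun a => ?_⟩
  obtain ⟨s, hs, h1⟩ := hc a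
  obtain ⟨t, ht, h2⟩ := hc' a
  exact ⟨_, by simp; omega, h1.pair h2⟩

@[fun_prop]
theorem dataCons {f : α → β} {g : α → γ} (hf : PolyTime f) (hg : PolyTime g) :
    PolyTime (fun a => Data.cons (enc (f a)) (enc (g a))) :=
  (pair hf hg).transfer _root_.id (fun _ => rfl) (fun _ => rfl)

@[fun_prop]
theorem cons' {f g : α → Data} (hf : PolyTime f) (hg : PolyTime g) :
    PolyTime (fun a => Data.cons (f a) (g a)) := dataCons hf hg

@[fun_prop]
theorem const (b : β) : PolyTime (fun _ : α => b) := by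
  refine of_enc ?_
  generalize enc b = d
  induction d with
  | nil => exact ⟨.nil, 1, fun a => ⟨_, by simp, .nil _⟩⟩
  | cons d e hd he => exact cons' hd he

@[fun_prop]
theorem cons {f : α → β} {g : α → List β} (hf : PolyTime f) (hg : PolyTime g) :
    PolyTime (fun a => f a :: g a) :=
  (pair hf hg).transfer _root_.id (fun _ => rfl) (fun _ => rfl)

@[fun_prop]
theorem cond {p : α → Bool} {f g : α → β} (hp : PolyTime p) (hf : PolyTime f) (hg : PolyTime g) :
    PolyTime (fun a => bif p a then f a else g a) := by
  obtain ⟨c, h, hc⟩ := hf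
  obtain ⟨c', h', hc'⟩ := hg
  obtain ⟨c'', h'', hc''⟩ := hp
  refine ⟨.cond c'' c c', h + h' + h'' + .X, fun a => ?_⟩
  obtain ⟨s, hs, h1⟩ := hc a
  obtain ⟨t, ht, h2⟩ := hc' a
  obtain ⟨r, hr, h3⟩ := hc'' a
  cases hpa : p a
  · rw [hpa] at h3
    exact ⟨r + t + encSize a, by simp; omega, .cond_false h3 (by simpa [hpa] using h2)⟩
  · rw [hpa] at h3
    exact ⟨r + s + encSize a, by simp; omega,
      .cond_true h3 (by simp [enc_true]) (by simpa [hpa] using h1)⟩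

@[fun_prop]
theorem ite {p : α → Bool} {f g : α → β} (hp : PolyTime p) (hf : PolyTime f) (hg : PolyTime g) :
    PolyTime (fun a => if p a then f a else g a) :=
  (cond hp hf hg).congr fun a => by cases p a <;> rfl

@[fun_prop]
theorem not {p : α → Bool} (hp : PolyTime p) : PolyTime (fun a => !p a) :=
  (cond hp (const false) (const true)).congr fun a => by cases p a <;> rfl

@[fun_prop]
theorem and {p q : α → Bool} (hp : PolyTime p) (hq : PolyTime q) : PolyTime (fun a => p a && q a) :=
  (cond hp hq (const false)).congr fun a => by cases p a <;> rfl

@[fun_prop]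
theorem or {p q : α → Bool} (hp : PolyTime p) (hq : PolyTime q) : PolyTime (fun a => p a || q a) :=
  (cond hp (const true) hq).congr fun a => by cases p a <;> rfl

theorem head : PolyTime Data.head := ⟨.head, .X, fun a => ⟨_, by simp, .head _⟩⟩

theorem tail : PolyTime Data.tail := ⟨.tail, .X, fun a => ⟨_, by simp, .tail _⟩⟩

theorem isNil : PolyTime Data.isNil := by
  refine ⟨.cond .id .nil (.pair .nil .nil), 2 * .X + 3, fun a => ?_⟩
  rw [enc_data, encSize, enc_data]
  cases a with
  | nil =>
    refine ⟨_, ?_, .cond_false (.id _) (.pair (.nil _) (.nil _))⟩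
    simp [Data.size]
  | cons a b =>
    refine ⟨_, ?_, .cond_true (.id _) (by simp) (.nil _)⟩
    simp; omega

/-! ### Lists -/

@[fun_prop]
theorem isEmpty {l : α → List β} (hl : PolyTime l) : PolyTime (fun a => (l a).isEmpty) :=
  (isNil.comp hl.to_enc).congr fun a => by cases h : l a <;> rfl

@[fun_prop]
theorem listTail {l : α → List β} (hl : PolyTime l) : PolyTime (fun a => (l a).tail) :=
  of_enc <| (tail.comp hl.to_enc).congr fun a => by cases h : l a <;> rfl

@[fun_prop]
theorem headD {l : α → List β} {d : α → β} (hl : PolyTime l) (hd : PolyTime d) :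
    PolyTime (fun a => (l a).headD (d a)) :=
  of_enc <| (cond hl.isEmpty hd.to_enc (head.comp hl.to_enc)).congr fun a => by
    cases h : l a <;> rfl

/-- The fold is one `loop` whose state carries the rest of the list. As `B` bounds the accumulators
of all prefixes, every pass has the same polynomial cost bound. -/
theorem runsIn_foldl {step : α → σ → β → σ}
    (hstep : PolyTime fun x : α × σ × β => step x.1 x.2.1 x.2.2) :
    ∃ (c : Prog) (h : Polynomial ℕ), ∀ a s l B,
      (∀ l', l' <+: l → encSize (l'.foldl (step a) s) ≤ B) →
      RunsIn c (enc (a, l, s)) (enc (a, ([] : List β), l.foldl (step a) s))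
        ((l.length + 1) * h.eval (encSize a + encSize l + B + 2)) := by
  -- A nonempty list has the same encoding as the pair of its head and its tail, so the loop body
  -- may be typed on pairs.
  have hbody : PolyTime fun x : α × (β × List β) × σ =>
      (x.1, x.2.1.2, step x.1 x.2.2 x.2.1.1) := by
    have : PolyTime fun x : α × (β × List β) × σ => step x.1 x.2.2 x.2.1.1 :=
      hstep.comp (g := fun x : α × (β × List β) × σ => (x.1, x.2.2, x.2.1.1)) (by fun_prop)
    fun_prop
  have htest : PolyTime fun x : α × List β × σ => x.2.1 := by fun_prop
  obtain ⟨f, hf, Hf⟩ := hbody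
  obtain ⟨c, hc, Hc⟩ := htest
  refine ⟨.loop c f, hf + hc + .X, fun a s l B hB => ?_⟩
  induction l generalizing s with
  | nil =>
    obtain ⟨r, hr, h⟩ := Hc (a, [], s)
    refine ⟨_, ?_, .loop_done h⟩
    have h1 := hB [] (List.prefix_refl _)
    have h2 : encSize (a, ([] : List β), s) ≤ encSize a + encSize ([] : List β) + B + 2 := by
      simp only [encSize_pair, List.foldl_nil] at h1 ⊢; omega
    have h3 := eval_monotone_nat hc h2
    simp only [Polynomial.eval_add, Polynomial.eval_X, List.length_nil, zero_add, one_mul]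
    dsimp only at h3
    change r + encSize (a, ([] : List β), s) ≤ _
    omega
  | cons x l ih =>
    obtain ⟨r, hr, h⟩ := Hc (a, x :: l, s)
    obtain ⟨q, hq, h'⟩ := Hf (a, (x, l), s)
    have hB' : ∀ l', l' <+: l → encSize (l'.foldl (step a) (step a s x)) ≤ B := fun l' hl' =>
      hB (x :: l') ((List.prefix_cons_inj x).2 hl')
    obtain ⟨t, ht, h''⟩ := ih _ hB'
    refine ⟨_, ?_, .loop_step h (by simp [enc_cons]) h' h''⟩
    have h1 := hB [] List.nil_prefix
    have h2 : encSize (a, x :: l, s) ≤ encSize a + encSize (x :: l) + B + 2 := by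
      simp only [encSize_pair, List.foldl_nil] at h1 ⊢; omega
    have h3 := eval_monotone_nat hc h2
    have h4 := eval_monotone_nat hf h2
    have h5 : t ≤ (l.length + 1) * (hf + hc + .X : Polynomial ℕ).eval
        (encSize a + encSize (x :: l) + B + 2) := by
      refine ht.trans (Nat.mul_le_mul_left _ (eval_monotone_nat _ ?_))
      simp only [encSize_cons]; omega
    have h6 : encSize (a, (x, l), s) = encSize (a, x :: l, s) := rfl
    rw [h6] at hq
    rw [List.length_cons, Nat.succ_mul]
    generalize (l.length + 1) * (hf + hc + .X : Polynomial ℕ).eval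
        (encSize a + encSize (x :: l) + B + 2) = K at *
    simp only [Polynomial.eval_add, Polynomial.eval_X]
    dsimp only at h3 h4
    change r + q + t + encSize (a, x :: l, s) ≤ _
    omega

theorem foldl_of_bound {init : α → σ} {step : α → σ → β → σ} {l : α → List β}
    (hinit : PolyTime init) (hstep : PolyTime fun x : α × σ × β => step x.1 x.2.1 x.2.2)
    (hl : PolyTime l) (b : Polynomial ℕ)
    (hb : ∀ a l', l' <+: l a → encSize (l'.foldl (step a) (init a)) ≤ b.eval (encSize a)) :
    PolyTime (fun a => (l a).foldl (step a) (init a)) := by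
  obtain ⟨c, h, hc⟩ := runsIn_foldl hstep
  obtain ⟨q, hq⟩ := hl.encSize_le
  have h1 : PolyTime fun a => (a, ([] : List β), (l a).foldl (step a) (init a)) := by
    refine of_relative (g := fun a => (a, l a, init a)) (by fun_prop) ⟨c, ?_⟩
    refine ⟨q * h.comp (.X + q + b + 2), fun a => (hc a _ _ _ (hb a)).mono ?_⟩
    rw [Polynomial.eval_mul, Polynomial.eval_comp]
    have h2 : (l a).length + 1 ≤ q.eval (encSize a) := by
      rcases h : l a with _ | ⟨x, l'⟩
      · exact (one_le_encSize _).trans (hq a)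
      · have h1 := two_mul_length_lt_encSize (l a)
        have h2 := hq a
        rw [h] at h1 h2
        rw [List.length_cons] at *
        omega
    refine Nat.mul_le_mul h2 (eval_monotone_nat _ ?_)
    have := hq a
    simp
    omega
  exact (snd.comp (snd.comp h1))

/-- A step that runs in polynomial time is not enough, as it might double the accumulator each time.
Growth by a summand that depends on the input alone keeps it polynomial. The invariant restricts
this requirement to the states that occur. -/
theorem foldl_of_growth {init : α → σ} {step : α → σ → β → σ} {l : α → List β}
    (hinit : PolyTime init) (hstep : PolyTime fun x : α × σ × β => step x.1 x.2.1 x.2.2)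
    (hl : PolyTime l) (inv : α → σ → Prop) (h0 : ∀ a, inv a (init a))
    (hs : ∀ a s, ∀ x ∈ l a, inv a s → inv a (step a s x)) (b : Polynomial ℕ)
    (hb : ∀ a s, ∀ x ∈ l a, inv a s →
      encSize (step a s x) ≤ encSize s + b.eval (encSize a)) :
    PolyTime (fun a => (l a).foldl (step a) (init a)) := by
  obtain ⟨q, hq⟩ := hl.encSize_le
  obtain ⟨r, hr⟩ := hinit.encSize_le
  refine foldl_of_bound hinit hstep hl (r + q * b) fun a l' hl' => ?_
  have key : ∀ l' : List β, (∀ x ∈ l', x ∈ l a) → ∀ s, inv a s →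
      encSize (l'.foldl (step a) s) ≤ encSize s + l'.length * b.eval (encSize a) := by
    intro l' hl' 
    induction l' with
    | nil => simp
    | cons x l' ih =>
      intro s his
      have hx := hl' x List.mem_cons_self
      have h1 := ih (fun y hy => hl' y (List.mem_cons_of_mem _ hy)) _ (hs a s x hx his)
      have h2 := hb a s x hx his
      simp only [List.foldl_cons, List.length_cons, Nat.succ_mul]
      omega
  refine (key l' (fun x hx => hl'.subset hx) _ (h0 a)).trans ?_
  simp only [Polynomial.eval_add, Polynomial.eval_mul]
  refine Nat.add_le_add (hr a) (Nat.mul_le_mul_right _ ?_)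
  have h1 := hl'.length_le
  have h2 := two_mul_length_lt_encSize (l a)
  have h3 := hq a
  omega

@[fun_prop]
theorem reverse {l : α → List β} (hl : PolyTime l) : PolyTime (fun a => (l a).reverse) := by
  obtain ⟨q, hq⟩ := hl.encSize_le
  have := foldl_of_growth (init := fun _ : α => ([] : List β)) (step := fun _ s x => x :: s)
    (by fun_prop) (by fun_prop) hl (fun _ _ => True) (fun _ => trivial) (fun _ _ _ _ _ => trivial)
    q (fun a s x hx _ => by
      have h1 := encSize_le_of_mem hx
      have h2 := hq a
      rw [encSize_cons]; omega)
  exact this.congr fun a => by simp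

@[fun_prop]
theorem append {l l' : α → List β} (hl : PolyTime l) (hl' : PolyTime l') :
    PolyTime (fun a => l a ++ l' a) := by
  obtain ⟨q, hq⟩ := hl.encSize_le
  have := foldl_of_growth (init := l') (step := fun _ s x => x :: s)
    hl' (by fun_prop) hl.reverse (fun _ _ => True) (fun _ => trivial) (fun _ _ _ _ _ => trivial)
    q (fun a s x hx _ => by
      have h1 := encSize_le_of_mem (List.mem_reverse.1 hx)
      have h2 := hq a
      rw [encSize_cons]; omega)
  exact this.congr fun a => by simp

theorem encSize_apply_mem_le {l : α → List β} {f : α → β → γ} (hl : PolyTime l)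
    (hf : PolyTime fun x : α × β => f x.1 x.2) :
    ∃ q : Polynomial ℕ, ∀ a, ∀ x ∈ l a, encSize (f a x) ≤ q.eval (encSize a) := by
  obtain ⟨q, hq⟩ := hl.encSize_le
  obtain ⟨r, hr⟩ := hf.encSize_le
  refine ⟨r.comp (.X + q), fun a x hx => (hr (a, x)).trans ?_⟩
  rw [Polynomial.eval_comp]
  refine eval_monotone_nat _ ?_
  have h1 := encSize_le_of_mem hx
  have h2 := hq a
  simp [encSize_pair]; omega

theorem flatMap {l : α → List β} {f : α → β → List γ} (hl : PolyTime l)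
    (hf : PolyTime fun x : α × β => f x.1 x.2) : PolyTime (fun a => (l a).flatMap (f a)) := by
  obtain ⟨q, hq⟩ := encSize_apply_mem_le hl hf
  have := foldl_of_growth (init := fun _ : α => ([] : List γ)) (step := fun a s x => s ++ f a x)
    (by fun_prop) (append (by fun_prop)
      (hf.comp (g := fun x : α × List γ × β => (x.1, x.2.2)) (by fun_prop)))
    hl (fun _ _ => True) (fun _ => trivial) (fun _ _ _ _ _ => trivial) q (fun a s x hx _ => by
      have h1 := hq a x hx
      have h2 := encSize_append s (f a x)
      omega)
  exact this.congr fun a => by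
    rw [← List.nil_append ((l a).flatMap (f a))]
    generalize ([] : List γ) = s
    induction l a generalizing s with
    | nil => simp
    | cons x l ih => simp [ih]

theorem map {l : α → List β} {f : α → β → γ} (hl : PolyTime l)
    (hf : PolyTime fun x : α × β => f x.1 x.2) : PolyTime (fun a => (l a).map (f a)) :=
  (flatMap (f := fun a x => [f a x]) hl (by fun_prop)).congr fun a => by
    rw [List.map_eq_flatMap]

theorem filter {l : α → List β} {p : α → β → Bool} (hl : PolyTime l)
    (hp : PolyTime fun x : α × β => p x.1 x.2) : PolyTime (fun a => (l a).filter (p a)) :=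
  (flatMap (f := fun a x => if p a x then [x] else []) hl (by fun_prop)).congr fun a => by
    induction l a with
    | nil => rfl
    | cons x l ih => rw [List.flatMap_cons, ih, List.filter_cons]; split <;> simp

theorem any {l : α → List β} {p : α → β → Bool} (hl : PolyTime l)
    (hp : PolyTime fun x : α × β => p x.1 x.2) : PolyTime (fun a => (l a).any (p a)) :=
  (filter hl hp).isEmpty.not.congr fun a => by
    induction l a with
    | nil => rfl
    | cons x l ih => rw [List.filter_cons, List.any_cons, ← ih]; cases p a x <;> simp

theorem all {l : α → List β} {p : α → β → Bool} (hl : PolyTime l)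
    (hp : PolyTime fun x : α × β => p x.1 x.2) : PolyTime (fun a => (l a).all (p a)) :=
  (any (p := fun a x => !p a x) hl (by fun_prop)).not.congr fun a => by
    simp [List.all_eq_not_any_not]

end PolyTime

namespace PolyTime

variable {α β γ σ : Type} [Encode α] [Encode β] [Encode γ] [Encode σ]

/-! ### Unary arithmetic -/

/-- A unary number and a list of units are the same tree, so unary arithmetic is inherited from
operations on lists. -/
theorem enc_replicate (n : ℕ) : enc (List.replicate n ()) = Data.unary n := by
  induction n with
  | zero => rfl
  | succ n ih => rw [List.replicate_succ, enc_cons, ih]; rfl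

@[fun_prop]
theorem units {n : α → Unary} (hn : PolyTime n) :
    PolyTime (fun a => List.replicate (n a).val ()) :=
  hn.transfer _root_.id (fun _ => rfl) fun _ => (enc_replicate _).symm

theorem ofUnits {n : α → ℕ} (hn : PolyTime fun a => List.replicate (n a) ()) :
    PolyTime (fun a => (⟨n a⟩ : Unary)) :=
  hn.transfer _root_.id (fun _ => rfl) fun _ => enc_replicate _

@[fun_prop]
theorem length {l : α → List β} (hl : PolyTime l) : PolyTime (fun a => (⟨(l a).length⟩ : Unary)) :=
  ofUnits <| (map (f := fun _ _ => ()) hl (by fun_prop)).congr fun a => by simp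

theorem length_units {l : α → List Unit} (hl : PolyTime l) {n : α → ℕ}
    (h : ∀ a, (l a).length = n a) : PolyTime (fun a => (⟨n a⟩ : Unary)) :=
  hl.length.congr fun a => by rw [h]

@[fun_prop]
theorem unarySucc {n : α → Unary} (hn : PolyTime n) :
    PolyTime (fun a => (⟨(n a).val + 1⟩ : Unary)) :=
  length_units (l := fun a => () :: List.replicate (n a).val ()) (by fun_prop) (by simp)

@[fun_prop]
theorem unaryPred {n : α → Unary} (hn : PolyTime n) :
    PolyTime (fun a => (⟨(n a).val - 1⟩ : Unary)) :=
  length_units (l := fun a => (List.replicate (n a).val ()).tail) (by fun_prop) (by simp)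

@[fun_prop]
theorem unaryAdd {m n : α → Unary} (hm : PolyTime m) (hn : PolyTime n) :
    PolyTime (fun a => (⟨(m a).val + (n a).val⟩ : Unary)) :=
  length_units (l := fun a => List.replicate (m a).val () ++ List.replicate (n a).val ())
    (by fun_prop) (by simp)

@[fun_prop]
theorem unaryMul {m n : α → Unary} (hm : PolyTime m) (hn : PolyTime n) :
    PolyTime (fun a => (⟨(m a).val * (n a).val⟩ : Unary)) :=
  length_units (l := fun a => (List.replicate (m a).val ()).flatMap
    fun _ => List.replicate (n a).val ()) (flatMap (by fun_prop) (by fun_prop)) (by simp)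

theorem iterate_of_growth {n : α → Unary} {init : α → σ} {step : α → σ → σ}
    (hn : PolyTime n) (hinit : PolyTime init) (hstep : PolyTime fun x : α × σ => step x.1 x.2)
    (inv : α → σ → Prop) (h0 : ∀ a, inv a (init a)) (hs : ∀ a s, inv a s → inv a (step a s))
    (b : Polynomial ℕ) (hb : ∀ a s, inv a s → encSize (step a s) ≤ encSize s + b.eval (encSize a)) :
    PolyTime (fun a => (step a)^[(n a).val] (init a)) := by
  have := foldl_of_growth (step := fun a s (_ : Unit) => step a s) hinit
    (hstep.comp (g := fun x : α × σ × Unit => (x.1, x.2.1)) (by fun_prop)) hn.units inv h0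
    (fun a s _ _ => hs a s) b (fun a s _ _ => hb a s)
  exact this.congr fun a => by
    generalize init a = s
    induction (n a).val generalizing s with
    | zero => rfl
    | succ n ih => rw [List.replicate_succ, List.foldl_cons, ih, Function.iterate_succ_apply]

@[fun_prop]
theorem unarySub {m n : α → Unary} (hm : PolyTime m) (hn : PolyTime n) :
    PolyTime (fun a => (⟨(m a).val - (n a).val⟩ : Unary)) :=
  (iterate_of_growth (step := fun _ (s : Unary) => ⟨s.val - 1⟩) hn hm (by fun_prop)
    (fun _ _ => True) (fun _ => trivial) (fun _ _ _ => trivial) 0 (fun a s _ => by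
      simp only [encSize_unary]; omega)).congr fun a => by
    generalize (n a).val = k
    generalize m a = s
    induction k generalizing s with
    | zero => rfl
    | succ n ih =>
      rw [Function.iterate_succ_apply, ih]
      simp only [Nat.sub_sub, Nat.add_comm]

@[fun_prop]
theorem unaryLe {m n : α → Unary} (hm : PolyTime m) (hn : PolyTime n) :
    PolyTime (fun a => decide ((m a).val ≤ (n a).val)) :=
  (isEmpty (unarySub hm hn).units).congr fun a => by
    simp [Nat.sub_eq_zero_iff_le]

@[fun_prop]
theorem unaryLt {m n : α → Unary} (hm : PolyTime m) (hn : PolyTime n) :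
    PolyTime (fun a => decide ((m a).val < (n a).val)) :=
  unaryLe (m := fun a => ⟨(m a).val + 1⟩) (by fun_prop) hn

@[fun_prop]
theorem unaryEq {m n : α → Unary} (hm : PolyTime m) (hn : PolyTime n) :
    PolyTime (fun a => decide ((m a).val = (n a).val)) :=
  (and (unaryLe hm hn) (unaryLe hn hm)).congr fun a => by
    simp [le_antisymm_iff]

/-- Supplies the fuel of clocked simulations from a given polynomial time bound. -/
theorem unaryPolynomial (h : Polynomial ℕ) {n : α → Unary} (hn : PolyTime n) :
    PolyTime (fun a => (⟨h.eval (n a).val⟩ : Unary)) := by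
  induction h using Polynomial.induction_on' with
  | add p q hp hq =>
    simpa using unaryAdd hp hq
  | monomial k c =>
    simp only [Polynomial.eval_monomial]
    refine unaryMul (m := fun _ => ⟨c⟩) (n := fun a => ⟨(n a).val ^ k⟩) (const _) ?_
    induction k with
    | zero => simpa using const _
    | succ k ih => simpa [pow_succ] using unaryMul ih hn

/-- The list of the natural numbers below `n`, in unary. -/
def _root_.LogicalInduction.unaryRange (n : ℕ) : List Unary := (List.range n).map Unary.mk

theorem _root_.LogicalInduction.mem_unaryRange {n : ℕ} {k : Unary} :
    k ∈ unaryRange n ↔ k.val < n := by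
  simp only [unaryRange, List.mem_map, List.mem_range]
  exact ⟨by rintro ⟨j, hj, rfl⟩; exact hj, fun h => ⟨k.val, h, rfl⟩⟩

@[fun_prop]
theorem range {n : α → Unary} (hn : PolyTime n) : PolyTime (fun a => unaryRange (n a).val) := by
  obtain ⟨q, hq⟩ := hn.encSize_le
  have := iterate_of_growth (n := n) (init := fun a => (n a, ([] : List Unary)))
    (step := fun _ s => (⟨s.1.val - 1⟩, ⟨s.1.val - 1⟩ :: s.2)) hn (by fun_prop) (by fun_prop)
    (fun a s => s.1.val ≤ (n a).val) (fun a => le_rfl)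
    (fun a s h => (Nat.sub_le _ _).trans h) (q + 2)
    (fun a s h => by
      have := hq a
      rcases s with ⟨s, l⟩
      simp [encSize_pair, encSize_cons, encSize_unary] at *
      omega)
  refine (snd.comp this).congr fun a => ?_
  -- Counting down while prepending yields the list in increasing order.
  have key : ∀ m k : ℕ, (fun s : Unary × List Unary => ((⟨s.1.val - 1⟩, ⟨s.1.val - 1⟩ :: s.2) :
      Unary × List Unary))^[k] (⟨m + k⟩, []) = (⟨m⟩, (List.range' m k).map Unary.mk) := by
    intro m k
    induction k generalizing m with
    | zero => rfl
    | succ k ih =>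
      rw [Function.iterate_succ_apply', show m + (k + 1) = (m + 1) + k by ring, ih]
      simp [List.range'_succ]
  have := key 0 (n a).val
  rw [zero_add] at this
  rw [this, unaryRange, List.range_eq_range']

/-! ### While loops and structural size -/

/-- The number `N` of passes is not an input of the program. This is what is needed to compute the
size of a tree, which later serves as the number of passes of other loops. -/
theorem runsIn_while {test : σ → Bool} {step : σ → σ} (ht : PolyTime test) (hs : PolyTime step) :
    ∃ (c : Prog) (h : Polynomial ℕ), ∀ N s B,
      (∀ k < N, test (step^[k] s) = true) → test (step^[N] s) = false →
      (∀ k ≤ N, encSize (step^[k] s) ≤ B) →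
      RunsIn c (enc s) (enc (step^[N] s)) ((N + 1) * h.eval B) := by
  obtain ⟨f, hf, Hf⟩ := hs
  obtain ⟨c, hc, Hc⟩ := ht
  refine ⟨.loop c f, hf + hc + .X, fun N s B h1 h2 hB => ?_⟩
  induction N generalizing s with
  | zero =>
    obtain ⟨r, hr, h⟩ := Hc s
    rw [show test s = false from h2] at h
    refine ⟨_, ?_, .loop_done h⟩
    have h3 := hB 0 le_rfl
    have h4 := eval_monotone_nat hc h3
    dsimp at h4 h3
    simp only [Polynomial.eval_add, Polynomial.eval_X, zero_add, one_mul]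
    change r + encSize s ≤ _
    omega
  | succ N ih =>
    obtain ⟨r, hr, h⟩ := Hc s
    obtain ⟨q, hq, h'⟩ := Hf s
    obtain ⟨t, ht, h''⟩ := ih (step s) (fun k hk => h1 (k + 1) (by omega)) h2
      (fun k hk => hB (k + 1) (by omega))
    rw [show test s = true from h1 0 (by omega)] at h
    refine ⟨_, ?_, .loop_step h (by simp [enc_true]) h' h''⟩
    have h3 := hB 0 (by omega)
    have h4 := eval_monotone_nat hc h3
    have h5 := eval_monotone_nat hf h3
    dsimp at h3 h4 h5
    rw [Nat.succ_mul]
    generalize (N + 1) * (hf + hc + .X : Polynomial ℕ).eval B = K at *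
    simp only [Polynomial.eval_add, Polynomial.eval_X]
    change r + q + t + encSize s ≤ _
    omega

@[fun_prop]
theorem dataHead {f : α → Data} (hf : PolyTime f) : PolyTime (fun a => (f a).head) := head.comp hf

@[fun_prop]
theorem dataTail {f : α → Data} (hf : PolyTime f) : PolyTime (fun a => (f a).tail) := tail.comp hf

@[fun_prop]
theorem dataIsNil {f : α → Data} (hf : PolyTime f) : PolyTime (fun a => (f a).isNil) :=
  isNil.comp hf

/-- One step of counting the nodes of a stack of trees. -/
def sizeStep (s : Unary × List Data) : Unary × List Data :=
  (⟨s.1.val + 1⟩, bif (s.2.headD .nil).isNil then s.2.tail else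
    (s.2.headD .nil).head :: (s.2.headD .nil).tail :: s.2.tail)

/-- Each step takes one node off the stack and counts it, so the count plus the number of remaining
nodes is constant. -/
theorem sizeStep_iterate (N : ℕ) (s : Unary × List Data)
    (hN : N ≤ (s.2.map Data.size).sum) :
    (sizeStep^[N] s).1.val = s.1.val + N ∧
      ((sizeStep^[N] s).2.map Data.size).sum + N = (s.2.map Data.size).sum := by
  induction N generalizing s with
  | zero => simp
  | succ N ih =>
    have h : (sizeStep s).1.val = s.1.val + 1 ∧
        ((sizeStep s).2.map Data.size).sum + 1 = (s.2.map Data.size).sum := by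
      rcases s with ⟨n, _ | ⟨_ | ⟨a, b⟩, st⟩⟩
      · simp at hN
      · simp [sizeStep, Data.isNil, Data.size]; omega
      · simp [sizeStep, Data.isNil, Data.size, Data.head, Data.tail]; omega
    have := ih (sizeStep s) (by omega)
    rw [Function.iterate_succ_apply]
    omega

theorem encSize_dataList_le (l : List Data) : encSize l ≤ 2 * (l.map Data.size).sum + 1 := by
  induction l with
  | nil => simp [encSize_nil]
  | cons d l ih =>
    have := d.one_le_size
    rw [encSize_cons, List.map_cons, List.sum_cons]
    change d.size + _ + 1 ≤ _
    omega

theorem map_size_sum_eq_zero {l : List Data} : (l.map Data.size).sum = 0 ↔ l = [] := by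
  cases l with
  | nil => simp
  | cons d l => have := d.one_le_size; simp; omega

@[fun_prop]
theorem size {f : α → Data} (hf : PolyTime f) : PolyTime (fun a => (⟨(f a).size⟩ : Unary)) := by
  refine comp (f := fun d : Data => (⟨d.size⟩ : Unary)) ?_ hf
  obtain ⟨c, h, hc⟩ := runsIn_while (σ := Unary × List Data) (test := fun s => !s.2.isEmpty)
    (step := sizeStep) (by fun_prop) (by unfold sizeStep; fun_prop)
  have h1 : PolyTime fun d : Data => sizeStep^[d.size] (⟨0⟩, [d]) := by
    refine of_relative (g := fun d : Data => ((⟨0⟩ : Unary), [d])) (by fun_prop)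
      ⟨c, (.X + 1) * h.comp (4 * .X + 3), fun d => ?_⟩
    have key := fun N hN => sizeStep_iterate N (⟨0⟩, [d]) hN
    simp only [List.map_cons, List.map_nil, List.sum_cons, List.sum_nil, add_zero, zero_add] at key
    refine (hc d.size (⟨0⟩, [d]) (4 * d.size + 3) (fun k hk => ?_) ?_ fun k hk => ?_).mono ?_
    · have := (key k hk.le).2
      simp only [Bool.not_eq_true', List.isEmpty_eq_false_iff, ne_eq]
      rw [← map_size_sum_eq_zero]; omega
    · have := (key d.size le_rfl).2
      simp only [Bool.not_eq_false', List.isEmpty_iff]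
      rw [← map_size_sum_eq_zero]; omega
    · obtain ⟨h1, h2⟩ := key k hk
      have h3 := encSize_dataList_le (sizeStep^[k] (⟨0⟩, [d])).2
      have h4 : encSize (sizeStep^[k] (⟨0⟩, [d])) = encSize (sizeStep^[k] (⟨0⟩, [d])).1 +
        encSize (sizeStep^[k] (⟨0⟩, [d])).2 + 1 := rfl
      rw [h4, encSize_unary]
      omega
    · simp [encSize, enc_data]
  exact (fst.comp h1).congr fun d =>
    Unary.ext ((sizeStep_iterate d.size (⟨0⟩, [d]) (by simp)).1.trans (zero_add _))

/-! ### Equality of data -/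

/-- One step of comparing a stack of pairs of trees. -/
def eqStep (s : Bool × List (Data × Data)) : Bool × List (Data × Data) :=
  bif s.2.isEmpty then s else
  bif (s.2.headD (.nil, .nil)).1.isNil then
    bif (s.2.headD (.nil, .nil)).2.isNil then (s.1, s.2.tail) else (false, [])
  else
    bif (s.2.headD (.nil, .nil)).2.isNil then (false, []) else
    (s.1, ((s.2.headD (.nil, .nil)).1.head, (s.2.headD (.nil, .nil)).2.head) ::
      ((s.2.headD (.nil, .nil)).1.tail, (s.2.headD (.nil, .nil)).2.tail) :: s.2.tail)

/-- Each step on a nonempty stack uses up one node of a left tree or empties the stack, so the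
number of left nodes bounds the number of steps. -/
theorem eqStep_iterate (N : ℕ) (s : Bool × List (Data × Data))
    (hN : (s.2.map fun x => x.1.size).sum ≤ N) :
    (eqStep^[N] s).1 = true ↔ s.1 = true ∧ ∀ x ∈ s.2, x.1 = x.2 := by
  induction N generalizing s with
  | zero =>
    rcases s with ⟨b, _ | ⟨x, l⟩⟩
    · simp
    · have := x.1.one_le_size
      simp at hN; omega
  | succ N ih =>
    rw [Function.iterate_succ_apply]
    have h0 : ∀ b, (eqStep^[N] (b, [])).1 = true ↔ b = true := fun b => by
      simpa using ih (b, []) (by simp)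
    rcases s with ⟨b, _ | ⟨⟨_ | ⟨x, x'⟩, _ | ⟨y, y'⟩⟩, l⟩⟩
    · simpa [eqStep] using h0 b
    · simp only [eqStep, Data.isNil, List.headD_cons, List.isEmpty_cons, cond_true, cond_false,
        List.tail_cons]
      rw [ih _ (by simp [Data.size] at hN ⊢; omega)]
      simp
    · simp only [eqStep, Data.isNil, List.headD_cons, List.isEmpty_cons, cond_true, cond_false]
      rw [h0]; simp
    · simp only [eqStep, Data.isNil, List.headD_cons, List.isEmpty_cons, cond_true, cond_false]
      rw [h0]; simp
    · simp only [eqStep, Data.isNil, List.headD_cons, List.isEmpty_cons, cond_false,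
        List.tail_cons, Data.head, Data.tail]
      rw [ih _ (by simp [Data.size] at hN ⊢; omega)]
      simp [and_assoc]

open scoped Classical in
theorem dataEq {f g : α → Data} (hf : PolyTime f) (hg : PolyTime g) :
    PolyTime (fun a => decide (f a = g a)) := by
  have h := iterate_of_growth (α := α) (n := fun a => ⟨(f a).size⟩)
    (init := fun a => (true, [(f a, g a)])) (step := fun _ s => eqStep s)
    (by fun_prop) (by fun_prop) (by unfold eqStep; fun_prop)
    (fun _ _ => True) (fun _ => trivial) (fun _ _ _ => trivial) 0 (fun a s _ => by
      rcases s with ⟨b, _ | ⟨⟨_ | ⟨x, x'⟩, _ | ⟨y, y'⟩⟩, l⟩⟩ <;>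
      simp [eqStep, Data.isNil, encSize_pair, encSize_cons, encSize_nil, encSize, enc_data,
        Data.size, enc_false, Data.head, Data.tail] <;>
      have := (enc b).one_le_size <;> omega)
  exact (fst.comp h).congr fun a => by
    rw [Bool.eq_iff_iff, eqStep_iterate _ _ (by simp)]
    simp

theorem eq_of_injective [DecidableEq β] (hinj : Function.Injective (enc : β → Data)) {f g : α → β}
    (hf : PolyTime f) (hg : PolyTime g) : PolyTime (fun a => decide (f a = g a)) :=
  (dataEq hf.to_enc hg.to_enc).congr fun a => by rw [decide_eq_decide, hinj.eq_iff]

/-! ### Binary numbers -/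

/-- The successor of a number written in binary. -/
def bitsSucc : List Bool → List Bool
  | [] => [true]
  | false :: l => true :: l
  | true :: l => false :: bitsSucc l

theorem bits_succ (n : ℕ) : (n + 1).bits = bitsSucc n.bits := by
  induction n using Nat.binaryRec' with
  | zero => simp [bitsSucc]
  | bit b n h ih =>
    rw [Nat.bits_append_bit n b h]
    cases b
    · rw [bitsSucc, ← Nat.bit1_bits]; rfl
    · rw [bitsSucc, ← ih, ← Nat.bit0_bits _ (by omega)]
      congr 1

theorem encSize_bitsSucc (l : List Bool) : encSize (bitsSucc l) ≤ encSize l + 4 := by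
  induction l with
  | nil => decide
  | cons b l ih =>
    cases b
    · simp [bitsSucc, encSize_cons, encSize, enc_true, enc_false, Data.size]; omega
    · simp [bitsSucc, encSize_cons, encSize, enc_true, enc_false, Data.size] at *; omega

/-- The recursion for the successor as a scan from the least significant bit; the state is the carry
and the reversed output. -/
theorem bitsSucc_eq_foldl (l : List Bool) (c : Bool) (acc : List Bool) :
    (fun s : Bool × List Bool => (bif s.1 then true :: s.2 else s.2).reverse)
      (l.foldl (fun s b => (s.1 && b, (bif s.1 then !b else b) :: s.2)) (c, acc)) =
      acc.reverse ++ bif c then bitsSucc l else l := by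
  induction l generalizing c acc with
  | nil => cases c <;> simp [bitsSucc]
  | cons b l ih =>
    rw [List.foldl_cons, ih]
    cases b <;> cases c <;> simp [bitsSucc]

theorem bitsSucc_polyTime : PolyTime bitsSucc := by
  have h := foldl_of_growth (init := fun _ : List Bool => (true, ([] : List Bool)))
    (step := fun _ s b => (s.1 && b, (bif s.1 then !b else b) :: s.2)) (by fun_prop) (by fun_prop)
    PolyTime.id (fun _ _ => True) (fun _ => trivial) (fun _ _ _ _ _ => trivial) 6
    (fun _ s x _ _ => by
      have h1 := encSize_bool_le (s.1 && x)
      have h2 := encSize_bool_le (bif s.1 then !x else x)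
      have h3 : encSize s = encSize s.1 + encSize s.2 + 1 := rfl
      have h4 := one_le_encSize s.1
      simp [encSize_pair, encSize_cons] at *
      omega)
  have h2 := comp (f := fun s : Bool × List Bool => (bif s.1 then true :: s.2 else s.2).reverse)
    (by fun_prop) h
  exact h2.congr fun l => by
    have := bitsSucc_eq_foldl l true []
    simpa using this

@[fun_prop]
theorem natSucc {n : α → ℕ} (hn : PolyTime n) : PolyTime (fun a => n a + 1) := by
  have h : PolyTime fun a => (n a).bits := hn.transfer _root_.id (fun _ => rfl) (fun _ => rfl)
  exact (bitsSucc_polyTime.comp h).transfer _root_.id (fun _ => rfl) fun a => by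
    simp only [_root_.id, ← bits_succ]; rfl

theorem encSize_nat_succ (n : ℕ) : encSize (n + 1) ≤ encSize n + 4 := by
  have := encSize_bitsSucc n.bits
  rwa [← bits_succ] at this

@[fun_prop]
theorem natAddUnary {m : α → ℕ} {n : α → Unary} (hm : PolyTime m) (hn : PolyTime n) :
    PolyTime (fun a => m a + (n a).val) :=
  (iterate_of_growth (step := fun _ (s : ℕ) => s + 1) hn hm (by fun_prop)
    (fun _ _ => True) (fun _ => trivial) (fun _ _ _ => trivial) 4
    (fun a s _ => by simpa using encSize_nat_succ s)).congr fun a => by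
      rw [Nat.succ_iterate]

@[fun_prop]
theorem unaryToNat {n : α → Unary} (hn : PolyTime n) : PolyTime (fun a => (n a).val) :=
  (natAddUnary (const 0) hn).congr fun _ => zero_add _

@[fun_prop]
theorem succPNat {n : α → Unary} (hn : PolyTime n) : PolyTime (fun a => (n a).val.succPNat) :=
  (natSucc hn.unaryToNat).transfer _root_.id (fun _ => rfl) (fun _ => rfl)

theorem _root_.LogicalInduction.enc_bool_injective : Function.Injective (enc : Bool → Data) := by
  intro a b; cases a <;> cases b <;> simp [enc_true, enc_false]

theorem _root_.LogicalInduction.enc_list_injective (h : Function.Injective (enc : β → Data)) :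
    Function.Injective (enc : List β → Data) := by
  intro l
  induction l with
  | nil => intro l'; cases l' <;> simp [enc_nil, enc_cons]
  | cons a l ih =>
    intro l'
    cases l' with
    | nil => simp [enc_nil, enc_cons]
    | cons b l' =>
      simp only [enc_cons, Data.cons.injEq, List.cons.injEq]
      exact fun ⟨h1, h2⟩ => ⟨h h1, ih h2⟩

theorem _root_.LogicalInduction.enc_nat_injective : Function.Injective (enc : ℕ → Data) := by
  intro m n h
  have h1 : m.bits = n.bits := enc_list_injective enc_bool_injective h
  have key : ∀ n : ℕ, n.bits.foldr Nat.bit 0 = n := fun n => by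
    induction n using Nat.binaryRec' with
    | zero => simp
    | bit b n h ih => rw [Nat.bits_append_bit n b h, List.foldr_cons, ih]
  rw [← key m, h1, key]

/-! ### Rational numbers -/

/-- For positive reduced fractions inversion only exchanges numerator and denominator. -/
theorem ratInv {q : α → ℚ} (hq : PolyTime q) (hpos : ∀ a, 0 < q a) :
    PolyTime (fun a => (q a)⁻¹) := by
  have h : PolyTime fun a => (Data.cons (.cons .nil (enc (q a)).tail)
      (enc (q a)).head.tail) := by
    have := hq.to_enc
    fun_prop
  refine h.transfer _root_.id (fun _ => rfl) fun a => ?_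
  have h1 : 0 < (q a).num := Rat.num_pos.2 (hpos a)
  have h2 : enc (q a)⁻¹ = enc ((q a)⁻¹.num, (q a)⁻¹.den) := rfl
  have h3 : enc (q a) = enc ((q a).num, (q a).den) := rfl
  have h4 : ∀ z : ℤ, enc z = enc (decide (z < 0), z.natAbs) := fun _ => rfl
  have h5 : (q a)⁻¹.num = (q a).den := by
    rw [Rat.num_inv, Int.sign_eq_one_of_pos h1, one_mul]
  have h6 : (q a)⁻¹.den = (q a).num.natAbs := by
    rw [Rat.den_inv, if_neg h1.ne']
  simp only [_root_.id]
  rw [h2, h3, h5, h6, enc_data, enc_pair, enc_pair, h4, h4, enc_pair, enc_pair]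
  rfl

/-- The pairs `(a, d)` with `a ≤ j` and `d ≤ k`. -/
def fractionCandidates (j k : ℕ) : List (Unary × Unary) :=
  (unaryRange (j + 1)).flatMap fun a => (unaryRange (k + 1)).map fun d => (a, d)

/-- The candidates `(a, d)` such that `a / (d + 1)` is the reduced form of `j / (k + 1)`. -/
def reducedFractions (j k : ℕ) : List (Unary × Unary) :=
  (fractionCandidates j k).filter fun x => decide (x.1.val * (k + 1) = j * (x.2.val + 1)) &&
    (fractionCandidates j k).all fun y =>
      !decide (y.1.val * (k + 1) = j * (y.2.val + 1)) || decide (x.2.val ≤ y.2.val)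

theorem mem_fractionCandidates {j k : ℕ} {x : Unary × Unary} :
    x ∈ fractionCandidates j k ↔ x.1.val ≤ j ∧ x.2.val ≤ k := by
  rcases x with ⟨a, d⟩
  simp [fractionCandidates, mem_unaryRange]

/-- As the inputs are unary, exhaustive search can replace the Euclidean algorithm: the reduced
fraction is the candidate with the least denominator. -/
theorem headD_reducedFractions (j k : ℕ) :
    ((reducedFractions j k).headD (⟨0⟩, ⟨0⟩)).1.val = ((j : ℚ) / ((k + 1 : ℕ) : ℚ)).num.natAbs ∧
    ((reducedFractions j k).headD (⟨0⟩, ⟨0⟩)).2.val + 1 = ((j : ℚ) / ((k + 1 : ℕ) : ℚ)).den := by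
  set q : ℚ := (j : ℚ) / ((k + 1 : ℕ) : ℚ) with hq
  have hk : ((k + 1 : ℕ) : ℚ) ≠ 0 := by positivity
  have hq0 : 0 ≤ q := by positivity
  have hnum : ((q.num.natAbs : ℕ) : ℤ) = q.num := Int.natAbs_of_nonneg (Rat.num_nonneg.2 hq0)
  have hden := q.den_pos
  have char : ∀ a d : ℕ, 0 < d → (a * (k + 1) = j * d ↔ (a : ℚ) / d = q) := by
    intro a d hd
    rw [hq, div_eq_div_iff (by positivity) hk]
    exact_mod_cast Iff.rfl
  have hqq : ((q.num.natAbs : ℕ) : ℚ) / q.den = q := by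
    have : ((q.num.natAbs : ℕ) : ℚ) = q.num := by rw [← hnum]; rfl
    rw [this, Rat.num_div_den]
  -- The reduced denominator divides every denominator of `q`, hence it is the least one.
  have hdvd : ∀ a d : ℕ, 0 < d → (a : ℚ) / d = q → q.den ∣ d := by
    intro a d hd h
    have := Rat.den_dvd a d
    rw [Rat.divInt_eq_div, Int.cast_natCast, Int.cast_natCast, h] at this
    exact_mod_cast this
  have hle : q.den ≤ k + 1 := Nat.le_of_dvd (by omega) (hdvd j (k + 1) (by omega) rfl)
  have hbase : q.num.natAbs * (k + 1) = j * q.den := (char _ _ hden).2 hqq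
  have hmem : (⟨q.num.natAbs⟩, ⟨q.den - 1⟩) ∈ reducedFractions j k := by
    rw [reducedFractions, List.mem_filter, mem_fractionCandidates]
    refine ⟨⟨?_, by dsimp only; omega⟩, ?_⟩
    · dsimp only
      by_contra! hlt
      have h1 : j * q.den ≤ j * (k + 1) := Nat.mul_le_mul_left _ hle
      have h2 : j * (k + 1) < q.num.natAbs * (k + 1) := Nat.mul_lt_mul_of_pos_right hlt (by omega)
      omega
    · simp only [Bool.and_eq_true, decide_eq_true_eq, List.all_eq_true, Bool.or_eq_true,
        Bool.not_eq_true', decide_eq_false_iff_not]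
      refine ⟨by rw [Nat.sub_add_cancel hden]; exact hbase, fun y hy => ?_⟩
      by_cases h : y.1.val * (k + 1) = j * (y.2.val + 1)
      · right
        have := Nat.le_of_dvd (by omega) (hdvd _ _ (by omega) ((char _ _ (by omega)).1 h))
        omega
      · exact .inl h
  have huniq : ∀ x ∈ reducedFractions j k, x.1.val = q.num.natAbs ∧ x.2.val + 1 = q.den := by
    intro x hx
    have h0 := hmem
    rw [reducedFractions, List.mem_filter] at hx h0
    simp only [Bool.and_eq_true, decide_eq_true_eq, List.all_eq_true, Bool.or_eq_true,
        Bool.not_eq_true', decide_eq_false_iff_not] at hx h0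
    have h1 := hx.2.1
    have h2 := (hx.2.2 _ h0.1).resolve_left (by simpa using h0.2.1)
    have h3 := Nat.le_of_dvd (by omega) (hdvd _ _ (by omega) ((char _ _ (by omega)).1 h1))
    dsimp only at h2
    have h4 : x.2.val + 1 = q.den := by omega
    refine ⟨?_, h4⟩
    rw [h4, ← hbase] at h1
    exact Nat.eq_of_mul_eq_mul_right (by omega) h1
  rcases h : reducedFractions j k with _ | ⟨x, l⟩
  · rw [h] at hmem; simp at hmem
  · exact huniq x (by rw [h]; exact List.mem_cons_self)

/-- Provides the grid points `j / (k + 1)` of the approximate expectations and the weights `1 / (k +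
1)`. -/
theorem ratDiv {j k : α → Unary} (hj : PolyTime j) (hk : PolyTime k) :
    PolyTime (fun a => ((j a).val : ℚ) / (((k a).val + 1 : ℕ) : ℚ)) := by
  have h1 : PolyTime fun x : Unary × Unary => fractionCandidates x.1.val x.2.val := by
    unfold fractionCandidates
    refine flatMap (f := fun x : Unary × Unary => fun a => (unaryRange (x.2.val + 1)).map
      fun d => (a, d)) (range (n := fun x : Unary × Unary => ⟨x.1.val + 1⟩) (by fun_prop))
      (map (f := fun x d => (x.2, d)) (range (n := fun x : (Unary × Unary) × Unary =>
        ⟨x.1.2.val + 1⟩) (by fun_prop)) (by fun_prop))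
  have heq : ∀ {δ : Type} [Encode δ] (x : δ → Unary × Unary) (y : δ → Unary × Unary), PolyTime x →
      PolyTime y → PolyTime fun d => decide ((y d).1.val * ((x d).2.val + 1) =
        (x d).1.val * ((y d).2.val + 1)) := fun x y hx hy =>
    unaryEq (m := fun d => ⟨(y d).1.val * ((x d).2.val + 1)⟩)
      (n := fun d => ⟨(x d).1.val * ((y d).2.val + 1)⟩)
      (unaryMul (n := fun d => ⟨(x d).2.val + 1⟩) (by fun_prop) (by fun_prop))
      (unaryMul (n := fun d => ⟨(y d).2.val + 1⟩) (by fun_prop) (by fun_prop))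
  have h2 : PolyTime fun x : Unary × Unary => reducedFractions x.1.val x.2.val := by
    unfold reducedFractions
    refine filter (p := fun x : Unary × Unary => fun y => decide (y.1.val * (x.2.val + 1) =
      x.1.val * (y.2.val + 1)) && (fractionCandidates x.1.val x.2.val).all fun z =>
      !decide (z.1.val * (x.2.val + 1) = x.1.val * (z.2.val + 1)) ||
        decide (y.2.val ≤ z.2.val)) h1 (and (heq _ _ fst snd) ?_)
    refine all (p := fun x : (Unary × Unary) × Unary × Unary => fun z =>
      !decide (z.1.val * (x.1.2.val + 1) = x.1.1.val * (z.2.val + 1)) ||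
        decide (x.2.2.val ≤ z.2.val)) (h1.comp fst) (or (not (heq _ _ (by fun_prop)
        (by fun_prop))) (by fun_prop))
  have h3 : PolyTime fun a => (reducedFractions (j a).val (k a).val).headD (⟨0⟩, ⟨0⟩) :=
    headD (h2.comp (pair hj hk)) (const _)
  have h4 : PolyTime fun a => ((false,
      ((reducedFractions (j a).val (k a).val).headD (⟨0⟩, ⟨0⟩)).1.val),
      ((reducedFractions (j a).val (k a).val).headD (⟨0⟩, ⟨0⟩)).2.val + 1) := by
    fun_prop
  refine h4.transfer _root_.id (fun _ => rfl) fun a => ?_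
  obtain ⟨e1, e2⟩ := headD_reducedFractions (j a).val (k a).val
  simp only [_root_.id]
  rw [e1, e2]
  set q : ℚ := ((j a).val : ℚ) / (((k a).val + 1 : ℕ) : ℚ)
  have hq0 : 0 ≤ q := by positivity
  have : decide (q.num < 0) = false := by simpa using hq0
  change _ = enc ((decide (q.num < 0), q.num.natAbs), q.den)
  rw [this]

end PolyTime

/-! ## Clocked simulation of programs -/

/-- A pair of the remaining fuel and a result, where the result is dropped if no fuel remains. -/
def withFuel (k : ℕ) (x : Data) : Unary × Data :=
  bif decide (0 < k) then (⟨k⟩, x) else (⟨0⟩, .nil)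

/-- One pass through a loop, where `c` and `f` simulate the test and the body. -/
def clockStep (c f : Unary × Data → Unary × Data) (s : Bool × Unary × Data) :
    Bool × Unary × Data :=
  bif s.1 then s else
  bif (c s.2).2.isNil then (true, withFuel ((c s.2).1.val - s.2.2.size) s.2.2) else
  (false, withFuel ((f ((c s.2).1, s.2.2)).1.val - s.2.2.size) (f ((c s.2).1, s.2.2)).2)

/-- The simulation of a program that is stopped when the cost exhausts the given fuel; the output
contains the remaining fuel, which is `0` if the simulation was stopped. -/
def clock : Prog → Unary × Data → Unary × Data
  | .id, s => withFuel (s.1.val - s.2.size) s.2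
  | .nil, s => withFuel (s.1.val - 1) .nil
  | .head, s => withFuel (s.1.val - s.2.size) s.2.head
  | .tail, s => withFuel (s.1.val - s.2.size) s.2.tail
  | .pair f g, s => withFuel ((clock g ((clock f s).1, s.2)).1.val - s.2.size)
      (.cons (clock f s).2 (clock g ((clock f s).1, s.2)).2)
  | .comp g f, s => withFuel ((clock g (clock f s)).1.val - 1) (clock g (clock f s)).2
  | .cond c f g, s =>
      bif (clock c s).2.isNil then
        withFuel ((clock g ((clock c s).1, s.2)).1.val - s.2.size)
          (clock g ((clock c s).1, s.2)).2
      else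
        withFuel ((clock f ((clock c s).1, s.2)).1.val - s.2.size)
          (clock f ((clock c s).1, s.2)).2
  | .loop c f, s =>
      bif ((clockStep (clock c) (clock f))^[s.1.val] (false, s)).1 then
        ((clockStep (clock c) (clock f))^[s.1.val] (false, s)).2
      else (⟨0⟩, .nil)

theorem withFuel_zero (x : Data) : withFuel 0 x = (⟨0⟩, .nil) := rfl

theorem withFuel_succ (k : ℕ) (x : Data) : withFuel (k + 1) x = (⟨k + 1⟩, x) := by
  simp [withFuel]

theorem withFuel_of_pos {k : ℕ} (hk : 0 < k) (x : Data) : withFuel k x = (⟨k⟩, x) := by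
  simp [withFuel, hk]

/-- The outcome `r` of a simulation from the state `s` is a failure or that of a run. -/
def ClockSound (c : Prog) (s r : Unary × Data) : Prop :=
  r = (⟨0⟩, .nil) ∨ ∃ t, Run c s.2 r.2 t ∧ r.1.val + t = s.1.val ∧ 0 < r.1.val

theorem ClockSound.withFuel {c : Prog} {s : Unary × Data} {k : ℕ} {x : Data}
    (h : 0 < k → ∃ t, Run c s.2 x t ∧ k + t = s.1.val) : ClockSound c s (withFuel k x) := by
  rcases Nat.eq_zero_or_pos k with rfl | hk
  · exact .inl rfl
  · obtain ⟨t, h1, h2⟩ := h hk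
    rw [withFuel_of_pos hk]
    exact .inr ⟨t, h1, h2, hk⟩

theorem ClockSound.run {c : Prog} {s r : Unary × Data} (h : ClockSound c s r)
    (hr : 0 < r.1.val) : ∃ t, Run c s.2 r.2 t ∧ r.1.val + t = s.1.val := by
  rcases h with rfl | ⟨t, h1, h2, -⟩
  · simp at hr
  · exact ⟨t, h1, h2⟩

theorem Data.isNil_iff {d : Data} : d.isNil = true ↔ d = .nil := by
  cases d <;> simp [Data.isNil]

theorem Data.isNil_eq_false_iff {d : Data} : d.isNil = false ↔ d ≠ .nil := by
  cases d <;> simp [Data.isNil]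

theorem clock_loop_sound {c f : Prog} (hc : ∀ s, ClockSound c s (clock c s))
    (hf : ∀ s, ClockSound f s (clock f s)) (N : ℕ) (s : Unary × Data)
    (h : ((clockStep (clock c) (clock f))^[N] (false, s)).1 = true) :
    ClockSound (.loop c f) s ((clockStep (clock c) (clock f))^[N] (false, s)).2 := by
  induction N generalizing s with
  | zero => simp at h
  | succ N ih =>
    rw [Function.iterate_succ_apply] at h ⊢
    have hcs := hc s
    cases hn : (clock c s).2.isNil
    · have hfs := hf ((clock c s).1, s.2)
      have hstep : clockStep (clock c) (clock f) (false, s) =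
          (false, LogicalInduction.withFuel ((clock f ((clock c s).1, s.2)).1.val - s.2.size)
            (clock f ((clock c s).1, s.2)).2) := by
        simp [clockStep, hn]
      rw [hstep] at h ⊢
      have := ih _ h
      rcases this with h1 | ⟨t, h1, h2, h3⟩
      · exact .inl h1
      -- Without fuel after this pass there is no success later on, since successful outcomes retain
      -- positive fuel.
      · rcases Nat.eq_zero_or_pos ((clock f ((clock c s).1, s.2)).1.val - s.2.size) with h0 | h0
        · rw [h0, withFuel_zero] at h2 h3
          dsimp only at h2; omega
        rw [withFuel_of_pos h0] at h1 h2 h3 ⊢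
        obtain ⟨u, h4, h5⟩ := hfs.run (by omega)
        dsimp only at h4 h5 h2
        obtain ⟨v, h6, h7⟩ := hcs.run (by omega)
        exact .inr ⟨_, .loop_step h6 (Data.isNil_eq_false_iff.1 hn) h4 h1, by omega, h3⟩
    · have hstep : clockStep (clock c) (clock f) (false, s) =
          (true, LogicalInduction.withFuel ((clock c s).1.val - s.2.size) s.2) := by
        simp [clockStep, hn]
      have hfix : ∀ N r, (clockStep (clock c) (clock f))^[N] (true, r) = (true, r) := fun N r =>
        Function.iterate_fixed (by simp [clockStep]) N
      rw [hstep, hfix]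
      refine .withFuel fun h0 => ?_
      obtain ⟨v, h6, h7⟩ := hcs.run (by omega)
      rw [Data.isNil_iff.1 hn] at h6
      exact ⟨_, .loop_done h6, by omega⟩

/-- Fuel is passed from stage to stage and failure sets it to `0`. Positive fuel at the end thus
certifies that every stage succeeded, and the fuel consumed is exactly the cost of the run. -/
theorem clock_sound (c : Prog) (s : Unary × Data) : ClockSound c s (clock c s) := by
  induction c generalizing s with
  | id => exact .withFuel fun h => ⟨_, .id _, by omega⟩
  | nil => exact .withFuel fun h => ⟨_, .nil _, by omega⟩
  | head => exact .withFuel fun h => ⟨_, .head _, by omega⟩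
  | tail => exact .withFuel fun h => ⟨_, .tail _, by omega⟩
  | pair f g ihf ihg =>
    refine .withFuel fun h => ?_
    obtain ⟨t, h1, h2⟩ := (ihg _).run (show 0 < (clock g ((clock f s).1, s.2)).1.val by omega)
    dsimp only at h1 h2
    obtain ⟨u, h3, h4⟩ := (ihf s).run (by omega)
    exact ⟨_, .pair h3 h1, by omega⟩
  | comp g f ihg ihf =>
    refine .withFuel fun h => ?_
    obtain ⟨t, h1, h2⟩ := (ihg _).run (show 0 < (clock g (clock f s)).1.val by omega)
    obtain ⟨u, h3, h4⟩ := (ihf s).run (by omega)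
    exact ⟨_, .comp h3 h1, by omega⟩
  | cond c f g ihc ihf ihg =>
    unfold clock
    cases hn : (clock c s).2.isNil <;> dsimp only [cond_true, cond_false]
    · refine .withFuel fun h => ?_
      obtain ⟨t, h1, h2⟩ := (ihf _).run (show 0 < (clock f ((clock c s).1, s.2)).1.val by omega)
      dsimp only at h1 h2
      obtain ⟨u, h3, h4⟩ := (ihc s).run (by omega)
      exact ⟨_, .cond_true h3 (Data.isNil_eq_false_iff.1 hn) h1, by omega⟩
    · refine .withFuel fun h => ?_
      obtain ⟨t, h1, h2⟩ := (ihg _).run (show 0 < (clock g ((clock c s).1, s.2)).1.val by omega)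
      dsimp only at h1 h2
      obtain ⟨u, h3, h4⟩ := (ihc s).run (by omega)
      rw [Data.isNil_iff.1 hn] at h3
      exact ⟨_, .cond_false h3 h1, by omega⟩
  | loop c f ihc ihf =>
    unfold clock
    cases h : ((clockStep (clock c) (clock f))^[s.1.val] (false, s)).1
    · exact .inl rfl
    · exact clock_loop_sound ihc ihf _ _ h

/-- The surplus `k + 1` is positive because fuel `0` marks failure, and arbitrary because each stage
must leave enough for the following ones. -/
theorem clock_complete {c : Prog} {x y : Data} {t : ℕ} (h : Run c x y t) (k : ℕ) :
    clock c (⟨t + (k + 1)⟩, x) = (⟨k + 1⟩, y) := by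
  have hfix : ∀ c f N r, (clockStep (clock c) (clock f))^[N] (true, r) = (true, r) :=
    fun c f N r => Function.iterate_fixed (by simp [clockStep]) N
  induction h generalizing k with
  | id x => simp [clock, withFuel_succ]
  | nil x => simp [clock, withFuel_succ]
  | head x => simp [clock, withFuel_succ]
  | tail x => simp [clock, withFuel_succ]
  | @pair f g x y z s t _ _ ih1 ih2 =>
    have h1 := ih1 (t + x.size + k)
    have h2 := ih2 (x.size + k)
    rw [show s + (t + x.size + k + 1) = s + t + x.size + (k + 1) by ring] at h1
    rw [show t + (x.size + k + 1) = t + x.size + k + 1 by ring] at h2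
    simp only [clock, h1, h2]
    rw [show x.size + k + 1 - x.size = k + 1 by omega, withFuel_succ]
  | @comp f g x y z s t _ _ ih1 ih2 =>
    have h1 := ih1 (t + 1 + k)
    have h2 := ih2 (1 + k)
    rw [show s + (t + 1 + k + 1) = s + t + 1 + (k + 1) by ring] at h1
    rw [show t + (1 + k + 1) = t + 1 + k + 1 by ring] at h2
    simp only [clock, h1, h2]
    rw [show 1 + k + 1 - 1 = k + 1 by omega, withFuel_succ]
  | @cond_true c f g x b y r s _ hb _ ih1 ih2 =>
    have h1 := ih1 (s + x.size + k)
    have h2 := ih2 (x.size + k)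
    rw [show r + (s + x.size + k + 1) = r + s + x.size + (k + 1) by ring] at h1
    rw [show s + (x.size + k + 1) = s + x.size + k + 1 by ring] at h2
    simp only [clock, h1, h2, Data.isNil_eq_false_iff.2 hb, _root_.cond_false]
    rw [show x.size + k + 1 - x.size = k + 1 by omega, withFuel_succ]
  | @cond_false c f g x y r s _ _ ih1 ih2 =>
    have h1 := ih1 (s + x.size + k)
    have h2 := ih2 (x.size + k)
    rw [show r + (s + x.size + k + 1) = r + s + x.size + (k + 1) by ring] at h1
    rw [show s + (x.size + k + 1) = s + x.size + k + 1 by ring] at h2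
    simp only [clock, h1, h2, Data.isNil, _root_.cond_true]
    rw [show x.size + k + 1 - x.size = k + 1 by omega, withFuel_succ]
  | @loop_done c f x r _ ih =>
    have h1 := ih (x.size + k)
    rw [show r + (x.size + k + 1) = r + x.size + k + 1 by ring] at h1
    have hstep : clockStep (clock c) (clock f) (false, (⟨r + x.size + k + 1⟩, x)) =
        (true, (⟨k + 1⟩, x)) := by
      simp only [clockStep, h1, Data.isNil, _root_.cond_true, _root_.cond_false]
      rw [show x.size + k + 1 - x.size = k + 1 by omega, withFuel_succ]
    rw [show r + x.size + (k + 1) = r + x.size + k + 1 by ring, clock]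
    dsimp only
    rw [Function.iterate_succ_apply, hstep, hfix]
    rfl
  | @loop_step c f x b y z r s t _ hb _ _ ih1 ih2 ih3 =>
    have h1 := ih1 (s + t + x.size + k)
    have h2 := ih2 (t + x.size + k)
    rw [show r + (s + t + x.size + k + 1) = r + s + t + x.size + k + 1 by ring] at h1
    rw [show s + (t + x.size + k + 1) = s + t + x.size + k + 1 by ring] at h2
    have hstep : clockStep (clock c) (clock f) (false, (⟨r + s + t + x.size + k + 1⟩, x)) =
        (false, (⟨t + (k + 1)⟩, y)) := by
      simp only [clockStep, h1, h2, Data.isNil_eq_false_iff.2 hb, _root_.cond_false]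
      rw [show t + x.size + k + 1 - x.size = t + (k + 1) by omega, withFuel_of_pos (by omega)]
    have h3 := ih3 k
    rw [clock] at h3
    dsimp only at h3
    set N := t + (k + 1) with hN
    -- The simulated loop is iterated as often as there was fuel at the start, but after the first
    -- pass only `N` iterations are accounted for by induction. The other `M` leave the finished
    -- state fixed; their number is not negative since the first pass costs at least `x.size ≥ 1`.
    obtain ⟨M, hM⟩ : ∃ M, r + s + t + x.size + k = M + N := by
      have := x.one_le_size
      exact ⟨r + s + x.size - 1, by omega⟩
    rw [show r + s + t + x.size + (k + 1) = r + s + t + x.size + k + 1 by ring, clock]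
    dsimp only
    rw [Function.iterate_succ_apply, hstep, hM, Function.iterate_add_apply]
    generalize (clockStep (clock c) (clock f))^[N] (false, ⟨N⟩, y) = u at h3 ⊢
    obtain ⟨b, u⟩ := u
    cases b
    · simp at h3
    · rw [hfix]
      simpa using h3

/-- Both runs are reproduced by the same clocked simulation with fuel `s + t + 1`, which is a
function; the remaining fuel reveals the cost. -/
theorem Run.deterministic {c : Prog} {x y z : Data} {s t : ℕ} (h : Run c x y s)
    (h' : Run c x z t) : y = z ∧ s = t := by
  have h1 := clock_complete h t
  have h2 := clock_complete h' s
  rw [show t + (s + 1) = s + (t + 1) by ring, h1] at h2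
  simp only [Prod.mk.injEq, Unary.mk.injEq] at h2
  exact ⟨h2.2, by omega⟩

/-! ### The clocked simulation runs in polynomial time -/

namespace PolyTime

variable {α β γ σ : Type} [Encode α] [Encode β] [Encode γ] [Encode σ]

@[fun_prop]
theorem withFuel {k : α → Unary} {x : α → Data} (hk : PolyTime k) (hx : PolyTime x) :
    PolyTime fun a => withFuel (k a).val (x a) := by
  unfold LogicalInduction.withFuel
  refine cond (unaryLt (m := fun _ => ⟨0⟩) (const _) hk) ?_ (const _)
  exact pair (hk.congr fun _ => rfl) hx

@[fun_prop]
theorem withFuelSub {k m : α → Unary} {x : α → Data} (hk : PolyTime k) (hm : PolyTime m)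
    (hx : PolyTime x) :
    PolyTime fun a => LogicalInduction.withFuel ((k a).val - (m a).val) (x a) :=
  withFuel (k := fun a => ⟨(k a).val - (m a).val⟩) (by fun_prop) hx

@[fun_prop]
theorem withFuelSubSize {k : α → Unary} {d x : α → Data} (hk : PolyTime k) (hd : PolyTime d)
    (hx : PolyTime x) :
    PolyTime fun a => LogicalInduction.withFuel ((k a).val - (d a).size) (x a) :=
  withFuelSub (m := fun a => ⟨(d a).size⟩) hk (by fun_prop) hx

/-- Fuel never increases, and an output is no larger than the fuel spent on it. So all states of a
simulated loop are bounded by the initial fuel and the input. -/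
theorem _root_.LogicalInduction.clockStep_bounds (c f : Prog) (r : Bool × Unary × Data) :
    (clockStep (LogicalInduction.clock c) (LogicalInduction.clock f) r).2.1.val ≤ r.2.1.val ∧
    (clockStep (LogicalInduction.clock c) (LogicalInduction.clock f) r).2.2.size ≤
      max r.2.1.val r.2.2.size := by
  have hx := r.2.2.one_le_size
  have hfail : ((⟨0⟩, .nil) : Unary × Data).1.val ≤ r.2.1.val ∧
      ((⟨0⟩, .nil) : Unary × Data).2.size ≤ max r.2.1.val r.2.2.size :=
    ⟨Nat.zero_le _, by simp [Data.size]; omega⟩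
  have hc := clock_sound c r.2
  have hf := clock_sound f ((LogicalInduction.clock c r.2).1, r.2.2)
  unfold clockStep
  cases r.1
  · simp only [_root_.cond_false]
    cases hn : (LogicalInduction.clock c r.2).2.isNil
    · simp only [_root_.cond_false]
      generalize LogicalInduction.clock f ((LogicalInduction.clock c r.2).1, r.2.2) = w at *
      rcases Nat.eq_zero_or_pos (w.1.val - r.2.2.size) with h0 | h0
      · rw [h0]; exact hfail
      · rw [withFuel_of_pos h0]
        obtain ⟨t, h1, h2⟩ := hf.run (by omega)
        dsimp only at h2 ⊢
        obtain ⟨u, h3, h4⟩ := hc.run (by omega)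
        have := h1.size_le
        exact ⟨by omega, by omega⟩
    · simp only [_root_.cond_true]
      rcases Nat.eq_zero_or_pos ((LogicalInduction.clock c r.2).1.val - r.2.2.size) with h0 | h0
      · rw [h0]; exact hfail
      · rw [withFuel_of_pos h0]
        obtain ⟨u, h3, h4⟩ := hc.run (by omega)
        exact ⟨by dsimp only; omega, le_max_right _ _⟩
  · simp

theorem clock (c : Prog) : PolyTime (clock c) := by
  refine congr (f := fun s => LogicalInduction.clock c s) ?_ fun _ => rfl
  induction c with
  | id => unfold LogicalInduction.clock; fun_prop
  | nil =>
    unfold LogicalInduction.clock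
    exact withFuelSub (m := fun _ => ⟨1⟩) (by fun_prop) (by fun_prop) (by fun_prop)
  | head => unfold LogicalInduction.clock; fun_prop
  | tail => unfold LogicalInduction.clock; fun_prop
  | pair f g ihf ihg => unfold LogicalInduction.clock; fun_prop
  | comp g f ihg ihf =>
    unfold LogicalInduction.clock
    exact withFuelSub (m := fun _ => ⟨1⟩) (by fun_prop) (by fun_prop) (by fun_prop)
  | cond c f g ihc ihf ihg => unfold LogicalInduction.clock; fun_prop
  | loop c f ihc ihf =>
    unfold LogicalInduction.clock
    have hstep : PolyTime fun s =>
        clockStep (LogicalInduction.clock c) (LogicalInduction.clock f) s := by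
      unfold clockStep; fun_prop
    have h := iterate_of_growth (α := Unary × Data) (n := fun s => s.1) (init := fun s => (false, s))
      (step := fun _ => clockStep (LogicalInduction.clock c) (LogicalInduction.clock f))
      (by fun_prop) (by fun_prop) (hstep.comp snd)
      (fun s r => r.2.1.val ≤ s.1.val ∧ r.2.2.size ≤ s.1.val + s.2.size)
      (fun s => ⟨le_rfl, by simp⟩) (fun s r hr => ?_) (4 * .X + 10) (fun s r hr => ?_)
    · fun_prop
    · have := clockStep_bounds c f r
      omega
    · have := clockStep_bounds c f r
      generalize clockStep (LogicalInduction.clock c) (LogicalInduction.clock f) r = w at *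
      have h1 : encSize w = encSize w.1 + (encSize w.2.1 + w.2.2.size + 1) + 1 := rfl
      have h2 : encSize s = encSize s.1 + s.2.size + 1 := rfl
      have h3 := encSize_bool_le w.1
      have h4 := encSize_unary w.2.1
      have h5 := encSize_unary s.1
      simp
      omega

open scoped Classical in
/-- If `g` is computable, it is computed in polynomial time when enough additional time is
allowed. -/
theorem exists_clocked {g : α → β} (c : Prog) (hc : ∀ a, Halts c (enc a) (enc (g a))) :
    ∃ t : α → ℕ, (∀ a (T : ℕ), RunsIn c (enc a) (enc (g a)) T → t a ≤ T) ∧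
      PolyTime (fun x : Unary × α => if t x.2 < x.1.val then [g x.2] else []) := by
  choose t ht using hc
  refine ⟨t, fun a T ⟨s, hs, hrun⟩ => ?_, ?_⟩
  · rw [((ht a).deterministic hrun).2]; exact hs
  have h0 : PolyTime fun x : Unary × α => LogicalInduction.clock c (x.1, enc x.2) :=
    (clock c).comp (by have := to_enc (snd (α := Unary) (β := α)); fun_prop)
  have h1 : PolyTime fun x : Unary × α =>
      if decide (0 < (LogicalInduction.clock c (x.1, enc x.2)).1.val) then
        [(LogicalInduction.clock c (x.1, enc x.2)).2] else [] :=
    ite (unaryLt (m := fun _ => ⟨0⟩) (by fun_prop) (by fun_prop)) (by fun_prop) (by fun_prop)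
  refine h1.transfer _root_.id (fun _ => rfl) fun x => ?_
  simp only [_root_.id, decide_eq_true_eq]
  by_cases h : t x.2 < x.1.val
  · obtain ⟨k, hk⟩ := Nat.exists_eq_add_of_lt h
    have := clock_complete (ht x.2) k
    rw [← show x.1 = ⟨t x.2 + (k + 1)⟩ from Unary.ext (by rw [hk]; ring)] at this
    rw [this, if_pos h, if_pos (by simp)]
    rfl
  · rw [if_neg h, if_neg]
    · rfl
    -- Remaining fuel would come from a run cheaper than the given fuel, but the cost `t` is unique.
    · intro hpos
      obtain ⟨s, h2, h3⟩ := (clock_sound c (x.1, enc x.2)).run hpos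
      have := (ht x.2).deterministic h2
      dsimp only at h3
      omega

end PolyTime

/-! ## Encodings of formulas -/

set_option linter.unusedSectionVars false

section Injectivity

variable {L : FirstOrder.Language.{0, 0}} [∀ k, Encodable (L.Functions k)]
  [∀ k, Encodable (L.Relations k)]

theorem encList_id_injective : Function.Injective (encList (fun d : Data => d)) := by
  intro l
  induction l with
  | nil => intro l'; cases l' <;> simp [encList]
  | cons a l ih =>
    intro l'
    cases l' with
    | nil => simp [encList]
    | cons b l' =>
      simp only [encList, Data.cons.injEq, List.cons.injEq]
      exact fun ⟨h1, h2⟩ => ⟨h1, ih h2⟩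

theorem encTerm_injective {α : Type} {v : α → ℕ} (hv : Function.Injective v) :
    Function.Injective (encTerm v : L.Term α → Data) := by
  intro s
  induction s with
  | var a =>
    intro t h
    cases t with
    | var b =>
      simp only [encTerm, Data.cons.injEq, true_and] at h
      rw [hv (enc_nat_injective h)]
    | func f ts => simp [encTerm, Data.unary] at h
  | @func l f ts ih =>
    intro t h
    cases t with
    | var b => simp [encTerm, Data.unary] at h
    | @func l' g us =>
      simp only [encTerm, Data.cons.injEq, true_and] at h
      obtain ⟨h1, h2⟩ := h
      have h3 := encList_id_injective h2
      -- The arity is not written down; it is recovered from the number of arguments.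
      have h4 : l = l' := by simpa using congrArg List.length h3
      subst h4
      have h5 := List.ofFn_injective h3
      have h6 : f = g := Encodable.encode_injective (enc_nat_injective h1)
      subst h6
      congr 1
      funext i
      exact ih i (congrFun h5 i)

theorem varIndex_injective {α : Type} {v : α → ℕ} (hv : Function.Injective v) (n : ℕ) :
    Function.Injective (varIndex v n) := by
  rintro (a | i) (b | j) h
  · simp only [varIndex, Sum.elim_inl] at h
    rw [hv (Nat.add_left_cancel h)]
  · simp only [varIndex, Sum.elim_inl, Sum.elim_inr] at h; omega
  · simp only [varIndex, Sum.elim_inl, Sum.elim_inr] at h; omega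
  · simp only [varIndex, Sum.elim_inr] at h
    congr 1
    ext
    omega

theorem encFormula_injective {α : Type} {v : α → ℕ} (hv : Function.Injective v) {n : ℕ} :
    Function.Injective (encFormula v : L.BoundedFormula α n → Data) := by
  intro φ
  induction φ with
  | falsum => intro ψ h; cases ψ <;> simp [encFormula, Data.unary] at h ⊢
  | @equal n s t =>
    intro ψ h
    cases ψ with
    | equal s' t' =>
      simp only [encFormula, Data.cons.injEq, true_and] at h
      rw [encTerm_injective (varIndex_injective hv n) h.1,
        encTerm_injective (varIndex_injective hv n) h.2]
    | _ => simp [encFormula, Data.unary] at h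
  | @rel n l R ts =>
    intro ψ h
    cases ψ with
    | @rel _ l' R' ts' =>
      simp only [encFormula, Data.cons.injEq, true_and] at h
      obtain ⟨h1, h2⟩ := h
      have h3 := encList_id_injective h2
      have h4 : l = l' := by simpa using congrArg List.length h3
      subst h4
      have h5 := List.ofFn_injective h3
      have h6 : R = R' := Encodable.encode_injective (enc_nat_injective h1)
      subst h6
      congr 1
      funext i
      exact encTerm_injective (varIndex_injective hv n) (congrFun h5 i)
    | _ => simp [encFormula, Data.unary] at h
  | imp φ ψ ih1 ih2 =>
    intro χ h
    cases χ with
    | imp φ' ψ' =>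
      simp only [encFormula, Data.cons.injEq, true_and] at h
      rw [ih1 h.1, ih2 h.2]
    | _ => simp [encFormula, Data.unary] at h
  | all φ ih =>
    intro χ h
    cases χ with
    | all φ' =>
      simp only [encFormula, Data.cons.injEq, true_and] at h
      rw [ih h]
    | _ => simp [encFormula, Data.unary] at h

/-- Sentences can be compared by their codes, and a world can be specified by truth values of codes.
-/
theorem enc_sentence_injective : Function.Injective (enc : L.Sentence → Data) :=
  encFormula_injective fun a => a.elim

end Injectivity

/-! ### Families of formulas that can be written down in polynomial time -/

section Families

variable {L : FirstOrder.Language.{0, 0}} [∀ k, Encodable (L.Functions k)]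
  [∀ k, Encodable (L.Relations k)] {ι α β : Type} [Encode ι]

/-- A family of terms that can be written down in polynomial time. -/
def PolyTerm (t : ι → L.Term α) : Prop := ∀ v : α → ℕ, PolyTime fun i => encTerm v (t i)

/-- A family of formulas that can be written down in polynomial time. -/
def PolyFormula {n : ℕ} (F : ι → L.BoundedFormula α n) : Prop :=
  ∀ v : α → ℕ, PolyTime fun i => encFormula v (F i)

theorem encTerm_relabel (v : β → ℕ) (g : α → β) (t : L.Term α) :
    encTerm v (t.relabel g) = encTerm (v ∘ g) t := by
  induction t with
  | var a => rfl
  | func f ts ih => simp only [Term.relabel, encTerm, ih]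

theorem varIndex_relabelAux {n k : ℕ} (v : β → ℕ) (g : α → β ⊕ Fin n) (x : α ⊕ Fin k) :
    varIndex v (n + k) (BoundedFormula.relabelAux g k x) =
      varIndex (fun a => varIndex v n (g a)) k x := by
  rcases x with a | j
  · rcases h : g a with b | j
    · simp [varIndex, BoundedFormula.relabelAux, h]; omega
    · simp [varIndex, BoundedFormula.relabelAux, h]; omega
  · simp [varIndex, BoundedFormula.relabelAux]; omega

/-- Free variables are indexed as if they were bound further outside, so relabelling, even into
bound variables, only changes their numbering. This is why polynomial families are required to be
computable for every numbering. -/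
theorem encFormula_relabel {n k : ℕ} (v : β → ℕ) (g : α → β ⊕ Fin n) (F : L.BoundedFormula α k) :
    encFormula v (F.relabel g) = encFormula (fun a => varIndex v n (g a)) F := by
  have hcomp : ∀ k, varIndex v (n + k) ∘ BoundedFormula.relabelAux g k =
      varIndex (fun a => varIndex v n (g a)) k := fun k => funext (varIndex_relabelAux v g)
  induction F with
  | falsum => rfl
  | @equal k s t =>
    rw [encFormula, ← hcomp, ← encTerm_relabel, ← encTerm_relabel]; rfl
  | @rel k l R ts =>
    rw [encFormula, ← hcomp]
    simp only [← encTerm_relabel]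
    rfl
  | imp φ ψ ih1 ih2 => rw [BoundedFormula.relabel_imp, encFormula, encFormula, ih1, ih2]
  | all φ ih => rw [BoundedFormula.relabel_all, encFormula, encFormula, ih]

namespace PolyFormula

theorem falsum {n : ℕ} : PolyFormula (fun _ : ι => (⊥ : L.BoundedFormula α n)) :=
  fun _ => PolyTime.const _

theorem imp {n : ℕ} {F G : ι → L.BoundedFormula α n} (hF : PolyFormula F) (hG : PolyFormula G) :
    PolyFormula fun i => F i ⟹ G i := fun v => by
  have h1 := hF v
  have h2 := hG v
  simp only [encFormula]
  fun_prop

theorem all {n : ℕ} {F : ι → L.BoundedFormula α (n + 1)} (hF : PolyFormula F) :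
    PolyFormula fun i => (F i).all := fun v => by
  have h1 := hF v
  simp only [encFormula]
  fun_prop

theorem alls {n : ℕ} {F : ι → L.BoundedFormula α n} (hF : PolyFormula F) :
    PolyFormula fun i => (F i).alls := by
  induction n with
  | zero => exact hF
  | succ n ih => exact ih hF.all

theorem not {n : ℕ} {F : ι → L.BoundedFormula α n} (hF : PolyFormula F) :
    PolyFormula fun i => ∼(F i) := hF.imp falsum

theorem inf {n : ℕ} {F G : ι → L.BoundedFormula α n} (hF : PolyFormula F) (hG : PolyFormula G) :
    PolyFormula fun i => F i ⊓ G i := (hF.imp hG.not).not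

theorem sup {n : ℕ} {F G : ι → L.BoundedFormula α n} (hF : PolyFormula F) (hG : PolyFormula G) :
    PolyFormula fun i => F i ⊔ G i := hF.not.imp hG

theorem relabel {n k : ℕ} {F : ι → L.BoundedFormula α k} (hF : PolyFormula F)
    (g : α → β ⊕ Fin n) : PolyFormula fun i => (F i).relabel g := fun v =>
  (hF fun a => varIndex v n (g a)).congr fun i => (encFormula_relabel v g (F i)).symm

theorem formulaRelabel {F : ι → L.Formula α} (hF : PolyFormula (n := 0) F)
    (g : α → β) : PolyFormula (n := 0) fun i => (F i).relabel g :=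
  hF.relabel (n := 0) _

theorem ofSentence {F : ι → L.Sentence} (hF : PolyTime F) :
    PolyFormula (n := 0) F := fun v => by
  rw [show v = Empty.elim from funext fun a => a.elim]
  exact hF.to_enc

theorem toPolyTime {F : ι → L.Sentence} (hF : PolyFormula (n := 0) F) : PolyTime F :=
  PolyTime.of_enc (hF Empty.elim)

end PolyFormula

theorem PolyTerm.relabel {t : ι → L.Term α} (ht : PolyTerm t) (g : α → β) :
    PolyTerm fun i => (t i).relabel g := fun v =>
  (ht (v ∘ g)).congr fun i => (encTerm_relabel v g (t i)).symm

theorem PolyTerm.const (t : L.Term α) : PolyTerm (fun _ : ι => t) := fun _ => PolyTime.const _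

theorem PolyFormula.equal {s t : ι → L.Term α} (hs : PolyTerm s) (ht : PolyTerm t) :
    PolyFormula (n := 0) fun i => (s i).equal (t i) := fun v => by
  have h1 := hs.relabel (Sum.inl : α → α ⊕ Fin 0) (varIndex v 0)
  have h2 := ht.relabel (Sum.inl : α → α ⊕ Fin 0) (varIndex v 0)
  have : PolyTime fun i => Data.cons (.unary 1) (.cons
      (encTerm (varIndex v 0) ((s i).relabel (Sum.inl : α → α ⊕ Fin 0)))
      (encTerm (varIndex v 0) ((t i).relabel (Sum.inl : α → α ⊕ Fin 0)))) := by fun_prop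
  exact this

theorem PolyTime.encList_ofFn {n : ℕ} {d : ι → Fin n → Data} (hd : ∀ j, PolyTime fun i => d i j) :
    PolyTime fun i => encList (fun d => d) (List.ofFn (d i)) := by
  induction n with
  | zero => simpa [encList] using PolyTime.const _
  | succ n ih =>
    simp only [List.ofFn_succ, encList]
    exact PolyTime.cons' (hd 0) (ih fun j => hd j.succ)

theorem PolyTerm.subst {t : L.Term α} {f : ι → α → L.Term β} (hf : ∀ a, PolyTerm fun i => f i a) :
    PolyTerm fun i => t.subst (f i) := fun v => by
  induction t with
  | var a => exact hf a v
  | func g ts ih =>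
    simp only [Term.subst, encTerm]
    have := PolyTime.encList_ofFn ih
    fun_prop

/-- The formula is fixed, so its structure can be built into the program; only the substituted terms
vary. -/
theorem PolyFormula.subst {n : ℕ} {F : L.BoundedFormula α n} {f : ι → α → L.Term β}
    (hf : ∀ a, PolyTerm fun i => f i a) : PolyFormula fun i => F.subst (f i) := fun v => by
  have key : ∀ n (t : L.Term (α ⊕ Fin n)), PolyTerm fun i =>
      t.subst (Sum.elim (Term.relabel Sum.inl ∘ f i) (Term.var ∘ Sum.inr)) := by
    refine fun n t => PolyTerm.subst fun a => ?_
    rcases a with a | j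
    · exact (hf a).relabel _
    · exact PolyTerm.const _
  induction F with
  | falsum => exact PolyTime.const _
  | @equal n s t =>
    have h1 := key _ s (varIndex v n)
    have h2 := key _ t (varIndex v n)
    simp only [BoundedFormula.subst, BoundedFormula.mapTermRel, encFormula]
    fun_prop
  | @rel n l R ts =>
    have h1 := PolyTime.encList_ofFn fun j => key _ (ts j) (varIndex v n)
    simp only [BoundedFormula.subst, BoundedFormula.mapTermRel, encFormula]
    exact PolyTime.cons' (PolyTime.const _) (PolyTime.cons' (PolyTime.const _) h1)
  | imp φ ψ ih1 ih2 =>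
    simp only [BoundedFormula.subst, BoundedFormula.mapTermRel, encFormula] at *
    fun_prop
  | all φ ih =>
    simp only [BoundedFormula.subst, BoundedFormula.mapTermRel, encFormula] at *
    fun_prop

variable {Q : QuoteSystem L} {δ : Type} [Encode δ]

theorem PolyTerm.quote {Γ : L.Theory} (hQ : Q.Adequate Γ) {x : ι → δ} (hx : PolyTime x) :
    PolyTerm fun i => (Q.quote (x i) : L.Term β) := fun v => by
  have h1 : PolyTime (Q.name) := hQ.name_poly
  refine (h1.comp hx.to_enc).to_enc.congr fun i => ?_
  change _ = encTerm v ((Q.name (enc (x i))).relabel Empty.elim)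
  rw [encTerm_relabel, show v ∘ Empty.elim = Empty.elim from
    funext fun a => a.elim]
  rfl

theorem PolyFormula.forallOne {X : ι → L.Formula (Fin 1)} (hX : PolyFormula (n := 0) X) :
    PolyFormula (n := 0) fun i => forallOne (X i) :=
  (hX.relabel _).alls

theorem PolyFormula.forallTail {k : ℕ} {X : ι → L.Formula (Fin (k + 1))}
    (hX : PolyFormula (n := 0) X) : PolyFormula (n := 0) fun i => QuoteSystem.forallTail (X i) :=
  (hX.relabel _).alls

theorem PolyFormula.gt {Γ : L.Theory} (hQ : Q.Adequate Γ) {X : ι → L.Formula (Fin 1)} {q : ι → ℚ}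
    (hX : PolyFormula (n := 0) X) (hq : PolyTime q) : PolyTime fun i => Q.gt (X i) (q i) := by
  refine toPolyTime (PolyFormula.forallOne (hX.imp (PolyFormula.subst fun a => ?_)))
  fin_cases a
  · exact PolyTerm.quote hQ hq
  · exact PolyTerm.const _

theorem PolyFormula.indicator {φ : ι → L.Sentence}
    (hφ : PolyTime φ) : PolyFormula (n := 0) fun i => Q.indicator (φ i) := by
  have h := (PolyFormula.ofSentence hφ).formulaRelabel (Empty.elim : Empty → Fin 1)
  exact (h.inf (PolyFormula.equal (PolyTerm.const _) (PolyTerm.const _))).sup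
    (h.not.inf (PolyFormula.equal (PolyTerm.const _) (PolyTerm.const _)))

theorem PolyFormula.prod {X Y : ι → L.Formula (Fin 1)} (hX : PolyFormula (n := 0) X)
    (hY : PolyFormula (n := 0) Y) : PolyFormula (n := 0) fun i => Q.prod (X i) (Y i) := by
  refine PolyFormula.forallTail (((hX.formulaRelabel _).inf (hY.formulaRelabel _)).imp
    (PolyFormula.subst fun a => PolyTerm.const _))

theorem PolyFormula.futureIndicator {Γ : L.Theory} (hQ : Q.Adequate Γ)
    (γf : L.Formula (Fin 2)) (γP : L.Formula (Fin 3)) (γp : L.Formula (Fin 2))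
    (γI : L.Formula (Fin 4)) {n : ι → ℕ+} {φ : ι → L.Sentence} {δ : ι → ℚ} (hn : PolyTime n)
    (hφ : PolyTime φ) (hδ : PolyTime δ) : PolyFormula (n := 0) fun i =>
      QuoteSystem.futureIndicator Q γf γP γp γI (n i) (φ i) (δ i) := by
  refine PolyFormula.forallTail (PolyFormula.imp (PolyFormula.inf (PolyFormula.inf
    (PolyFormula.subst fun a => ?_) (PolyFormula.subst fun a => ?_))
    (PolyFormula.subst fun a => ?_)) (PolyFormula.subst fun a => ?_)) <;>
  fin_cases a <;> first | exact PolyTerm.const _ | exact PolyTerm.quote hQ hn |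
    exact PolyTerm.quote hQ hφ | exact PolyTerm.quote hQ hδ

end Families

/-! ## Propositional compactness and provability -/

section Logic

variable {L : FirstOrder.Language.{0, 0}}

/-- Worlds form a product of copies of the discrete space `Bool`, which is compact, and each
condition involves finitely many coordinates. -/
theorem isClosed_isPC : IsClosed {W : World L | W.IsPC} := by
  have h : {W : World L | W.IsPC} = {W | W ⊥ = false} ∩
      ⋂ φ : L.Sentence, ⋂ ψ : L.Sentence, {W | W (φ ⟹ ψ) = (!(W φ) || W ψ)} := by
    ext W; simp [World.IsPC]
  rw [h]
  refine (isClosed_eq (continuous_apply _) continuous_const).inter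
    (isClosed_iInter fun φ => isClosed_iInter fun ψ =>
      isClosed_eq (continuous_apply _) ?_)
  exact (continuous_of_discreteTopology (f := fun x : Bool × Bool => !x.1 || x.2)).comp
    ((continuous_apply φ).prodMk (continuous_apply (A := fun _ => Bool) ψ))

theorem isClosed_pcWorlds (S : Set L.Sentence) : IsClosed (pcWorlds S) := by
  have h : pcWorlds S = {W : World L | W.IsPC} ∩ ⋂ φ ∈ S, {W | W φ = true} := by
    ext W; simp [pcWorlds]
  rw [h]
  exact isClosed_isPC.inter (isClosed_biInter fun φ _ =>
    isClosed_eq (continuous_apply _) continuous_const)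

theorem pcWorlds_anti {S T : Set L.Sentence} (h : S ⊆ T) : pcWorlds T ⊆ pcWorlds S :=
  fun _ hW => ⟨hW.1, fun φ hφ => hW.2 φ (h hφ)⟩

/-- If a closed set of worlds meets the worlds of every member of a directed family of sets of
sentences, then it meets the worlds of the union. -/
theorem exists_mem_pcWorlds_iUnion {ι : Type} [Nonempty ι] (S : ι → Set L.Sentence)
    (hS : Directed (· ⊆ ·) S) (C : Set (World L)) (hC : IsClosed C)
    (h : ∀ i, (pcWorlds (S i) ∩ C).Nonempty) : (pcWorlds (⋃ i, S i) ∩ C).Nonempty := by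
  obtain ⟨W, hW⟩ := IsCompact.nonempty_iInter_of_directed_nonempty_isCompact_isClosed
    (fun i => pcWorlds (S i) ∩ C)
    (fun i j => by
      obtain ⟨k, h1, h2⟩ := hS i j
      exact ⟨k, Set.inter_subset_inter_left _ (pcWorlds_anti h1),
        Set.inter_subset_inter_left _ (pcWorlds_anti h2)⟩) h
    (fun i => ((isClosed_pcWorlds _).inter hC).isCompact)
    (fun i => (isClosed_pcWorlds _).inter hC)
  rw [Set.mem_iInter] at hW
  obtain ⟨i⟩ := ‹Nonempty ι›
  refine ⟨W, ⟨(hW i).1.1, fun φ hφ => ?_⟩, (hW i).2⟩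
  obtain ⟨j, hj⟩ := Set.mem_iUnion.1 hφ
  exact (hW j).1.2 φ hj

/-- The implication from all members of a list. -/
def listImp (l : List L.Sentence) (ψ : L.Sentence) : L.Sentence := l.foldr (fun φ χ => φ ⟹ χ) ψ

theorem Proves.of_listImp {Γ : L.Theory} {l : List L.Sentence} {ψ : L.Sentence}
    (h : Proves Γ (listImp l ψ)) (hl : ∀ φ ∈ l, Proves Γ φ) : Proves Γ ψ := by
  induction l with
  | nil => exact h
  | cons φ l ih =>
    exact ih (.mp h (hl φ List.mem_cons_self)) fun χ hχ => hl χ (List.mem_cons_of_mem _ hχ)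

theorem World.IsPC.listImp {W : World L} (hW : W.IsPC) (l : List L.Sentence) (ψ : L.Sentence) :
    W (listImp l ψ) = true ↔ ((∀ φ ∈ l, W φ = true) → W ψ = true) := by
  induction l with
  | nil => simp [LogicalInduction.listImp]
  | cons φ l ih =>
    have h : LogicalInduction.listImp (φ :: l) ψ = φ ⟹ LogicalInduction.listImp l ψ := rfl
    rw [h, hW.2]
    cases h1 : W φ <;> simp [ih, h1]

theorem Proves.sound {Γ : L.Theory} {φ : L.Sentence} (h : Proves Γ φ) {W : World L}
    (hW : W ∈ pcWorlds Γ) : W φ = true := by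
  induction h with
  | ax h => exact hW.2 _ h
  | taut h => exact h W hW.1
  | mp _ _ ih1 ih2 => simpa [hW.1.2, ih2] using ih1

/-- Propositional compactness: if a finite part of `Γ` had no world, the implication from its
members to `⊥` would be a tautology, and `Γ` would prove `⊥`. -/
theorem IsConsistent.nonempty_pcWorlds {Γ : L.Theory} (h : IsConsistent Γ) :
    (pcWorlds Γ).Nonempty := by
  have : Nonempty {s : Finset L.Sentence // (s : Set L.Sentence) ⊆ Γ} := ⟨⟨∅, by simp⟩⟩
  have h1 := exists_mem_pcWorlds_iUnion (ι := {s : Finset L.Sentence // (s : Set L.Sentence) ⊆ Γ})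
    (h := ?_) (S := fun s => (s.1 : Set L.Sentence)) (C := Set.univ) ?_ isClosed_univ
  · rw [Set.inter_univ] at h1
    refine h1.mono (pcWorlds_anti fun φ hφ => ?_)
    exact Set.mem_iUnion.2 ⟨⟨{φ}, by simpa using hφ⟩, by simp⟩
  · classical
    rintro ⟨s, hs⟩ ⟨t, ht⟩
    exact ⟨⟨s ∪ t, by simp [hs, ht]⟩, by simp, by simp⟩
  · rintro ⟨s, hs⟩
    by_contra hne
    refine h (Proves.of_listImp (l := s.toList) (.taut fun W hW => ?_) fun φ hφ =>
      .ax (hs (by simpa using hφ)))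
    rw [hW.listImp]
    intro hall
    exact absurd ⟨W, ⟨hW, fun φ hφ => hall φ (by simpa using hφ)⟩, trivial⟩ hne

theorem realize_listImp {M : Type*} [L.Structure M] (l : List L.Sentence) (ψ : L.Sentence) :
    M ⊨ listImp l ψ ↔ ((∀ φ ∈ l, M ⊨ φ) → M ⊨ ψ) := by
  induction l with
  | nil => simp [listImp]
  | cons φ l ih =>
    have h : listImp (φ :: l) ψ = φ ⟹ listImp l ψ := rfl
    rw [h, Sentence.Realize, Formula.Realize, BoundedFormula.realize_imp]
    change (M ⊨ φ → M ⊨ listImp l ψ) ↔ _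
    rw [ih]
    simp

/-- First-order consequences of provable sentences are provable. -/
theorem Proves.of_models {Γ : L.Theory} (hΓ : ContainsLogic Γ) {ψ : L.Sentence}
    (h : ∀ (M : Type) [L.Structure M] [Nonempty M], (∀ φ, Proves Γ φ → M ⊨ φ) → M ⊨ ψ) :
    Proves Γ ψ := by
  have h1 : ({φ | Proves Γ φ} : L.Theory) ⊨ᵇ ψ :=
    Theory.models_sentence_iff.2 fun M =>
      h M fun φ hφ => Theory.realize_sentence_of_mem {φ | Proves Γ φ} hφ
  -- By first-order compactness finitely many provable sentences imply `ψ`. That implication is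
  -- logically valid, hence provable, and modus ponens removes its premises.
  obtain ⟨T, hT, h2⟩ := Theory.models_iff_finset_models.1 h1
  refine Proves.of_listImp (l := T.toList) (hΓ _ ?_) fun φ hφ => hT (by simpa using hφ)
  refine Theory.models_sentence_iff.2 fun M => (realize_listImp _ _).2 fun hM => ?_
  have : M ⊨ (T : L.Theory) := (Theory.model_iff _).2 fun φ hφ => hM φ (by simpa using hφ)
  exact h2.realize_sentence M

end Logic

/-! ## The quoted variables in models of the provable sentences -/

section Models

variable {L : FirstOrder.Language.{0, 0}} {M : Type} [L.Structure M]

/-- The value of a closed name. -/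
def QuoteSystem.denote (Q : QuoteSystem L) (M : Type) [L.Structure M] (d : Data) : M :=
  (Q.name d).realize Empty.elim

variable {Q : QuoteSystem L} {α β : Type}

theorem realize_name (d : Data) (v : β → M) :
    ((Q.name d).relabel Empty.elim : L.Term β).realize v = Q.denote M d := by
  rw [Term.realize_relabel, QuoteSystem.denote]
  congr 1
  funext a
  exact a.elim

theorem realize_quote [Encode α] (x : α) (v : β → M) :
    (Q.quote x : L.Term β).realize v = Q.denote M (enc x) := realize_name _ v

theorem realize_forallOne (X : L.Formula (Fin 1)) :
    M ⊨ forallOne X ↔ ∀ x : M, X.Realize fun _ => x := by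
  rw [forallOne, Sentence.Realize, BoundedFormula.realize_alls]
  simp only [BoundedFormula.realize_relabel]
  constructor
  · intro h x
    have := h fun _ => x
    rw [Formula.Realize]
    convert this
    rfl
  · intro h xs
    have := h (xs 0)
    rw [Formula.Realize] at this
    convert this
    rfl

theorem realize_forallTail {k : ℕ} (X : L.Formula (Fin (k + 1))) (v : Fin 1 → M) :
    (QuoteSystem.forallTail X).Realize v ↔
      ∀ ys : Fin k → M, X.Realize (Fin.cases (v 0) ys) := by
  have key : ∀ xs : Fin (k + 0) → M, (Sum.elim v (xs ∘ Fin.castAdd 0) ∘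
      (Fin.cases (Sum.inl 0) Sum.inr : Fin (k + 1) → Fin 1 ⊕ Fin k)) =
        (Fin.cases (v 0) xs : Fin (k + 1) → M) := by
    intro xs
    funext j
    refine Fin.cases rfl (fun j => rfl) j
  rw [QuoteSystem.forallTail, BoundedFormula.realize_alls]
  refine forall_congr' fun xs => ?_
  rw [BoundedFormula.realize_relabel, key, Formula.Realize]
  exact iff_of_eq (congrArg _ (Subsingleton.elim _ _))

theorem realize_subst (X : L.Formula α) (t : α → L.Term β) (v : β → M) :
    Formula.Realize (X.subst t : L.Formula β) v ↔ X.Realize fun a => (t a).realize v :=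
  BoundedFormula.realize_subst

variable {Γ : L.Theory}

theorem QuoteSystem.ProvesValue.realize_iff {k : ℕ} {γ : L.Formula (Fin (k + 1))}
    {d : Fin k → Data} {e : Data} (h : Q.ProvesValue Γ γ d e) (hM : ∀ φ, Proves Γ φ → M ⊨ φ)
    (x : M) :
    γ.Realize (Fin.snoc (α := fun _ => M) (fun i => Q.denote M (d i)) x) ↔ x = Q.denote M e := by
  have h1 := (realize_forallOne _).1 (hM _ h) x
  rw [Formula.realize_iff, realize_subst, Formula.realize_equal, realize_name,
    Term.realize_var] at h1
  rw [← h1]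
  refine iff_of_eq (congrArg _ ?_)
  funext j
  refine Fin.lastCases ?_ (fun j => ?_) j
  · simp
  · simpa using (realize_name (d j) _).symm

/-- In the structure `M`, the formula `X` defines the value of the name of `r`. -/
def QuoteSystem.Defines (Q : QuoteSystem L) (M : Type) [L.Structure M] (X : L.Formula (Fin 1))
    (r : ℚ) : Prop :=
  ∀ x : M, (X.Realize fun _ => x) ↔ x = Q.denote M (enc r)

variable [∀ k, Encodable (L.Functions k)]

/-- With `X` determinate in `M`, the sentence compares two names, and `Γ` proves or refutes this
comparison. -/
theorem realize_gt_iff (hQ : Q.Adequate Γ) (hM : ∀ φ, Proves Γ φ → M ⊨ φ)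
    {X : L.Formula (Fin 1)} {r : ℚ} (hX : Q.Defines M X r) (q : ℚ) :
    M ⊨ Q.gt X q ↔ q < r := by
  have h1 : M ⊨ Q.gt X q ↔ Q.lt.Realize ![Q.denote M (enc q), Q.denote M (enc r)] := by
    rw [QuoteSystem.gt, realize_forallOne]
    have : ∀ x : M, Formula.Realize (X ⟹ Q.lt.subst ![Q.quote q, .var 0]) (fun _ => x) ↔
        (x = Q.denote M (enc r) → Q.lt.Realize ![Q.denote M (enc q), x]) := by
      intro x
      rw [Formula.realize_imp, hX x, realize_subst]
      refine imp_congr_right fun _ => iff_of_eq (congrArg _ ?_)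
      funext j
      fin_cases j
      · exact realize_quote q _
      · rfl
    simp only [this, forall_eq]
  have h2 : M ⊨ (Q.lt.subst ![Q.quote q, Q.quote r] : L.Sentence) ↔
      Q.lt.Realize ![Q.denote M (enc q), Q.denote M (enc r)] := by
    rw [Sentence.Realize, realize_subst]
    refine iff_of_eq (congrArg _ ?_)
    funext j
    fin_cases j
    · exact realize_quote q _
    · exact realize_quote r _
  rw [h1, ← h2]
  by_cases h : q < r
  · exact iff_of_true (hM _ (hQ.lt_true q r h)) h
  · have := hM _ (hQ.lt_false q r h)
    rw [Sentence.realize_not] at this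
    exact iff_of_false this h

-- The value depends on the model, because `Γ` need not decide `φ`. For this reason definability is
-- a notion about a structure rather than about `Γ`.
open scoped Classical in
theorem defines_indicator (φ : L.Sentence) :
    Q.Defines M (Q.indicator φ) (if M ⊨ φ then 1 else 0) := by
  intro x
  have h : Formula.Realize (Formula.relabel Empty.elim φ : L.Formula (Fin 1)) (fun _ => x) ↔
      M ⊨ φ := by
    rw [Formula.realize_relabel, Sentence.Realize]
    exact iff_of_eq (congrArg _ (Subsingleton.elim _ _))
  rw [QuoteSystem.indicator, Formula.realize_sup, Formula.realize_inf, Formula.realize_inf,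
    Formula.realize_not, h, Formula.realize_equal, Formula.realize_equal, realize_quote,
    realize_quote, Term.realize_var]
  by_cases hφ : M ⊨ φ <;> simp [hφ]

/-- Since each factor holds of exactly one element, the universal quantifiers reduce to a single
instance, which `Γ` evaluates. -/
theorem defines_prod (hQ : Q.Adequate Γ) (hM : ∀ φ, Proves Γ φ → M ⊨ φ)
    {X Y : L.Formula (Fin 1)} {r s : ℚ} (hX : Q.Defines M X r) (hY : Q.Defines M Y s) :
    Q.Defines M (Q.prod X Y) (r * s) := by
  intro x
  have hmul := (hQ.mul_rep (r, s)).realize_iff hM x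
  rw [QuoteSystem.prod, realize_forallTail, ← hmul]
  have : ∀ ys : Fin 2 → M, Formula.Realize
      ((Formula.relabel (fun _ => 1) X ⊓ Formula.relabel (fun _ => 2) Y) ⟹
      Q.mul.subst ![.var 1, .var 2, .var 0] : L.Formula (Fin 3)) (Fin.cases x ys) ↔
      (ys 0 = Q.denote M (enc r) ∧ ys 1 = Q.denote M (enc s) → Q.mul.Realize ![ys 0, ys 1, x]) := by
    intro ys
    rw [Formula.realize_imp, Formula.realize_inf, Formula.realize_relabel,
      Formula.realize_relabel, realize_subst, ← hX (ys 0), ← hY (ys 1)]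
    refine imp_congr (Iff.rfl) (iff_of_eq (congrArg _ ?_))
    funext j
    fin_cases j <;> rfl
  simp only [this]
  have hsn : (Fin.snoc (α := fun _ => M) (fun i => Q.denote M (![enc r, enc s] i)) x) =
      ![Q.denote M (enc r), Q.denote M (enc s), x] := by
    funext j; fin_cases j <;> rfl
  rw [hsn]
  constructor
  · intro h
    exact h ![Q.denote M (enc r), Q.denote M (enc s)] ⟨rfl, rfl⟩
  · rintro h ys ⟨h1, h2⟩
    rw [h1, h2]
    exact h

theorem proves_gt (hΓ : ContainsLogic Γ) (hQ : Q.Adequate Γ) {X : L.Formula (Fin 1)} {r q : ℚ}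
    (hX : ∀ (M : Type) [L.Structure M], (∀ φ, Proves Γ φ → M ⊨ φ) → Q.Defines M X r)
    (h : q < r) : Proves Γ (Q.gt X q) :=
  .of_models hΓ fun M _ _ hM => (realize_gt_iff hQ hM (hX M hM) q).2 h

theorem proves_not_gt (hΓ : ContainsLogic Γ) (hQ : Q.Adequate Γ) {X : L.Formula (Fin 1)} {r q : ℚ}
    (hX : ∀ (M : Type) [L.Structure M], (∀ φ, Proves Γ φ → M ⊨ φ) → Q.Defines M X r)
    (h : ¬ q < r) : Proves Γ ∼(Q.gt X q) :=
  .of_models hΓ fun M _ _ hM => (Sentence.realize_not _).2 fun h' =>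
    h ((realize_gt_iff hQ hM (hX M hM) q).1 h')

/-- In a model of `φ` the indicator has the value `1`, so the product has the value of `X`. This is
the only property of the product used by the bets; it bounds what is bought from below. -/
theorem proves_gt_prod_indicator (hΓ : ContainsLogic Γ) (hQ : Q.Adequate Γ)
    {X : L.Formula (Fin 1)} {r : ℚ}
    (hX : ∀ (M : Type) [L.Structure M], (∀ φ, Proves Γ φ → M ⊨ φ) → Q.Defines M X r)
    (φ : L.Sentence) (q : ℚ) :
    Proves Γ (φ ⟹ (Q.gt X q ⟹ Q.gt (Q.prod (Q.indicator φ) X) q)) := by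
  classical
  refine .of_models hΓ fun M _ _ hM => ?_
  rw [Sentence.Realize, Formula.realize_imp, Formula.realize_imp]
  intro (h1 : M ⊨ φ) (h2 : M ⊨ Q.gt X q)
  have h3 := defines_prod hQ hM (defines_indicator φ) (hX M hM)
  rw [if_pos h1, one_mul] at h3
  exact (realize_gt_iff hQ hM h3 q).2 ((realize_gt_iff hQ hM (hX M hM) q).1 h2)

variable [∀ k, Encodable (L.Relations k)]

/-- Each of the represented functions has exactly one value in `M`, so only one triple `m, x, r`
satisfies the premises. The future price thus becomes determinate in `Γ`, although it is not
available on day `n`. -/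
theorem defines_futureIndicator (hM : ∀ φ, Proves Γ φ → M ⊨ φ)
    {P : ℕ+ → L.Sentence → ℚ} {f : ℕ+ → ℕ+} {p : ℕ+ → ℚ}
    {γf : L.Formula (Fin 2)} {γP : L.Formula (Fin 3)} {γp : L.Formula (Fin 2)}
    {γI : L.Formula (Fin 4)}
    (hγf : Q.Represents Γ γf (fun n : ℕ+ => ![enc n]) (fun n => enc (f n)))
    (hγP : Q.Represents Γ γP (fun x : ℕ+ × L.Sentence => ![enc x.1, enc x.2])
      (fun x => enc (P x.1 x.2)))
    (hγp : Q.Represents Γ γp (fun n : ℕ+ => ![enc n]) (fun n => enc (p n)))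
    (hγI : Q.Represents Γ γI
      (fun x : {d : ℚ // 0 < d} × ℚ × ℚ => ![enc x.1.1, enc x.2.1, enc x.2.2])
      (fun x => enc (ctsInd x.1.1 x.2.1 x.2.2)))
    (n : ℕ+) (φ : L.Sentence) {δ : ℚ} (hδ : 0 < δ) :
    Q.Defines M (Q.futureIndicator γf γP γp γI n φ δ) (ctsInd δ (P (f n) φ) (p n)) := by
  intro x
  have h1 : ∀ m : M, γf.Realize ![Q.denote M (enc n), m] ↔ m = Q.denote M (enc (f n)) := by
    intro m
    rw [← (hγf n).realize_iff hM m]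
    refine iff_of_eq (congrArg _ ?_)
    funext j; fin_cases j <;> rfl
  have h2 : ∀ y : M, γP.Realize ![Q.denote M (enc (f n)), Q.denote M (enc φ), y] ↔
      y = Q.denote M (enc (P (f n) φ)) := by
    intro m
    rw [← (hγP (f n, φ)).realize_iff hM m]
    refine iff_of_eq (congrArg _ ?_)
    funext j; fin_cases j <;> rfl
  have h3 : ∀ m : M, γp.Realize ![Q.denote M (enc n), m] ↔ m = Q.denote M (enc (p n)) := by
    intro m
    rw [← (hγp n).realize_iff hM m]
    refine iff_of_eq (congrArg _ ?_)
    funext j; fin_cases j <;> rfl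
  have h4 : γI.Realize ![Q.denote M (enc δ), Q.denote M (enc (P (f n) φ)), Q.denote M (enc (p n)),
      x] ↔ x = Q.denote M (enc (ctsInd δ (P (f n) φ) (p n))) := by
    rw [← (hγI (⟨δ, hδ⟩, P (f n) φ, p n)).realize_iff hM x]
    refine iff_of_eq (congrArg _ ?_)
    funext j; fin_cases j <;> rfl
  rw [QuoteSystem.futureIndicator, realize_forallTail, ← h4]
  have : ∀ ys : Fin 3 → M, Formula.Realize
      ((γf.subst ![Q.quote n, .var 1] ⊓ γP.subst ![.var 1, Q.quote φ, .var 2] ⊓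
        γp.subst ![Q.quote n, .var 3]) ⟹
      γI.subst ![Q.quote δ, .var 2, .var 3, .var 0] : L.Formula (Fin 4)) (Fin.cases x ys) ↔
      ((γf.Realize ![Q.denote M (enc n), ys 0] ∧
        γP.Realize ![ys 0, Q.denote M (enc φ), ys 1]) ∧ γp.Realize ![Q.denote M (enc n), ys 2] →
        γI.Realize ![Q.denote M (enc δ), ys 1, ys 2, x]) := by
    intro ys
    rw [Formula.realize_imp, Formula.realize_inf, Formula.realize_inf, realize_subst,
      realize_subst, realize_subst, realize_subst]
    refine imp_congr (and_congr (and_congr (iff_of_eq (congrArg _ ?_)) (iff_of_eq (congrArg _ ?_)))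
      (iff_of_eq (congrArg _ ?_))) (iff_of_eq (congrArg _ ?_)) <;>
    · funext j
      fin_cases j <;> first | rfl | exact realize_quote _ _
  simp only [this]
  constructor
  · intro h
    exact h ![Q.denote M (enc (f n)), Q.denote M (enc (P (f n) φ)), Q.denote M (enc (p n))]
      ⟨⟨(h1 _).2 rfl, (h2 _).2 rfl⟩, (h3 _).2 rfl⟩
  · rintro h ys ⟨⟨e1, e2⟩, e3⟩
    rw [h1] at e1
    rw [e1, h2] at e2
    rw [h3] at e3
    rw [e2, e3]
    exact h

end Models

/-! ## Propositional refutations -/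

section Tableau

variable {L : FirstOrder.Language.{0, 0}}

/-- A sentence with the truth value that it is assumed to have. -/
abbrev Signed (L : FirstOrder.Language.{0, 0}) : Type := Bool × L.Sentence

/-- A branch of a tableau: the assumptions to be analyzed, and those on prime sentences. -/
abbrev Branch (L : FirstOrder.Language.{0, 0}) : Type := List (Signed L) × List (Signed L)

def isFalsum : L.Sentence → Bool
  | .falsum => true
  | _ => false

def isImp : L.Sentence → Bool
  | .imp _ _ => true
  | _ => false

def impLeft : L.Sentence → L.Sentence
  | .imp φ _ => φ
  | φ => φ

def impRight : L.Sentence → L.Sentence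
  | .imp _ ψ => ψ
  | φ => φ

open scoped Classical in
/-- The branches that result from the analysis of the first assumption of a branch. -/
noncomputable def expand (s : Signed L) (br : Branch L) : List (Branch L) :=
  bif isFalsum s.2 then
    bif s.1 then [] else [br]
  else bif isImp s.2 then
    bif s.1 then [((false, impLeft s.2) :: br.1, br.2), ((true, impRight s.2) :: br.1, br.2)]
    else [((true, impLeft s.2) :: (false, impRight s.2) :: br.1, br.2)]
  else bif br.2.any (fun x => decide (x = (!s.1, s.2))) then [] else [(br.1, s :: br.2)]

/-- One step of the analysis of a tableau; closed branches are dropped. -/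
noncomputable def tableauStep (st : List (Branch L)) : List (Branch L) :=
  bif st.isEmpty || (st.headD ([], [])).1.isEmpty then st else
    expand ((st.headD ([], [])).1.headD (true, ⊥))
      ((st.headD ([], [])).1.tail, (st.headD ([], [])).2) ++ st.tail

/-- Within `N` steps, all branches of the tableau for the given assumptions are closed. -/
noncomputable def refutes (N : ℕ) (l : List (Signed L)) : Bool :=
  (tableauStep^[N] [(l, [])]).isEmpty

/-- The assumptions on a branch hold in the world `W`. -/
def SatBranch (W : World L) (br : Branch L) : Prop :=
  (∀ s ∈ br.1, W s.2 = s.1) ∧ ∀ s ∈ br.2, W s.2 = s.1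

theorem tableauStep_nil : tableauStep ([] : List (Branch L)) = [] := rfl

/-- A branch that is fully analyzed and not closed blocks the stack for good, so the tableau is
never counted as refuted. -/
theorem tableauStep_stuck (lits : List (Signed L)) (st : List (Branch L)) :
    tableauStep (([], lits) :: st) = ([], lits) :: st := rfl

theorem tableauStep_cons (s : Signed L) (l lits : List (Signed L)) (st : List (Branch L)) :
    tableauStep ((s :: l, lits) :: st) = expand s (l, lits) ++ st := rfl

theorem falsum_or_imp_or_prime (φ : L.Sentence) : φ = ⊥ ∨ (∃ ψ χ : L.Sentence, φ = ψ ⟹ χ) ∨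
    (isFalsum φ = false ∧ isImp φ = false) := by
  cases φ with
  | falsum => exact .inl rfl
  | imp ψ χ => exact .inr (.inl ⟨ψ, χ, rfl⟩)
  | _ => exact .inr (.inr ⟨rfl, rfl⟩)

theorem satBranch_cons {W : World L} {s : Signed L} {l lits : List (Signed L)} :
    SatBranch W (s :: l, lits) ↔ W s.2 = s.1 ∧ SatBranch W (l, lits) := by
  simp [SatBranch, and_assoc]

theorem satBranch_cons_right {W : World L} {s : Signed L} {l lits : List (Signed L)} :
    SatBranch W (l, s :: lits) ↔ W s.2 = s.1 ∧ SatBranch W (l, lits) := by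
  simp [SatBranch]; tauto

theorem expand_falsum (b : Bool) (br : Branch L) :
    expand (b, ⊥) br = bif b then [] else [br] := rfl

theorem expand_imp (b : Bool) (φ ψ : L.Sentence) (br : Branch L) :
    expand (b, φ ⟹ ψ) br = bif b then [((false, φ) :: br.1, br.2), ((true, ψ) :: br.1, br.2)]
      else [((true, φ) :: (false, ψ) :: br.1, br.2)] := rfl

theorem expand_prime {s : Signed L} (h1 : isFalsum s.2 = false) (h2 : isImp s.2 = false)
    (br : Branch L) :
    (expand s br = [] ∧ (!s.1, s.2) ∈ br.2) ∨
      (expand s br = [(br.1, s :: br.2)] ∧ (!s.1, s.2) ∉ br.2) := by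
  classical
  by_cases h : (!s.1, s.2) ∈ br.2
  · left
    have : (br.2.any fun x => decide (x = (!s.1, s.2))) = true :=
      List.any_eq_true.2 ⟨_, h, by simp⟩
    simp [expand, h1, h2, h, this]
  · right
    simp only [expand, h1, h2, cond_false, h, not_false_iff, and_true]
    rw [List.any_eq_false.2]
    · rfl
    · rintro x hx
      simp only [decide_eq_true_eq]
      rintro rfl
      exact h hx

/-- One direction gives soundness of tableaux, the other one passes unsatisfiability on to all new
branches, as completeness requires. -/
theorem exists_satBranch_expand {W : World L} (hW : W.IsPC) (s : Signed L) (br : Branch L) :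
    (∃ br' ∈ expand s br, SatBranch W br') ↔ W s.2 = s.1 ∧ SatBranch W br := by
  obtain ⟨b, φ⟩ := s
  obtain ⟨l, lits⟩ := br
  rcases falsum_or_imp_or_prime φ with rfl | ⟨ψ, χ, rfl⟩ | ⟨h1, h2⟩
  · rw [expand_falsum]
    cases b <;> simp [hW.1]
  · rw [expand_imp]
    cases b
    · simp [satBranch_cons, hW.2, and_assoc]
    · simp only [cond_true, List.mem_cons, List.not_mem_nil, or_false, exists_eq_or_imp,
        exists_eq_left, satBranch_cons, hW.2]
      cases W ψ <;> simp
  · rcases expand_prime (s := (b, φ)) h1 h2 (l, lits) with ⟨h3, h4⟩ | ⟨h3, h4⟩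
    · rw [h3]
      simp only [List.not_mem_nil, false_and, exists_false, false_iff]
      rintro ⟨h5, h6⟩
      have := h6.2 _ h4
      dsimp only at h5 this
      rw [h5] at this
      cases b <;> simp at this
    · rw [h3]
      simp [satBranch_cons_right]

theorem satBranch_tableauStep {W : World L} (hW : W.IsPC) {st : List (Branch L)}
    (h : ∃ br ∈ st, SatBranch W br) : ∃ br ∈ tableauStep st, SatBranch W br := by
  rcases st with _ | ⟨⟨_ | ⟨s, l⟩, lits⟩, st⟩
  · exact h
  · exact h
  · rw [tableauStep_cons]
    obtain ⟨br, hbr, h⟩ := h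
    rcases List.mem_cons.1 hbr with rfl | hbr
    · obtain ⟨br', h1, h2⟩ := (exists_satBranch_expand hW s (l, lits)).2 (satBranch_cons.1 h)
      exact ⟨br', List.mem_append_left _ h1, h2⟩
    · exact ⟨br, List.mem_append_right _ hbr, h⟩

/-- A world that satisfies all assumptions satisfies some branch at every stage, so the stack never
becomes empty. -/
theorem refutes_sound {N : ℕ} {l : List (Signed L)} (h : refutes N l = true) {W : World L}
    (hW : W.IsPC) : ∃ s ∈ l, W s.2 ≠ s.1 := by
  by_contra! hl
  have key : ∀ N, ∃ br ∈ tableauStep^[N] [(l, [])], SatBranch W br := by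
    intro N
    induction N with
    | zero => exact ⟨(l, []), by simp, hl, by simp⟩
    | succ N ih =>
      rw [Function.iterate_succ_apply']
      exact satBranch_tableauStep hW ih
  obtain ⟨br, hbr, -⟩ := key N
  rw [refutes, List.isEmpty_iff] at h
  rw [h] at hbr
  simp at hbr

theorem refutes_mono {N N' : ℕ} (hN : N ≤ N') {l : List (Signed L)} (h : refutes N l = true) :
    refutes N' l = true := by
  obtain ⟨k, rfl⟩ := Nat.exists_eq_add_of_le' hN
  rw [refutes, List.isEmpty_iff] at *
  rw [Function.iterate_add_apply, h]
  exact Function.iterate_fixed tableauStep_nil k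

variable [∀ k, Encodable (L.Functions k)] [∀ k, Encodable (L.Relations k)]

/-- The truth value of a formula, given those of the prime formulas. -/
def propEval (v : Data → Bool) : ∀ {n : ℕ}, L.BoundedFormula Empty n → Bool
  | _, .falsum => false
  | _, .imp φ ψ => !propEval v φ || propEval v ψ
  | _, φ => v (encFormula Empty.elim φ)

theorem isPC_propEval (v : Data → Bool) : World.IsPC (L := L) fun φ => propEval v φ :=
  ⟨rfl, fun _ _ => rfl⟩

theorem propEval_prime (v : Data → Bool) {φ : L.Sentence} (h1 : isFalsum φ = false)
    (h2 : isImp φ = false) : propEval v φ = v (enc φ) := by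
  cases φ with
  | falsum => simp [isFalsum] at h1
  | imp φ ψ => simp [isImp] at h2
  | _ => rfl

/-- The second component of a branch consists of consistent assumptions on prime sentences. -/
def GoodLits (lits : List (Signed L)) : Prop :=
  (∀ s ∈ lits, isFalsum s.2 = false ∧ isImp s.2 = false) ∧ ∀ s ∈ lits, (!s.1, s.2) ∉ lits

/-- Make true exactly the prime sentences that are asserted; a denied one is then false because it
is not asserted as well. -/
theorem GoodLits.exists_sat {lits : List (Signed L)} (h : GoodLits lits) :
    ∃ W : World L, W.IsPC ∧ SatBranch W ([], lits) := by
  classical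
  refine ⟨_, isPC_propEval fun d => decide (∃ s ∈ lits, s.1 = true ∧ enc s.2 = d), by simp, ?_⟩
  rintro ⟨b, φ⟩ hs
  dsimp only
  rw [propEval_prime _ (h.1 _ hs).1 (h.1 _ hs).2]
  cases b
  · rw [decide_eq_false_iff_not]
    rintro ⟨⟨b, ψ⟩, h1, h2, h3⟩
    have h4 := enc_sentence_injective h3
    dsimp only at h2 h4
    subst h2 h4
    exact h.2 _ hs h1
  · rw [decide_eq_true_eq]
    exact ⟨_, hs, rfl, rfl⟩

/-- The total size of the assumptions that are still to be analyzed. -/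
def todoSize (l : List (Signed L)) : ℕ := (l.map fun s => encSize s.2).sum

theorem encSize_imp (φ ψ : L.Sentence) :
    encSize (φ ⟹ ψ : L.Sentence) = encSize φ + encSize ψ + 9 := by
  change (Data.unary 3).size + ((enc φ).size + (enc ψ).size + 1) + 1 = _
  rw [Data.size_unary]; simp only [encSize]; omega

/-- The termination measure: an assumption is replaced by immediate subsentences, or it leaves the
list. -/
theorem todoSize_expand {s : Signed L} {l lits : List (Signed L)} {br : Branch L}
    (hbr : br ∈ expand s (l, lits)) : todoSize br.1 < todoSize (s :: l) := by
  obtain ⟨b, φ⟩ := s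
  have h0 : 0 < encSize φ := one_le_encSize φ
  rcases falsum_or_imp_or_prime φ with rfl | ⟨ψ, χ, rfl⟩ | ⟨h1, h2⟩
  · rw [expand_falsum] at hbr
    cases b
    · simp at hbr; subst hbr; simpa [todoSize] using h0
    · simp at hbr
  · have h := encSize_imp ψ χ
    rw [expand_imp] at hbr
    cases b
    · simp at hbr; subst hbr; simp [todoSize] at h ⊢; omega
    · simp at hbr
      rcases hbr with rfl | rfl <;> simp [todoSize] at h ⊢ <;> omega
  · rcases expand_prime (s := (b, φ)) h1 h2 (l, lits) with ⟨h3, h4⟩ | ⟨h3, h4⟩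
    · rw [h3] at hbr; simp at hbr
    · rw [h3] at hbr; simp at hbr; subst hbr; simpa [todoSize] using h0

theorem GoodLits.expand {s : Signed L} {l lits : List (Signed L)} {br : Branch L}
    (h : GoodLits lits) (hbr : br ∈ expand s (l, lits)) : GoodLits br.2 := by
  obtain ⟨b, φ⟩ := s
  rcases falsum_or_imp_or_prime φ with rfl | ⟨ψ, χ, rfl⟩ | ⟨h1, h2⟩
  · rw [expand_falsum] at hbr
    cases b
    · simp at hbr; subst hbr; exact h
    · simp at hbr
  · rw [expand_imp] at hbr
    cases b
    · simp at hbr; subst hbr; exact h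
    · simp at hbr
      rcases hbr with rfl | rfl <;> exact h
  · rcases expand_prime (s := (b, φ)) h1 h2 (l, lits) with ⟨h3, h4⟩ | ⟨h3, h4⟩
    · rw [h3] at hbr; simp at hbr
    · rw [h3] at hbr
      simp only [List.mem_singleton] at hbr
      subst hbr
      refine ⟨fun s hs => ?_, fun s hs => ?_⟩
      · rcases List.mem_cons.1 hs with rfl | hs
        · exact ⟨h1, h2⟩
        · exact h.1 s hs
      · rcases List.mem_cons.1 hs with rfl | hs
        · simpa using h4
        · rw [List.mem_cons, not_or]
          refine ⟨fun h5 => ?_, h.2 s hs⟩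
          rw [← h5] at h4
          simp [hs] at h4

/-- The stack is processed depth first, so the number of steps that closes a branch does not depend
on the branches below, and these numbers add up. -/
theorem exists_iterate_tableauStep (n : ℕ) (l lits : List (Signed L)) (hl : todoSize l ≤ n)
    (hlits : GoodLits lits) (hunsat : ∀ W : World L, W.IsPC → ¬ SatBranch W (l, lits)) :
    ∃ N, ∀ st, tableauStep^[N] ((l, lits) :: st) = st := by
  induction n generalizing l lits with
  | zero =>
    rcases l with _ | ⟨s, l⟩
    · obtain ⟨W, hW, h⟩ := hlits.exists_sat
      exact absurd h (hunsat W hW)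
    · have := one_le_encSize s.2
      simp [todoSize] at hl; omega
  | succ n ih =>
    rcases l with _ | ⟨s, l⟩
    · obtain ⟨W, hW, h⟩ := hlits.exists_sat
      exact absurd h (hunsat W hW)
    · have h1 : ∀ br ∈ expand s (l, lits), ∃ N, ∀ st, tableauStep^[N] (br :: st) = st := by
        rintro ⟨l', lits'⟩ hbr
        have h2 := todoSize_expand hbr
        refine ih _ _ (by dsimp only at h2; omega) (hlits.expand hbr) fun W hW h => ?_
        have := (exists_satBranch_expand hW s (l, lits)).1 ⟨_, hbr, h⟩
        exact hunsat W hW (satBranch_cons.2 this)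
      have h2 : ∀ bs : List (Branch L), (∀ br ∈ bs, ∃ N, ∀ st, tableauStep^[N] (br :: st) = st) →
          ∃ N, ∀ st, tableauStep^[N] (bs ++ st) = st := by
        intro bs
        induction bs with
        | nil => exact fun _ => ⟨0, fun st => rfl⟩
        | cons br bs ihb =>
          intro h
          obtain ⟨N, hN⟩ := h br List.mem_cons_self
          obtain ⟨N', hN'⟩ := ihb fun br hbr => h br (List.mem_cons_of_mem _ hbr)
          refine ⟨N' + N, fun st => ?_⟩
          rw [Function.iterate_add_apply, List.cons_append, hN, hN']
      obtain ⟨N, hN⟩ := h2 _ h1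
      exact ⟨N + 1, fun st => by rw [Function.iterate_succ_apply, tableauStep_cons, hN]⟩

/-- Completeness without a bound on `N`. Exponentially many steps do no harm, since a bet may stay
open for any finite time. -/
theorem exists_refutes {l : List (Signed L)}
    (h : ∀ W : World L, W.IsPC → ∃ s ∈ l, W s.2 ≠ s.1) : ∃ N, refutes N l = true := by
  obtain ⟨N, hN⟩ := exists_iterate_tableauStep _ l [] le_rfl ⟨by simp, by simp⟩ fun W hW hs => by
    obtain ⟨s, hs', hne⟩ := h W hW
    exact hne (hs.1 s hs')
  exact ⟨N, by rw [refutes, hN]; rfl⟩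

/-- A branch gives way to at most two branches that are no larger. So the stack grows by at most one
branch per step, and `N` steps take time polynomial in `N` and the input. -/
theorem encSize_expand {s : Signed L} {l lits : List (Signed L)} :
    (∀ br ∈ expand s (l, lits), encSize br ≤ encSize (s :: l, lits)) ∧
      (expand s (l, lits)).length ≤ 2 := by
  obtain ⟨b, φ⟩ := s
  rcases falsum_or_imp_or_prime φ with rfl | ⟨ψ, χ, rfl⟩ | ⟨h1, h2⟩
  · rw [expand_falsum]
    cases b
    · simp [encSize_pair, encSize_cons]; omega
    · simp
  · have h := encSize_imp ψ χ
    rw [expand_imp]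
    have ht : encSize true = 3 := rfl
    have hf : encSize false = 1 := rfl
    cases b
    · simp [encSize_pair, encSize_cons] at *; omega
    · simp [encSize_pair, encSize_cons] at *; omega
  · rcases expand_prime (s := (b, φ)) h1 h2 (l, lits) with ⟨h3, h4⟩ | ⟨h3, h4⟩
    · rw [h3]; simp
    · rw [h3]; simp [encSize_pair, encSize_cons]; omega

/-! ### Tableaux with a given number of steps run in polynomial time -/

namespace PolyTime

variable {α β : Type} [Encode α] [Encode β]

open scoped Classical in
theorem isFalsum : PolyTime (isFalsum : L.Sentence → Bool) := by
  have h : PolyTime fun φ : L.Sentence => decide ((enc φ).head = .unary 0) :=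
    dataEq (dataHead id.to_enc) (const _)
  exact h.congr fun φ => by
    cases φ <;> simp [enc, encFormula, Data.head, Data.unary, LogicalInduction.isFalsum]

open scoped Classical in
theorem isImp : PolyTime (isImp : L.Sentence → Bool) := by
  have h : PolyTime fun φ : L.Sentence => decide ((enc φ).head = .unary 3) :=
    dataEq (dataHead id.to_enc) (const _)
  exact h.congr fun φ => by
    cases φ <;> simp [enc, encFormula, Data.head, Data.unary, LogicalInduction.isImp]

theorem impLeft : PolyTime (impLeft : L.Sentence → L.Sentence) := by
  have h0 := id.to_enc (α := L.Sentence)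
  have h : PolyTime fun φ : L.Sentence => bif LogicalInduction.isImp φ then (enc φ).tail.head
      else enc φ := cond isImp (by fun_prop) h0
  refine of_enc (h.congr fun φ => ?_)
  cases φ <;> rfl

theorem impRight : PolyTime (impRight : L.Sentence → L.Sentence) := by
  have h0 := id.to_enc (α := L.Sentence)
  have h : PolyTime fun φ : L.Sentence => bif LogicalInduction.isImp φ then (enc φ).tail.tail
      else enc φ := cond isImp (by fun_prop) h0
  refine of_enc (h.congr fun φ => ?_)
  cases φ <;> rfl

theorem enc_signed_injective : Function.Injective (enc : Signed L → Data) := by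
  rintro ⟨b, φ⟩ ⟨c, ψ⟩ h
  simp only [enc_pair, Data.cons.injEq] at h
  rw [enc_bool_injective h.1, enc_sentence_injective h.2]

open scoped Classical in
theorem expand : PolyTime fun x : Signed L × Branch L => expand x.1 x.2 := by
  unfold LogicalInduction.expand
  have h1 : PolyTime fun x : Signed L × Branch L => LogicalInduction.isFalsum x.1.2 :=
    isFalsum.comp (by fun_prop)
  have h2 : PolyTime fun x : Signed L × Branch L => LogicalInduction.isImp x.1.2 :=
    isImp.comp (by fun_prop)
  have h3 : PolyTime fun x : Signed L × Branch L => LogicalInduction.impLeft x.1.2 :=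
    impLeft.comp (by fun_prop)
  have h4 : PolyTime fun x : Signed L × Branch L => LogicalInduction.impRight x.1.2 :=
    impRight.comp (by fun_prop)
  have h5 := any (α := Signed L × Branch L) (l := fun x => x.2.2)
    (p := fun x y => decide (y = (!x.1.1, x.1.2))) (by fun_prop)
    (eq_of_injective (f := fun z : (Signed L × Branch L) × Signed L => z.2)
      (g := fun z => (!z.1.1.1, z.1.1.2)) enc_signed_injective (by fun_prop) (by fun_prop))
  fun_prop

theorem tableauStep : PolyTime (tableauStep : List (Branch L) → List (Branch L)) := by
  refine congr (f := fun st => LogicalInduction.tableauStep st) ?_ fun _ => rfl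
  unfold LogicalInduction.tableauStep
  have h := comp (g := fun st : List (Branch L) => ((st.headD ([], [])).1.headD (true, ⊥),
      ((st.headD ([], [])).1.tail, (st.headD ([], [])).2))) expand (by fun_prop)
  fun_prop

theorem refutes {N : α → Unary} {l : α → List (Signed L)} (hN : PolyTime N) (hl : PolyTime l) :
    PolyTime fun a => refutes (N a).val (l a) := by
  refine comp (f := fun x : Unary × List (Signed L) => LogicalInduction.refutes x.1.val x.2) ?_
    (pair hN hl)
  unfold LogicalInduction.refutes
  have key : ∀ (x : Unary × List (Signed L)) (st : List (Branch L)),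
      (∀ br ∈ st, encSize br ≤ encSize x) →
      (∀ br ∈ LogicalInduction.tableauStep st, encSize br ≤ encSize x) ∧
      encSize (LogicalInduction.tableauStep st) ≤ encSize st + (encSize x + 1) := by
    intro x st hst
    rcases st with _ | ⟨⟨_ | ⟨s, l⟩, lits⟩, st⟩
    · exact ⟨hst, by rw [tableauStep_nil]; omega⟩
    · exact ⟨hst, by rw [tableauStep_stuck]; omega⟩
    · rw [tableauStep_cons]
      obtain ⟨h1, h2⟩ := encSize_expand (s := s) (l := l) (lits := lits)
      have h3 := hst _ List.mem_cons_self
      generalize LogicalInduction.expand s (l, lits) = e at *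
      refine ⟨fun br hbr => ?_, ?_⟩
      · rcases List.mem_append.1 hbr with hbr | hbr
        · exact (h1 br hbr).trans h3
        · exact hst br (List.mem_cons_of_mem _ hbr)
      · have h4 := encSize_append e st
        rw [encSize_cons]
        rcases e with _ | ⟨b1, _ | ⟨b2, _ | ⟨b3, e⟩⟩⟩
        · rw [encSize_nil] at h4; omega
        · have := h1 b1 (by simp)
          rw [encSize_cons, encSize_nil] at h4; omega
        · have := h1 b1 (by simp)
          have := h1 b2 (by simp)
          rw [encSize_cons, encSize_cons, encSize_nil] at h4; omega
        · simp at h2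
  exact isEmpty (iterate_of_growth (α := Unary × List (Signed L)) (n := fun x => x.1)
    (init := fun x => [(x.2, [])]) (step := fun _ st => LogicalInduction.tableauStep st)
    (by fun_prop) (by fun_prop) (tableauStep.comp snd)
    (fun x st => ∀ br ∈ st, encSize br ≤ encSize x)
    (fun x br hbr => by
      have := one_le_encSize x.1
      have h : encSize x = encSize x.1 + encSize x.2 + 1 := rfl
      simp only [List.mem_singleton] at hbr
      subst hbr
      rw [encSize_pair, encSize_nil]; omega)
    (fun x st h => (key x st h).1) (.X + 1) (fun x st h => by simpa using (key x st h).2))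

end PolyTime

end Tableau

/-! ## Operations on feature expressions -/

section Features

variable {S : Type}

namespace FeatureExpr

/-- The expression with the indices of all variables increased by `k`. -/
def shift (k : ℕ) : FeatureExpr S → FeatureExpr S
  | price φ i => price φ i
  | const q => const q
  | var j => var (j + k)
  | add a b => add (a.shift k) (b.shift k)
  | mul a b => mul (a.shift k) (b.shift k)
  | max a b => max (a.shift k) (b.shift k)
  | recip a => recip (a.shift k)

theorem eval_shift (V : ℕ+ → S → ℝ) (env env' : List ℝ) (e : FeatureExpr S) :
    (e.shift env.length).eval V (env ++ env') = e.eval V env' := by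
  induction e with
  | var j =>
    simp only [shift, eval]
    rw [List.getD_append_right _ _ _ _ (by omega), Nat.add_sub_cancel]
  | _ => simp_all [shift, eval]

theorem WellFormed.mono {e : FeatureExpr S} {n n' : ℕ+} {m m' : ℕ} (h : e.WellFormed n m)
    (hn : n ≤ n') (hm : m ≤ m') : e.WellFormed n' m' := by
  induction e with
  | price φ i => exact le_trans (show i ≤ n from h) hn
  | const q => trivial
  | var j => exact lt_of_lt_of_le (show j < m from h) hm
  | add a b iha ihb => exact ⟨iha h.1, ihb h.2⟩
  | mul a b iha ihb => exact ⟨iha h.1, ihb h.2⟩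
  | max a b iha ihb => exact ⟨iha h.1, ihb h.2⟩
  | recip a iha => exact iha h

theorem WellFormed.shift {e : FeatureExpr S} {n : ℕ+} {m : ℕ} (h : e.WellFormed n m) (k : ℕ) :
    (e.shift k).WellFormed n (k + m) := by
  induction e with
  | price φ i => exact h
  | const q => trivial
  | var j =>
    have : j < m := h
    change j + k < k + m
    omega
  | add a b iha ihb => exact ⟨iha h.1, ihb h.2⟩
  | mul a b iha ihb => exact ⟨iha h.1, ihb h.2⟩
  | max a b iha ihb => exact ⟨iha h.1, ihb h.2⟩
  | recip a iha => exact iha h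

/-- The sum of a list of expressions. -/
def sum (l : List (FeatureExpr S)) : FeatureExpr S := l.foldl add (const 0)

theorem eval_sum (V : ℕ+ → S → ℝ) (env : List ℝ) (l : List (FeatureExpr S)) :
    (sum l).eval V env = (l.map fun e => e.eval V env).sum := by
  have key : ∀ a : FeatureExpr S, (l.foldl add a).eval V env =
      a.eval V env + (l.map fun e => e.eval V env).sum := by
    induction l with
    | nil => simp
    | cons e l ih => intro a; rw [List.foldl_cons, ih]; simp [eval]; ring
  rw [sum, key]
  simp [eval]

theorem wellFormed_sum {n : ℕ+} {m : ℕ} {l : List (FeatureExpr S)}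
    (h : ∀ e ∈ l, e.WellFormed n m) : (sum l).WellFormed n m := by
  have key : ∀ a : FeatureExpr S, a.WellFormed n m → (l.foldl add a).WellFormed n m := by
    induction l with
    | nil => exact fun a ha => ha
    | cons e l ih =>
      exact fun a ha => ih (fun e he => h e (List.mem_cons_of_mem _ he)) _
        ⟨ha, h e List.mem_cons_self⟩
  exact key _ trivial

/-- The negative of an expression. -/
def neg (a : FeatureExpr S) : FeatureExpr S := mul (const (-1)) a

theorem eval_neg (V : ℕ+ → S → ℝ) (env : List ℝ) (a : FeatureExpr S) :
    a.neg.eval V env = -a.eval V env := by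
  simp [neg, eval]

theorem WellFormed.neg {n : ℕ+} {m : ℕ} {a : FeatureExpr S} (h : a.WellFormed n m) :
    a.neg.WellFormed n m := ⟨trivial, h⟩

/-! ### Shifting variables with a stack machine -/

def isVar : FeatureExpr S → Bool
  | var _ => true
  | _ => false

def isBin : FeatureExpr S → Bool
  | add _ _ => true
  | mul _ _ => true
  | max _ _ => true
  | _ => false

def isRecip : FeatureExpr S → Bool
  | recip _ => true
  | _ => false

def varIdx : FeatureExpr S → ℕ
  | var j => j
  | _ => 0

def argL : FeatureExpr S → FeatureExpr S
  | add a _ => a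
  | mul a _ => a
  | max a _ => a
  | recip a => a
  | e => e

def argR : FeatureExpr S → FeatureExpr S
  | add _ b => b
  | mul _ b => b
  | max _ b => b
  | e => e

/-- The expression with the outermost operation of `e` and the given arguments. -/
def rebuild (e a b : FeatureExpr S) : FeatureExpr S :=
  match e with
  | add _ _ => add a b
  | mul _ _ => mul a b
  | max _ _ => max a b
  | recip _ => recip a
  | e => e

/-- One step of the computation of `shift`; a task `(true, e)` is to shift `e`, and a task
`(false, e)` is to apply the outermost operation of `e` to the last results. -/
def shiftStep (k : ℕ) (s : List (Bool × FeatureExpr S) × List (FeatureExpr S)) :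
    List (Bool × FeatureExpr S) × List (FeatureExpr S) :=
  bif s.1.isEmpty then s else
  let b := (s.1.headD (true, const 0)).1
  let e := (s.1.headD (true, const 0)).2
  bif b then
    bif e.isVar then (s.1.tail, var (e.varIdx + k) :: s.2)
    else bif e.isBin then
      ((true, e.argL) :: (true, e.argR) :: (false, e) :: s.1.tail, s.2)
    else bif e.isRecip then ((true, e.argL) :: (false, e) :: s.1.tail, s.2)
    else (s.1.tail, e :: s.2)
  else bif e.isBin then
    (s.1.tail, e.rebuild (s.2.tail.headD e) (s.2.headD e) :: s.2.tail.tail)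
  else (s.1.tail, e.rebuild (s.2.headD e) e :: s.2.tail)

/-- The number of steps that `shiftStep` takes. -/
def shiftTime : FeatureExpr S → ℕ
  | price _ _ => 1
  | const _ => 1
  | var _ => 1
  | add a b => a.shiftTime + b.shiftTime + 2
  | mul a b => a.shiftTime + b.shiftTime + 2
  | max a b => a.shiftTime + b.shiftTime + 2
  | recip a => a.shiftTime + 2

theorem shiftStep_iterate (k : ℕ) (e : FeatureExpr S) (ts : List (Bool × FeatureExpr S))
    (out : List (FeatureExpr S)) :
    (shiftStep k)^[e.shiftTime] ((true, e) :: ts, out) = (ts, e.shift k :: out) := by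
  -- The three binary operations differ in `rebuild` only. The left argument is finished first, so
  -- its result lies below that of the right one.
  have bin : ∀ (e a b : FeatureExpr S), (∀ ts out, (shiftStep k)^[a.shiftTime] ((true, a) :: ts, out)
      = (ts, a.shift k :: out)) → (∀ ts out, (shiftStep k)^[b.shiftTime] ((true, b) :: ts, out)
      = (ts, b.shift k :: out)) → e.isVar = false → e.isBin = true → e.argL = a → e.argR = b →
      ∀ ts out, (shiftStep k)^[a.shiftTime + b.shiftTime + 2] ((true, e) :: ts, out) =
        (ts, e.rebuild (a.shift k) (b.shift k) :: out) := by
    intro e a b ha hb h1 h2 h3 h4 ts out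
    rw [show a.shiftTime + b.shiftTime + 2 = 1 + (b.shiftTime + (a.shiftTime + 1)) by ring,
      Function.iterate_add_apply, Function.iterate_add_apply, Function.iterate_add_apply]
    have : (shiftStep k)^[1] ((true, e) :: ts, out) =
        ((true, a) :: (true, b) :: (false, e) :: ts, out) := by
      simp [shiftStep, h1, h2, h3, h4]
    rw [this, ha, hb]
    simp [shiftStep, h2]
  induction e generalizing ts out with
  | price φ i => rfl
  | const q => rfl
  | var j => rfl
  | add a b iha ihb => exact bin (add a b) a b iha ihb rfl rfl rfl rfl ts out
  | mul a b iha ihb => exact bin (mul a b) a b iha ihb rfl rfl rfl rfl ts out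
  | max a b iha ihb => exact bin (max a b) a b iha ihb rfl rfl rfl rfl ts out
  | recip a iha =>
    rw [shiftTime, show a.shiftTime + 2 = 1 + (a.shiftTime + 1) by ring,
      Function.iterate_add_apply, Function.iterate_add_apply]
    have : (shiftStep k)^[1] ((true, recip a) :: ts, out) =
        ((true, a) :: (false, recip a) :: ts, out) := rfl
    rw [this, iha]
    rfl

end FeatureExpr

variable [Encode S]

open FeatureExpr

theorem FeatureExpr.enc_add (a b : FeatureExpr S) :
    enc (add a b) = .cons (.unary 3) (.cons (enc a) (enc b)) := rfl
theorem FeatureExpr.enc_mul (a b : FeatureExpr S) :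
    enc (mul a b) = .cons (.unary 4) (.cons (enc a) (enc b)) := rfl
theorem FeatureExpr.enc_max (a b : FeatureExpr S) :
    enc (max a b) = .cons (.unary 5) (.cons (enc a) (enc b)) := rfl
theorem FeatureExpr.enc_recip (a : FeatureExpr S) :
    enc (recip a) = .cons (.unary 6) (enc a) := rfl
theorem FeatureExpr.enc_var (j : ℕ) : enc (var j : FeatureExpr S) = .cons (.unary 2) (enc j) := rfl

theorem FeatureExpr.encSize_add (a b : FeatureExpr S) :
    encSize (add a b) = encSize a + encSize b + 9 := by
  simp [encSize, enc_add, Data.size, Data.size_unary]; omega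
theorem FeatureExpr.encSize_mul (a b : FeatureExpr S) :
    encSize (mul a b) = encSize a + encSize b + 11 := by
  simp [encSize, enc_mul, Data.size, Data.size_unary]; omega
theorem FeatureExpr.encSize_max (a b : FeatureExpr S) :
    encSize (max a b) = encSize a + encSize b + 13 := by
  simp [encSize, enc_max, Data.size, Data.size_unary]; omega
theorem FeatureExpr.encSize_recip (a : FeatureExpr S) :
    encSize (recip a) = encSize a + 14 := by
  simp [encSize, enc_recip, Data.size, Data.size_unary]; omega
theorem FeatureExpr.encSize_var (j : ℕ) :
    encSize (var j : FeatureExpr S) = encSize j + 6 := by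
  simp [encSize, enc_var, Data.size, Data.size_unary]; omega

theorem FeatureExpr.shiftTime_le (e : FeatureExpr S) : e.shiftTime ≤ encSize e := by
  induction e with
  | price φ i => exact one_le_encSize _
  | const q => exact one_le_encSize _
  | var j => exact one_le_encSize _
  | add a b iha ihb => rw [encSize_add, shiftTime]; omega
  | mul a b iha ihb => rw [encSize_mul, shiftTime]; omega
  | max a b iha ihb => rw [encSize_max, shiftTime]; omega
  | recip a iha => rw [encSize_recip, shiftTime]; omega

theorem FeatureExpr.encSize_rebuild (e a b : FeatureExpr S) :
    encSize (e.rebuild a b) ≤ encSize e + encSize a + encSize b := by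
  have ha := one_le_encSize a
  have hb := one_le_encSize b
  cases e with
  | add x y =>
    have := one_le_encSize x
    have := one_le_encSize y
    simp only [rebuild, encSize_add]; omega
  | mul x y =>
    have := one_le_encSize x
    have := one_le_encSize y
    simp only [rebuild, encSize_mul]; omega
  | max x y =>
    have := one_le_encSize x
    have := one_le_encSize y
    simp only [rebuild, encSize_max]; omega
  | recip x =>
    have := one_le_encSize x
    simp only [rebuild, encSize_recip]; omega
  | _ => simp only [rebuild]; omega

theorem FeatureExpr.encSize_arg (e : FeatureExpr S) :
    encSize e.argL ≤ encSize e ∧ encSize e.argR ≤ encSize e := by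
  cases e with
  | add x y => simp only [argL, argR, encSize_add]; omega
  | mul x y => simp only [argL, argR, encSize_mul]; omega
  | max x y => simp only [argL, argR, encSize_max]; omega
  | recip x => simp only [argL, argR, encSize_recip]; omega
  | _ => simp only [argL, argR]; omega

theorem encSize_headD_add_tail {β : Type} [Encode β] (l : List β) (d : β) :
    encSize (l.headD d) + encSize l.tail ≤ encSize l + encSize d := by
  cases l with
  | nil => simp; omega
  | cons a l => simp [encSize_cons]; omega

theorem encSize_natAdd (j k : ℕ) : encSize (j + k) ≤ encSize j + 4 * k := by
  induction k with
  | zero => simp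
  | succ k ih => have := PolyTime.encSize_nat_succ (j + k); rw [← add_assoc]; omega

/-! ### Building and shifting feature expressions in polynomial time -/

namespace PolyTime

variable {α β : Type} [Encode α] [Encode β]

@[fun_prop]
theorem exprAdd {a b : α → FeatureExpr S} (ha : PolyTime a) (hb : PolyTime b) :
    PolyTime fun x => add (a x) (b x) := of_enc (cons' (const _) (dataCons ha hb))

@[fun_prop]
theorem exprMul {a b : α → FeatureExpr S} (ha : PolyTime a) (hb : PolyTime b) :
    PolyTime fun x => mul (a x) (b x) := of_enc (cons' (const _) (dataCons ha hb))

@[fun_prop]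
theorem exprMax {a b : α → FeatureExpr S} (ha : PolyTime a) (hb : PolyTime b) :
    PolyTime fun x => FeatureExpr.max (a x) (b x) := of_enc (cons' (const _) (dataCons ha hb))

@[fun_prop]
theorem exprVar {j : α → ℕ} (hj : PolyTime j) :
    PolyTime fun x => (var (j x) : FeatureExpr S) := of_enc (cons' (const _) hj.to_enc)

@[fun_prop]
theorem exprConst {q : α → ℚ} (hq : PolyTime q) :
    PolyTime fun x => (FeatureExpr.const (q x) : FeatureExpr S) :=
  of_enc (cons' (const _) hq.to_enc)

@[fun_prop]
theorem exprPrice {φ : α → S} {i : α → ℕ+} (hφ : PolyTime φ) (hi : PolyTime i) :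
    PolyTime fun x => price (φ x) (i x) := of_enc (cons' (const _) (dataCons hφ hi))

@[fun_prop]
theorem exprNeg {a : α → FeatureExpr S} (ha : PolyTime a) : PolyTime fun x => (a x).neg :=
  exprMul (const _) ha

theorem exprSum {l : α → List (FeatureExpr S)} (hl : PolyTime l) :
    PolyTime fun x => FeatureExpr.sum (l x) := by
  obtain ⟨q, hq⟩ := hl.encSize_le
  unfold FeatureExpr.sum
  exact foldl_of_growth (step := fun _ s x => add s x) (const _) (by fun_prop) hl
    (fun _ _ => True) (fun _ => trivial) (fun _ _ _ _ _ => trivial) (q + 9) fun a s x hx _ => by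
      have h1 := encSize_le_of_mem hx
      have h2 := hq a
      rw [encSize_add]
      simp
      omega

open scoped Classical in
theorem exprTag (t : ℕ) :
    PolyTime fun e : FeatureExpr S => decide ((enc e).head = .unary t) :=
  dataEq (dataHead id.to_enc) (const _)

@[fun_prop]
theorem exprIsVar {e : α → FeatureExpr S} (he : PolyTime e) : PolyTime fun a => (e a).isVar := by
  refine comp (f := fun e : FeatureExpr S => e.isVar) ?_ he
  exact (exprTag 2).congr fun e => by
    cases e <;> simp [enc, encode, Data.head, Data.unary, isVar]

@[fun_prop]
theorem exprIsRecip {e : α → FeatureExpr S} (he : PolyTime e) :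
    PolyTime fun a => (e a).isRecip := by
  refine comp (f := fun e : FeatureExpr S => e.isRecip) ?_ he
  exact (exprTag 6).congr fun e => by
    cases e <;> simp [enc, encode, Data.head, Data.unary, isRecip]

@[fun_prop]
theorem exprIsBin {e : α → FeatureExpr S} (he : PolyTime e) : PolyTime fun a => (e a).isBin := by
  refine comp (f := fun e : FeatureExpr S => e.isBin) ?_ he
  exact ((exprTag 3).or ((exprTag 4).or (exprTag 5))).congr fun e => by
    cases e <;> simp [enc, encode, Data.head, Data.unary, isBin]

@[fun_prop]
theorem exprVarIdx {e : α → FeatureExpr S} (he : PolyTime e) : PolyTime fun a => (e a).varIdx := by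
  refine comp (f := fun e : FeatureExpr S => e.varIdx) ?_ he
  have h0 := id.to_enc (α := FeatureExpr S)
  have h : PolyTime fun e : FeatureExpr S => bif e.isVar then (enc e).tail else enc (0 : ℕ) := by
    fun_prop
  exact of_enc (h.congr fun e => by cases e <;> rfl)

@[fun_prop]
theorem exprArgL {e : α → FeatureExpr S} (he : PolyTime e) : PolyTime fun a => (e a).argL := by
  refine comp (f := fun e : FeatureExpr S => e.argL) ?_ he
  have h0 := id.to_enc (α := FeatureExpr S)
  have h : PolyTime fun e : FeatureExpr S => bif e.isBin then (enc e).tail.head else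
      bif e.isRecip then (enc e).tail else enc e := by fun_prop
  exact of_enc (h.congr fun e => by cases e <;> rfl)

@[fun_prop]
theorem exprArgR {e : α → FeatureExpr S} (he : PolyTime e) : PolyTime fun a => (e a).argR := by
  refine comp (f := fun e : FeatureExpr S => e.argR) ?_ he
  have h0 := id.to_enc (α := FeatureExpr S)
  have h : PolyTime fun e : FeatureExpr S => bif e.isBin then (enc e).tail.tail else enc e := by
    fun_prop
  exact of_enc (h.congr fun e => by cases e <;> rfl)

@[fun_prop]
theorem exprRebuild {e a b : α → FeatureExpr S} (he : PolyTime e) (ha : PolyTime a)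
    (hb : PolyTime b) : PolyTime fun x => (e x).rebuild (a x) (b x) := by
  have h0 := he.to_enc
  have h1 := ha.to_enc
  have h2 := hb.to_enc
  have h : PolyTime fun x => bif (e x).isBin then
      Data.cons (enc (e x)).head (.cons (enc (a x)) (enc (b x))) else
      bif (e x).isRecip then .cons (enc (e x)).head (enc (a x)) else enc (e x) := by fun_prop
  exact of_enc (h.congr fun x => by cases e x <;> rfl)

/-- All tasks concern subexpressions of the input, so whatever a step pushes is bounded by the
input. An increased variable index grows by at most `4 * k`, which is linear in the unary shift. -/
theorem _root_.LogicalInduction.FeatureExpr.shiftStep_growth (x : Unary × FeatureExpr S)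
    (s : List (Bool × FeatureExpr S) × List (FeatureExpr S))
    (hs : ∀ t ∈ s.1, encSize t.2 ≤ encSize x) :
    (∀ t ∈ (shiftStep x.1.val s).1, encSize t.2 ≤ encSize x) ∧
      encSize (shiftStep x.1.val s) ≤ encSize s + (6 * encSize x + 20) := by
  obtain ⟨_ | ⟨⟨b, e⟩, ts⟩, out⟩ := s
  · exact ⟨hs, by simp [shiftStep]⟩
  have he := hs _ List.mem_cons_self
  have hts : ∀ t ∈ ts, encSize t.2 ≤ encSize x := fun t ht => hs t (List.mem_cons_of_mem _ ht)
  obtain ⟨hL, hR⟩ := encSize_arg e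
  have hb := one_le_encSize b
  have ht : encSize true = 3 := rfl
  have hf : encSize false = 1 := rfl
  have hx : encSize x = 2 * x.1.val + 1 + encSize x.2 + 1 := by
    rw [← encSize_unary x.1]; rfl
  have h1 := encSize_headD_add_tail out e
  have h2 := encSize_headD_add_tail out.tail e
  have h3 := encSize_rebuild e (out.tail.headD e) (out.headD e)
  have h4 := encSize_rebuild e (out.headD e) e
  dsimp only at he
  simp only [shiftStep, List.isEmpty_cons, List.headD_cons, List.tail_cons, cond_false]
  cases b
  · simp only [cond_false]
    cases e.isBin
    · refine ⟨hts, ?_⟩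
      simp only [cond_false, encSize_pair, encSize_cons]; omega
    · refine ⟨hts, ?_⟩
      simp only [cond_true, encSize_pair, encSize_cons]; omega
  · simp only [cond_true]
    cases h5 : e.isVar
    · cases e.isBin
      · cases e.isRecip
        · refine ⟨hts, ?_⟩
          simp only [cond_false, encSize_pair, encSize_cons]; omega
        · simp only [cond_false, cond_true, List.forall_mem_cons]
          refine ⟨⟨by omega, he, hts⟩, ?_⟩
          simp only [encSize_pair, encSize_cons]; omega
      · simp only [cond_false, cond_true, List.forall_mem_cons]
        refine ⟨⟨by omega, by omega, he, hts⟩, ?_⟩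
        simp only [encSize_pair, encSize_cons]; omega
    · refine ⟨hts, ?_⟩
      cases e with
      | var j =>
        have := encSize_natAdd j x.1.val
        simp only [cond_true, encSize_pair, encSize_cons, varIdx, encSize_var] at *; omega
      | _ => simp [isVar] at h5

theorem exprShift {k : α → Unary} {e : α → FeatureExpr S} (hk : PolyTime k) (he : PolyTime e) :
    PolyTime fun a => (e a).shift (k a).val := by
  refine comp (f := fun x : Unary × FeatureExpr S => x.2.shift x.1.val) ?_ (pair hk he)
  have h0 := snd.to_enc (f := fun x : Unary × FeatureExpr S => x.2)
  have h := iterate_of_growth (α := Unary × FeatureExpr S) (n := fun x => ⟨(enc x.2).size⟩)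
    (init := fun x => ([(true, x.2)], ([] : List (FeatureExpr S))))
    (step := fun x s => shiftStep x.1.val s) (by fun_prop) (by fun_prop)
    (by unfold shiftStep; fun_prop)
    (fun x s => ∀ t ∈ s.1, encSize t.2 ≤ encSize x)
    (fun x t ht => by
      simp only [List.mem_singleton] at ht
      subst ht
      rw [encSize_pair]
      dsimp only
      omega)
    (fun x s hs => (shiftStep_growth x s hs).1) (6 * .X + 20)
    (fun x s hs => by simpa using (shiftStep_growth x s hs).2)
  have h2 := headD (snd.comp h) (snd (α := Unary) (β := FeatureExpr S))
  refine h2.congr fun x => ?_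
  -- The size of the expression serves as a sufficient number of steps; the surplus steps do
  -- nothing.
  obtain ⟨m, hm⟩ := Nat.exists_eq_add_of_le' (shiftTime_le x.2)
  change _ = m + _ at hm
  change ((shiftStep x.1.val)^[encSize x.2] _).2.headD _ = _
  rw [hm, Function.iterate_add_apply, shiftStep_iterate,
    Function.iterate_fixed (show shiftStep x.1.val ([], [x.2.shift x.1.val]) = _ from rfl)]
  rfl

end PolyTime

end Features

/-! ### Blocks of definitions -/

section Blocks

variable {S : Type}

open FeatureExpr

theorem evalDefs_append (V : ℕ+ → S → ℝ) (d d' : List (FeatureExpr S)) (env : List ℝ) :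
    evalDefs V (d ++ d') env = evalDefs V d' (evalDefs V d env) := by
  induction d generalizing env with
  | nil => rfl
  | cons e d ih => simp [evalDefs, ih]

theorem length_evalDefs (V : ℕ+ → S → ℝ) (d : List (FeatureExpr S)) (env : List ℝ) :
    (evalDefs V d env).length = env.length + d.length := by
  induction d generalizing env with
  | nil => rfl
  | cons e d ih => simp [evalDefs, ih]; omega

/-- Allows a program with its own local variables to be placed after other definitions without
changing its values. -/
theorem evalDefs_shift (V : ℕ+ → S → ℝ) (d : List (FeatureExpr S)) (env env' : List ℝ) :
    evalDefs V (d.map (shift env.length)) (env ++ env') = env ++ evalDefs V d env' := by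
  induction d generalizing env' with
  | nil => rfl
  | cons e d ih =>
    rw [List.map_cons, evalDefs, evalDefs, eval_shift, List.append_assoc, ih]

theorem DefsWellFormed.append {n : ℕ+} {d d' : List (FeatureExpr S)} (h : DefsWellFormed n d)
    (h' : ∀ (k : ℕ) (hk : k < d'.length), (d'[k]).WellFormed n (d.length + k)) :
    DefsWellFormed n (d ++ d') := by
  intro k hk
  by_cases hkd : k < d.length
  · rw [List.getElem_append_left hkd]
    exact h k hkd
  · rw [List.getElem_append_right (by omega)]
    have := h' (k - d.length) (by rw [List.length_append] at hk; omega)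
    rwa [Nat.add_sub_cancel' (by omega)] at this

end Blocks

/-! ## A trader that makes budgeted bets -/

section Sums

theorem unaryRange_succ (n : ℕ) : unaryRange (n + 1) = unaryRange n ++ [⟨n⟩] := by
  simp [unaryRange, List.range_succ]

theorem sum_unaryRange (n : ℕ) (g : ℕ → ℝ) :
    ((unaryRange n).map fun i => g i.val).sum = ∑ i ∈ Finset.range n, g i := by
  induction n with
  | zero => simp [unaryRange]
  | succ n ih => rw [unaryRange_succ, Finset.sum_range_succ, List.map_append, List.sum_append, ih]
                 simp

theorem sum_filter_unaryRange (n : ℕ) (g : ℕ → ℝ) (q : ℕ → Bool) :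
    (((unaryRange n).filter fun i => q i.val).map fun i => g i.val).sum =
      ∑ i ∈ Finset.range n, if q i then g i else 0 := by
  induction n with
  | zero => simp [unaryRange]
  | succ n ih =>
    rw [unaryRange_succ, Finset.sum_range_succ, List.filter_append, List.map_append,
      List.sum_append, ih]
    cases h : q n <;> simp [h]

end Sums

/-- The data of a trader who makes a bet on every day. The days are numbered from `0`, so that the
number `k` stands for day `k + 1`. The `k`-th bet buys the sentences `bought k j` and sells
`sold k j`, `j ≤ k`, at a ratio given by the feature `ratio k`, and on every day `n` such that
`due k n` it sells `base k`. -/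
structure BettingPlan (S : Type) where
  ratio : ℕ → Feature S
  bought : ℕ → ℕ → S
  sold : ℕ → ℕ → S
  base : ℕ → S
  slope : ℕ → ℚ
  margin : ℚ
  /-- On day `n`, the money spent on the `k`-th bet is available again. -/
  closed : ℕ → ℕ → Bool
  due : ℕ → ℕ → Bool

namespace BettingPlan

variable {S : Type} (B : BettingPlan S)

open FeatureExpr

/-- The number of variables used for the bets before the `k`-th. -/
def offset (k : ℕ) : ℕ := ((unaryRange k).map fun i => (B.ratio i.val).defs.length + 2).sum

/-- The variable that holds the value of `ratio k`. -/
def ratioVar (k : ℕ) : FeatureExpr S := var (B.offset k + (B.ratio k).defs.length)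

/-- The variable that holds the size of the `k`-th bet. -/
def stakeVar (k : ℕ) : FeatureExpr S := var (B.offset k + (B.ratio k).defs.length + 1)

/-- The weight of a sentence in the `k`-th bet. -/
def weight (k : ℕ) : FeatureExpr S := .const (((1 : ℕ) : ℚ) / ((k + 1 : ℕ) : ℚ))

/-- The average price on day `k` of the sentences `ψ j`, `j ≤ k`. -/
def average (k : ℕ) (ψ : ℕ → S) : FeatureExpr S :=
  mul (weight k) (sum ((unaryRange (k + 1)).map fun j => price (ψ j.val) k.succPNat))

/-- The profitability of the `k`-th bet, if it exceeds the margin. -/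
def excess (k : ℕ) : FeatureExpr S :=
  .max (.const 0) (add (add (mul (B.ratioVar k) (average k (B.sold k)))
    (neg (average k (B.bought k)))) (neg (add (.const B.margin) (weight k))))

/-- The size of the `k`-th bet: the part of the budget that is not spent on open bets, times the
profitability. -/
def stake (k : ℕ) : FeatureExpr S :=
  mul (B.excess k) (add (.const 1) (neg (sum
    (((unaryRange k).filter fun i => !B.closed i.val k).map fun i => B.stakeVar i.val))))

/-- The definitions of the variables for the `k`-th bet. -/
def block (k : ℕ) : List (FeatureExpr S) :=
  (B.ratio k).defs.map (fun e => e.shift (B.offset k)) ++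
    [(B.ratio k).ret.shift (B.offset k), B.stake k]

/-- The definitions of the variables for all bets before the `k`-th. -/
def blocks (k : ℕ) : List (FeatureExpr S) := (unaryRange k).flatMap fun i => B.block i.val

/-- The amount of `base i` sold on day `n`, relative to the size of the bet. -/
def hedge (i n : ℕ) : FeatureExpr S :=
  neg (.max (.const (-1)) (neg (.max (.const 0)
    (mul (add (price (B.base i) n.succPNat) (neg (B.ratioVar i))) (.const (B.slope i))))))

/-- The trades on day `k`. -/
def trades (k : ℕ) : List (S × FeatureExpr S) :=
  (unaryRange (k + 1)).map (fun j => (B.bought k j.val, mul (B.stakeVar k) (weight k))) ++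
  ((unaryRange (k + 1)).map (fun j => (B.sold k j.val,
    neg (mul (B.ratioVar k) (mul (B.stakeVar k) (weight k))))) ++
  ((unaryRange (k + 1)).filter fun i => B.due i.val k).map (fun i =>
    (B.base i.val, neg (mul (B.stakeVar i.val) (B.hedge i.val k)))))

/-- The trader following the plan. -/
def trader (n : ℕ+) : Strategy S := ⟨B.blocks (n.natPred + 1), B.trades n.natPred⟩

/-! ### Well-formedness -/

theorem offset_succ (k : ℕ) : B.offset (k + 1) = B.offset k + ((B.ratio k).defs.length + 2) := by
  simp [offset, unaryRange_succ]

theorem offset_mono {i k : ℕ} (h : i ≤ k) : B.offset i ≤ B.offset k := by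
  induction k, h using Nat.le_induction with
  | base => exact le_rfl
  | succ k _ ih => rw [offset_succ]; omega

theorem blocks_succ (k : ℕ) : B.blocks (k + 1) = B.blocks k ++ B.block k := by
  simp [blocks, unaryRange_succ]

theorem length_block (k : ℕ) : (B.block k).length = (B.ratio k).defs.length + 2 := by
  simp [block]

theorem length_blocks (k : ℕ) : (B.blocks k).length = B.offset k := by
  induction k with
  | zero => rfl
  | succ k ih => rw [blocks_succ, offset_succ, List.length_append, ih, length_block]

theorem wellFormed_average (k : ℕ) (ψ : ℕ → S) (m : ℕ) :
    (average k ψ).WellFormed k.succPNat m := by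
  refine ⟨trivial, wellFormed_sum fun e he => ?_⟩
  obtain ⟨j, -, rfl⟩ := List.mem_map.1 he
  exact le_rfl

theorem wellFormed_stakeVar {i k : ℕ} (h : i < k) (n : ℕ+) {m : ℕ} (hm : B.offset k ≤ m) :
    (B.stakeVar i).WellFormed n m := by
  have h1 := B.offset_mono (Nat.succ_le_of_lt h)
  rw [Nat.succ_eq_add_one, offset_succ] at h1
  change _ < m
  omega

theorem wellFormed_ratioVar {i k : ℕ} (h : i < k) (n : ℕ+) {m : ℕ} (hm : B.offset k ≤ m) :
    (B.ratioVar i).WellFormed n m := by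
  have h1 := B.offset_mono (Nat.succ_le_of_lt h)
  rw [Nat.succ_eq_add_one, offset_succ] at h1
  change _ < m
  omega

/-- The stake is the last definition of its block, so it may use the ratio of the same block and all
earlier stakes. -/
theorem wellFormed_stake (k : ℕ) :
    (B.stake k).WellFormed k.succPNat (B.offset k + ((B.ratio k).defs.length + 1)) := by
  refine ⟨⟨trivial, ⟨⟨?_, wellFormed_average _ _ _⟩, (wellFormed_average _ _ _).neg⟩,
    WellFormed.neg ⟨trivial, trivial⟩⟩, trivial, WellFormed.neg (wellFormed_sum fun e he => ?_)⟩
  · change _ < _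
    omega
  · obtain ⟨i, hi, rfl⟩ := List.mem_map.1 he
    have := mem_unaryRange.1 (List.mem_filter.1 hi).1
    exact B.wellFormed_stakeVar this _ (by omega)

theorem defsWellFormed_blocks (hB : ∀ k : ℕ, (B.ratio k).HasRank k.succPNat) (k : ℕ) {n : ℕ+}
    (hn : k ≤ n.natPred + 1) : DefsWellFormed n (B.blocks k) := by
  induction k with
  | zero => exact fun j hj => absurd hj (by simp [blocks, unaryRange])
  | succ k ih =>
    have hkn : k.succPNat ≤ n := by
      rw [← n.succPNat_natPred, Nat.succPNat_le_succPNat]; omega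
    rw [blocks_succ]
    refine (ih (by omega)).append fun j hj => ?_
    rw [length_block] at hj
    rw [length_blocks]
    obtain ⟨h1, h2⟩ := hB k
    simp only [block]
    by_cases hj1 : j < (B.ratio k).defs.length
    · rw [List.getElem_append_left (by simpa using hj1), List.getElem_map]
      exact ((h1 j hj1).shift _).mono hkn le_rfl
    · rw [List.getElem_append_right (by simpa using hj1)]
      simp only [List.length_map]
      obtain h3 | h3 : j = (B.ratio k).defs.length ∨ j = (B.ratio k).defs.length + 1 := by omega
      · subst h3
        simpa using (h2.shift _).mono hkn le_rfl
      · subst h3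
        simpa using (B.wellFormed_stake k).mono hkn le_rfl

theorem isTrader (hB : ∀ k : ℕ, (B.ratio k).HasRank k.succPNat) : IsTrader B.trader := by
  intro n
  refine ⟨B.defsWellFormed_blocks hB _ le_rfl, fun x hx => ?_⟩
  have hlen : B.trader n = ⟨B.blocks (n.natPred + 1), B.trades n.natPred⟩ := rfl
  rw [hlen] at hx ⊢
  simp only [length_blocks]
  simp only [trades, List.mem_append, List.mem_map] at hx
  rcases hx with ⟨j, hj, rfl⟩ | ⟨j, hj, rfl⟩ | ⟨i, hi, rfl⟩
  · exact ⟨B.wellFormed_stakeVar (Nat.lt_succ_self _) _ le_rfl, trivial⟩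
  · exact WellFormed.neg ⟨B.wellFormed_ratioVar (Nat.lt_succ_self _) _ le_rfl,
      B.wellFormed_stakeVar (Nat.lt_succ_self _) _ le_rfl, trivial⟩
  · have hi' := mem_unaryRange.1 (List.mem_filter.1 hi).1
    refine WellFormed.neg ⟨B.wellFormed_stakeVar hi' _ le_rfl, WellFormed.neg ⟨trivial,
      WellFormed.neg ⟨trivial, ⟨?_, (B.wellFormed_ratioVar hi' _ le_rfl).neg⟩, trivial⟩⟩⟩
    change _ ≤ _
    rw [n.succPNat_natPred]

/-! ### Values -/

variable (V : ℕ+ → S → ℝ)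

/-- The value of `ratio k`. -/
noncomputable def ratioVal (k : ℕ) : ℝ := (B.ratio k).eval V

/-- The values of the variables for the bets before the `k`-th. -/
noncomputable def env (k : ℕ) : List ℝ := evalDefs V (B.blocks k) []

/-- The size of the `k`-th bet. -/
noncomputable def stakeVal (k : ℕ) : ℝ :=
  (B.stake k).eval V (B.env V k ++ (evalDefs V (B.ratio k).defs [] ++ [B.ratioVal V k]))

/-- The profitability of the `k`-th bet. -/
noncomputable def edge (k : ℕ) : ℝ :=
  B.ratioVal V k * (1 / ((k : ℝ) + 1) * ∑ j ∈ Finset.range (k + 1), V k.succPNat (B.sold k j)) -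
    1 / ((k : ℝ) + 1) * ∑ j ∈ Finset.range (k + 1), V k.succPNat (B.bought k j)

/-- The amount of `base i` sold on day `n`, relative to the size of the bet. -/
noncomputable def hedgeVal (i n : ℕ) : ℝ :=
  min 1 (max 0 ((V n.succPNat (B.base i) - B.ratioVal V i) * B.slope i))

theorem length_env (k : ℕ) : (B.env V k).length = B.offset k := by
  rw [env, length_evalDefs, length_blocks]; simp

theorem env_succ (k : ℕ) : B.env V (k + 1) = B.env V k ++ (evalDefs V (B.ratio k).defs [] ++
    [B.ratioVal V k, B.stakeVal V k]) := by
  have h1 := evalDefs_shift V (B.ratio k).defs (B.env V k) []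
  rw [List.append_nil, length_env] at h1
  have h2 := eval_shift V (B.env V k) (evalDefs V (B.ratio k).defs []) (B.ratio k).ret
  rw [length_env] at h2
  rw [env, blocks_succ, evalDefs_append, block, evalDefs_append]
  change evalDefs V _ (evalDefs V _ (B.env V k)) = _
  rw [h1, evalDefs, evalDefs, evalDefs, h2]
  simp [stakeVal, ratioVal, Feature.eval]

/-- Later blocks only append variables. Hence the program of every day recomputes the same ratio and
stake for the `i`-th bet. -/
theorem env_eq_append {i k : ℕ} (h : i < k) : ∃ t, B.env V k = B.env V i ++
    (evalDefs V (B.ratio i).defs [] ++ [B.ratioVal V i, B.stakeVal V i]) ++ t := by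
  induction k, Nat.succ_le_of_lt h using Nat.le_induction with
  | base => exact ⟨[], by rw [Nat.succ_eq_add_one, env_succ, List.append_nil]⟩
  | succ k hk ih =>
    obtain ⟨t, ht⟩ := ih hk
    exact ⟨t ++ _, by rw [env_succ, ht, List.append_assoc]⟩

theorem eval_ratioVar_append (k : ℕ) (t : List ℝ) : (B.ratioVar k).eval V (B.env V k ++
    (evalDefs V (B.ratio k).defs [] ++ B.ratioVal V k :: t)) = B.ratioVal V k := by
  simp only [ratioVar, FeatureExpr.eval]
  rw [List.getD_append_right _ _ _ _ (by rw [length_env]; omega), length_env,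
    List.getD_append_right _ _ _ _ (by rw [length_evalDefs]; simp), length_evalDefs]
  simp

theorem eval_ratioVar {i k : ℕ} (h : i < k) (t : List ℝ) :
    (B.ratioVar i).eval V (B.env V k ++ t) = B.ratioVal V i := by
  obtain ⟨t', ht⟩ := B.env_eq_append V h
  rw [ht]
  simpa using B.eval_ratioVar_append V i (B.stakeVal V i :: (t' ++ t))

theorem eval_stakeVar {i k : ℕ} (h : i < k) (t : List ℝ) :
    (B.stakeVar i).eval V (B.env V k ++ t) = B.stakeVal V i := by
  obtain ⟨t', ht⟩ := B.env_eq_append V h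
  rw [ht]
  simp only [stakeVar, FeatureExpr.eval, List.append_assoc]
  rw [List.getD_append_right _ _ _ _ (by rw [length_env]; omega), length_env,
    List.getD_append_right _ _ _ _ (by rw [length_evalDefs]; simp; omega), length_evalDefs]
  have : B.offset i + (B.ratio i).defs.length + 1 - B.offset i - (([] : List ℝ).length +
    (B.ratio i).defs.length) = 1 := by simp; omega
  rw [this]
  simp

theorem eval_weight (k : ℕ) (env : List ℝ) :
    (weight k : FeatureExpr S).eval V env = 1 / ((k : ℝ) + 1) := by
  simp [weight, FeatureExpr.eval]

theorem eval_average (k : ℕ) (ψ : ℕ → S) (env : List ℝ) : (average k ψ).eval V env =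
    1 / ((k : ℝ) + 1) * ∑ j ∈ Finset.range (k + 1), V k.succPNat (ψ j) := by
  rw [average, FeatureExpr.eval, eval_weight, eval_sum, List.map_map,
    ← sum_unaryRange (k + 1) fun j => V k.succPNat (ψ j)]
  rfl

/-- The recursion of the budget. The estimates of the stakes in the exploitation argument rest on it
alone. -/
theorem stakeVal_eq (k : ℕ) : B.stakeVal V k =
    max 0 (B.edge V k - (B.margin + 1 / ((k : ℝ) + 1))) *
      (1 - ∑ i ∈ Finset.range k, if B.closed i k then 0 else B.stakeVal V i) := by
  have h1 := B.eval_ratioVar_append V k []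
  have h0 : (B.excess k).eval V (B.env V k ++ (evalDefs V (B.ratio k).defs [] ++
      [B.ratioVal V k])) = max 0 (B.edge V k - (B.margin + 1 / ((k : ℝ) + 1))) := by
    simp only [excess, FeatureExpr.eval, h1, eval_average, eval_neg, eval_weight, edge,
      Rat.cast_zero, sub_eq_add_neg]
  rw [stakeVal, stake, FeatureExpr.eval, h0, FeatureExpr.eval, eval_neg, eval_sum, List.map_map]
  have h2 : ((unaryRange k).filter fun i => !B.closed i.val k).map
      ((fun e => e.eval V (B.env V k ++ (evalDefs V (B.ratio k).defs [] ++ [B.ratioVal V k]))) ∘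
        fun i : Unary => B.stakeVar i.val) =
      ((unaryRange k).filter fun i => !B.closed i.val k).map fun i => B.stakeVal V i.val := by
    refine List.map_congr_left fun i hi => ?_
    exact B.eval_stakeVar V (mem_unaryRange.1 (List.mem_filter.1 hi).1) _
  rw [h2, sum_filter_unaryRange k (B.stakeVal V) (fun i => !B.closed i k)]
  have h3 : ∀ i, (if (!B.closed i k) = true then B.stakeVal V i else 0) =
      if B.closed i k = true then 0 else B.stakeVal V i := fun i => by
    cases B.closed i k <;> rfl
  simp only [h3, FeatureExpr.eval, Rat.cast_one, sub_eq_add_neg]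

/-- Features have no minimum, so `min 1 y` is expressed as `-max (-1) (-y)`. -/
theorem eval_hedge {i k : ℕ} (h : i < k) (n : ℕ) :
    (B.hedge i n).eval V (B.env V k) = B.hedgeVal V i n := by
  have h1 := B.eval_ratioVar V h []
  rw [List.append_nil] at h1
  simp only [hedge, eval_neg, FeatureExpr.eval, h1, hedgeVal]
  rw [← min_neg_neg]
  push_cast
  simp [sub_eq_add_neg]

theorem value_trader (k : ℕ) (W : S → ℝ) : (B.trader k.succPNat).value V k.succPNat W =
    B.stakeVal V k * (1 / ((k : ℝ) + 1)) * ∑ j ∈ Finset.range (k + 1),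
      (W (B.bought k j) - V k.succPNat (B.bought k j)) -
    B.ratioVal V k * B.stakeVal V k * (1 / ((k : ℝ) + 1)) * ∑ j ∈ Finset.range (k + 1),
      (W (B.sold k j) - V k.succPNat (B.sold k j)) -
    ∑ i ∈ Finset.range (k + 1), if B.due i k then B.stakeVal V i * B.hedgeVal V i k *
      (W (B.base i) - V k.succPNat (B.base i)) else 0 := by
  have h1 : ∀ i < k + 1, (B.stakeVar i).eval V (B.env V (k + 1)) = B.stakeVal V i := fun i hi => by
    simpa using B.eval_stakeVar V hi []
  have h2 : (B.ratioVar k).eval V (B.env V (k + 1)) = B.ratioVal V k := by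
    simpa using B.eval_ratioVar V (Nat.lt_succ_self k) []
  have h3 : ∀ l : List (S × FeatureExpr S), (l.map fun x => x.2.eval V (evalDefs V (B.blocks (k + 1))
      []) * (W x.1 - V k.succPNat x.1)) = l.map fun x => x.2.eval V (B.env V (k + 1)) *
        (W x.1 - V k.succPNat x.1) := fun _ => rfl
  rw [Strategy.value, trader, Nat.natPred_succPNat]
  dsimp only
  rw [h3, trades, List.map_append, List.map_append, List.sum_append, List.sum_append, List.map_map,
    List.map_map, List.map_map]
  have e1 := sum_unaryRange (k + 1) fun j => B.stakeVal V k * (1 / ((k : ℝ) + 1)) *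
    (W (B.bought k j) - V k.succPNat (B.bought k j))
  have e2 := sum_unaryRange (k + 1) fun j => -(B.ratioVal V k * B.stakeVal V k *
    (1 / ((k : ℝ) + 1)) * (W (B.sold k j) - V k.succPNat (B.sold k j)))
  have e3 := sum_filter_unaryRange (k + 1) (fun i => -(B.stakeVal V i * B.hedgeVal V i k *
    (W (B.base i) - V k.succPNat (B.base i)))) fun i => B.due i k
  rw [← Finset.mul_sum] at e1
  rw [Finset.sum_neg_distrib, ← Finset.mul_sum] at e2
  have e4 : ∀ i, (if B.due i k = true then -(B.stakeVal V i * B.hedgeVal V i k *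
      (W (B.base i) - V k.succPNat (B.base i))) else 0) = -(if B.due i k = true then
      B.stakeVal V i * B.hedgeVal V i k * (W (B.base i) - V k.succPNat (B.base i)) else 0) :=
    fun i => by split <;> simp
  simp only [e4, Finset.sum_neg_distrib] at e3
  rw [sub_sub, sub_eq_add_neg, neg_add, ← e1, ← e2, ← e3]
  congr 1
  · refine congrArg List.sum (List.map_congr_left fun j _ => ?_)
    simp only [Function.comp, FeatureExpr.eval, h1 k (Nat.lt_succ_self k), eval_weight]
  · congr 1
    · refine congrArg List.sum (List.map_congr_left fun j _ => ?_)
      simp only [Function.comp, eval_neg, FeatureExpr.eval, h1 k (Nat.lt_succ_self k), eval_weight,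
        h2]
      ring
    · refine congrArg List.sum (List.map_congr_left fun i hi => ?_)
      have hi' := mem_unaryRange.1 (List.mem_filter.1 hi).1
      simp only [Function.comp, eval_neg, FeatureExpr.eval, h1 _ hi', B.eval_hedge V hi']
      ring

end BettingPlan

/-! ## Efficient computability of the trader -/

section EffComputable

variable {α : Type} [Encode α]

/-- A unary number has size linear in its value, so the two notions of polynomial time agree; days
are renumbered from `0`. -/
theorem EffComputable.polyTime {x : ℕ+ → α} (hx : EffComputable x) :
    PolyTime fun k : Unary => x k.val.succPNat := by
  obtain ⟨c, h, hc⟩ := hx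
  refine PolyTime.of_relative (g := fun k : Unary => (⟨k.val + 1⟩ : Unary)) (by fun_prop)
    ⟨c, h, fun k => (hc k.val.succPNat).mono (eval_monotone_nat h ?_)⟩
  rw [encSize_unary, Nat.succPNat_coe]
  omega

theorem PolyTime.effComputable {x : ℕ+ → α} (hx : PolyTime fun k : Unary => x k.val.succPNat) :
    EffComputable x := by
  obtain ⟨c, h, hc⟩ := PolyTime.comp (g := fun k : Unary => (⟨k.val - 1⟩ : Unary)) hx (by fun_prop)
  refine ⟨c, h.comp (2 * .X + 1), fun n => ?_⟩
  have h1 := hc ⟨n⟩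
  have h2 : ((n : ℕ) - 1).succPNat = n := PNat.succPNat_natPred n
  dsimp only at h1
  rw [h2, encSize_unary] at h1
  have h3 : (h.comp (2 * .X + 1)).eval (n : ℕ) = h.eval (2 * (n : ℕ) + 1) := by simp
  rw [h3]
  exact h1

end EffComputable

namespace BettingPlan

variable {S : Type} [Encode S]

/-- All parts of a betting plan are computable in polynomial time. -/
structure IsPoly (B : BettingPlan S) : Prop where
  ratio : PolyTime fun k : Unary => B.ratio k.val
  bought : PolyTime fun x : Unary × Unary => B.bought x.1.val x.2.val
  sold : PolyTime fun x : Unary × Unary => B.sold x.1.val x.2.val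
  base : PolyTime fun k : Unary => B.base k.val
  slope : PolyTime fun k : Unary => B.slope k.val
  closed : PolyTime fun x : Unary × Unary => B.closed x.1.val x.2.val
  due : PolyTime fun x : Unary × Unary => B.due x.1.val x.2.val

namespace IsPoly

open PolyTime

variable {B : BettingPlan S} {α : Type} [Encode α] {k : α → Unary}

theorem defs (hB : B.IsPoly) : PolyTime fun k : Unary => (B.ratio k.val).defs :=
  of_enc <| (dataHead hB.ratio.to_enc).congr fun _ => rfl

theorem ret (hB : B.IsPoly) : PolyTime fun k : Unary => (B.ratio k.val).ret :=
  of_enc <| (dataTail hB.ratio.to_enc).congr fun _ => rfl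

theorem offset (hB : B.IsPoly) : PolyTime fun k : Unary => (⟨B.offset k.val⟩ : Unary) := by
  have h1 := hB.defs
  refine length_units (l := fun k : Unary => (unaryRange k.val).flatMap fun i =>
    () :: () :: List.replicate (B.ratio i.val).defs.length ()) (flatMap (by fun_prop) ?_)
    fun k => ?_
  · have h2 := (units (length h1)).comp (snd (α := Unary) (β := Unary))
    fun_prop
  · rw [List.length_flatMap, BettingPlan.offset]
    simp [add_assoc]

theorem ratioVar (hB : B.IsPoly) (hk : PolyTime k) : PolyTime fun a => B.ratioVar (k a).val := by
  have h1 := hB.offset.comp hk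
  have h2 := length (hB.defs.comp hk)
  exact exprVar (natAddUnary (unaryToNat h1) h2)

theorem stakeVar (hB : B.IsPoly) (hk : PolyTime k) : PolyTime fun a => B.stakeVar (k a).val := by
  have h1 := hB.offset.comp hk
  have h2 := length (hB.defs.comp hk)
  exact exprVar (natSucc (natAddUnary (unaryToNat h1) h2))

theorem weight (hk : PolyTime k) :
    PolyTime fun a => (BettingPlan.weight (k a).val : FeatureExpr S) :=
  exprConst (ratDiv (const (⟨1⟩ : Unary)) hk)

theorem average {ψ : ℕ → ℕ → S} (hψ : PolyTime fun x : Unary × Unary => ψ x.1.val x.2.val) :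
    PolyTime fun k : Unary => BettingPlan.average k.val (ψ k.val) := by
  have h1 := weight (S := S) (PolyTime.id (α := Unary))
  have h2 := range (unarySucc (PolyTime.id (α := Unary)))
  have h3 : PolyTime fun x : Unary × Unary =>
      FeatureExpr.price (ψ x.1.val x.2.val) x.1.val.succPNat := exprPrice hψ (succPNat fst)
  exact exprMul h1 (exprSum (map h2 h3))

theorem stake (hB : B.IsPoly) : PolyTime fun k : Unary => B.stake k.val := by
  have h1 := average hB.sold
  have h2 := average hB.bought
  have h3 := weight (S := S) (PolyTime.id (α := Unary))
  have h4 := hB.ratioVar (PolyTime.id (α := Unary))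
  have h5 := exprSum <| map (f := fun (_ : Unary) (i : Unary) => B.stakeVar i.val)
    (filter (p := fun k i => !B.closed i.val k.val) (range (PolyTime.id (α := Unary)))
    (not (hB.closed.comp (g := fun x : Unary × Unary => (x.2, x.1)) (by fun_prop))))
    (hB.stakeVar (snd (α := Unary)))
  unfold BettingPlan.stake BettingPlan.excess
  fun_prop

theorem block (hB : B.IsPoly) : PolyTime fun k : Unary => B.block k.val := by
  have h1 := exprShift hB.offset hB.ret
  have h2 := map (f := fun (k : Unary) e => FeatureExpr.shift (B.offset k.val) e) hB.defs
    (exprShift (hB.offset.comp fst) snd)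
  have h3 := hB.stake
  unfold BettingPlan.block
  fun_prop

theorem blocks (hB : B.IsPoly) : PolyTime fun k : Unary => B.blocks (k.val + 1) :=
  flatMap (range (unarySucc PolyTime.id)) (hB.block.comp snd)

theorem hedge (hB : B.IsPoly) : PolyTime fun x : Unary × Unary => B.hedge x.1.val x.2.val := by
  have h1 := hB.base
  have h2 := hB.slope.comp (fst (α := Unary) (β := Unary))
  have h3 := hB.base.comp (fst (α := Unary) (β := Unary))
  have h4 := hB.ratioVar (fst (α := Unary) (β := Unary))
  unfold BettingPlan.hedge
  fun_prop

theorem trades (hB : B.IsPoly) : PolyTime fun k : Unary => B.trades k.val := by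
  have h1 := range (unarySucc (PolyTime.id (α := Unary)))
  have hw := weight (S := S) (fst (α := Unary) (β := Unary))
  have hr := hB.ratioVar (fst (α := Unary) (β := Unary))
  have hs := hB.stakeVar (fst (α := Unary) (β := Unary))
  have hs' := hB.stakeVar (snd (α := Unary) (β := Unary))
  have hb := hB.bought
  have hso := hB.sold
  have hba := hB.base.comp (snd (α := Unary) (β := Unary))
  have hh := hB.hedge.comp (g := fun x : Unary × Unary => (x.2, x.1)) (by fun_prop)
  have hd := hB.due.comp (g := fun x : Unary × Unary => (x.2, x.1)) (by fun_prop)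
  refine append (map h1 ?_) (append (map h1 ?_) (map (filter (p := fun k i => B.due i.val k.val)
    h1 hd) ?_)) <;> fun_prop

theorem effComputable_trader (hB : B.IsPoly) : EffComputable B.trader := by
  refine PolyTime.effComputable (of_enc ?_)
  exact (dataCons hB.blocks hB.trades).congr fun k => by
    rw [BettingPlan.trader, Nat.natPred_succPNat]; rfl

end IsPoly

end BettingPlan

/-! ## Exploitation -/

section Budget

/-- The part of the budget spent on open bets. -/
theorem open_stakes_le {x : ℕ → ℝ} {closed : ℕ → ℕ → Bool} {e : ℕ → ℝ}
    (he : ∀ k, 0 ≤ e k ∧ e k ≤ 1)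
    (hx : ∀ k, x k = e k * (1 - ∑ i ∈ Finset.range k, if closed i k then 0 else x i))
    (hmono : ∀ i m n, m ≤ n → closed i m = true → closed i n = true) (n : ℕ) :
    0 ≤ x n ∧ (∑ i ∈ Finset.range (n + 1), if closed i n then 0 else x i) ≤ 1 := by
  have key : ∀ n, (∀ i < n, 0 ≤ x i) ∧
      (∑ i ∈ Finset.range n, if closed i n then 0 else x i) ≤ 1 := by
    intro n
    induction n with
    | zero => simp
    | succ n ih =>
      obtain ⟨h1, h2⟩ := ih
      have h3 : 0 ≤ x n := by
        rw [hx]; exact mul_nonneg (he n).1 (by linarith)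
      have h4 : x n ≤ 1 - ∑ i ∈ Finset.range n, if closed i n then 0 else x i := by
        conv_lhs => rw [hx]
        exact mul_le_of_le_one_left (by linarith) (he n).2
      have h5 : ∀ i < n + 1, 0 ≤ x i := fun i hi => by
        rcases Nat.lt_succ_iff_lt_or_eq.1 hi with h | rfl
        · exact h1 i h
        · exact h3
      refine ⟨h5, ?_⟩
      -- Passing to the next day can only close bets and release money; the new bet uses no more
      -- than what was free.
      have h6 : (∑ i ∈ Finset.range n, if closed i (n + 1) then 0 else x i) ≤
          ∑ i ∈ Finset.range n, if closed i n then 0 else x i := by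
        refine Finset.sum_le_sum fun i hi => ?_
        have := h1 i (Finset.mem_range.1 hi)
        by_cases h : closed i n = true
        · simp [h, hmono i n (n + 1) (Nat.le_succ n) h]
        · simp only [h]
          split <;> simp [this]
      rw [Finset.sum_range_succ]
      have : (if closed n (n + 1) = true then 0 else x n) ≤ x n := by split <;> simp [h3]
      linarith
  have h3 : 0 ≤ x n := (key (n + 1)).1 n (Nat.lt_succ_self n)
  refine ⟨h3, ?_⟩
  rw [Finset.sum_range_succ]
  have h4 : x n ≤ 1 - ∑ i ∈ Finset.range n, if closed i n then 0 else x i := by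
    conv_lhs => rw [hx]
    exact mul_le_of_le_one_left (by linarith [(key n).2]) (he n).2
  have : (if closed n n = true then 0 else x n) ≤ x n := by split <;> simp [h3]
  linarith

/-- If every bet is closed eventually and the opportunities do not vanish, then the total amount of
the bets is unbounded. -/
theorem unbounded_stakes {x : ℕ → ℝ} {closed : ℕ → ℕ → Bool} {e : ℕ → ℝ}
    (he : ∀ k, 0 ≤ e k ∧ e k ≤ 1)
    (hx : ∀ k, x k = e k * (1 - ∑ i ∈ Finset.range k, if closed i k then 0 else x i))
    (hmono : ∀ i m n, m ≤ n → closed i m = true → closed i n = true)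
    (hclosed : ∀ i, ∃ n, closed i n = true) {ε : ℝ} (hε : 0 < ε) (hfreq : ∃ᶠ k in atTop, ε ≤ e k)
    (C : ℝ) : ∃ n, C < ∑ i ∈ Finset.range n, x i := by
  by_contra! hC
  have hx0 : ∀ i, 0 ≤ x i := fun i => (open_stakes_le he hx hmono i).1
  have hsum : Summable x := summable_of_sum_range_le hx0 hC
  obtain ⟨N, hN⟩ : ∃ N, ∑' i, x i - 1 / 2 < ∑ i ∈ Finset.range N, x i :=
    (hsum.hasSum.tendsto_sum_nat.eventually_const_lt (by linarith)).exists
  choose t ht using hclosed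
  -- The stakes after the first `N` add up to less than `1/2`. Once the first `N` bets are closed,
  -- at least half of the budget is free.
  have h1 : ∀ᶠ k in atTop, ε / 2 ≤ e k → ε / 4 ≤ x k := by
    filter_upwards [eventually_ge_atTop N, eventually_ge_atTop ((Finset.range N).sup t)]
      with k hk1 hk2 hek
    have h2 : (∑ i ∈ Finset.range k, if closed i k then 0 else x i) ≤ 1 / 2 := by
      rw [← Finset.sum_range_add_sum_Ico _ hk1]
      have h3 : (∑ i ∈ Finset.range N, if closed i k then 0 else x i) = 0 := by
        refine Finset.sum_eq_zero fun i hi => ?_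
        rw [if_pos (hmono i (t i) k ((Finset.le_sup hi).trans hk2) (ht i))]
      have h4 : (∑ i ∈ Finset.Ico N k, if closed i k then 0 else x i) ≤
          ∑ i ∈ Finset.Ico N k, x i :=
        Finset.sum_le_sum fun i _ => by split <;> simp [hx0 i]
      have h5 := Finset.sum_range_add_sum_Ico x hk1
      have h6 := hsum.sum_le_tsum (Finset.range k) fun i _ => hx0 i
      linarith
    rw [hx]
    have := he k
    nlinarith
  have h2 : ∀ᶠ k in atTop, x k < ε / 4 := hsum.tendsto_atTop_zero.eventually_lt_const (by linarith)
  obtain ⟨k, h3, h4, h5⟩ := (hfreq.and_eventually (h1.and h2)).exists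
  have := h4 (by linarith)
  linarith

end Budget

theorem sum_Icc_pnat (g : ℕ+ → ℝ) (n : ℕ) :
    ∑ i ∈ Finset.Icc 1 n.succPNat, g i = ∑ k ∈ Finset.range (n + 1), g k.succPNat := by
  refine (Finset.sum_bij (fun k _ => Nat.succPNat k) ?_ ?_ ?_ ?_).symm
  · intro k hk
    rw [Finset.mem_range] at hk
    exact Finset.mem_Icc.2 ⟨one_le, Nat.succPNat_le_succPNat.2 (by omega)⟩
  · intro a _ b _ h
    exact Nat.succPNat_injective h
  · intro b hb
    refine ⟨b.natPred, ?_, b.succPNat_natPred⟩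
    have := (Finset.mem_Icc.1 hb).2
    rw [← b.succPNat_natPred, Nat.succPNat_le_succPNat] at this
    exact Finset.mem_range.2 (by omega)
  · intro _ _; rfl

theorem World.toReal_mem {L : FirstOrder.Language.{0, 0}} (W : World L) (φ : L.Sentence) :
    0 ≤ W.toReal φ ∧ W.toReal φ ≤ 1 := by
  unfold World.toReal; split <;> simp

theorem average_mem {n : ℕ} {g : ℕ → ℝ} (hg : ∀ j, 0 ≤ g j ∧ g j ≤ 1) :
    0 ≤ 1 / ((n : ℝ) + 1) * ∑ j ∈ Finset.range (n + 1), g j ∧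
      1 / ((n : ℝ) + 1) * ∑ j ∈ Finset.range (n + 1), g j ≤ 1 := by
  have h1 : ∑ j ∈ Finset.range (n + 1), g j ≤ (n : ℝ) + 1 := by
    refine (Finset.sum_le_sum fun j _ => (hg j).2).trans ?_
    simp
  have h2 : (0 : ℝ) < (n : ℝ) + 1 := by positivity
  refine ⟨mul_nonneg (by positivity) (Finset.sum_nonneg fun j _ => (hg j).1), ?_⟩
  rw [one_div, inv_mul_le_iff₀ h2]
  linarith

namespace BettingPlan

variable {L : FirstOrder.Language.{0, 0}} (B : BettingPlan L.Sentence)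

/-- The value on day `n` of the `i`-th bet, according to `W`. -/
noncomputable def betValue (V : ℕ+ → L.Sentence → ℝ) (f : ℕ → ℕ) (W : World L) (n i : ℕ) : ℝ :=
  B.stakeVal V i * (1 / ((i : ℝ) + 1)) * ∑ j ∈ Finset.range (i + 1),
      (W.toReal (B.bought i j) - V i.succPNat (B.bought i j)) -
    B.ratioVal V i * B.stakeVal V i * (1 / ((i : ℝ) + 1)) * ∑ j ∈ Finset.range (i + 1),
      (W.toReal (B.sold i j) - V i.succPNat (B.sold i j)) -
    if f i ≤ n then B.stakeVal V i * B.hedgeVal V i (f i) *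
      (W.toReal (B.base i) - V (f i).succPNat (B.base i)) else 0

/-- The accounts by days are regrouped by bets: each hedge is made on exactly one day, and not
before its bet. -/
theorem sum_value_trader (V : ℕ+ → L.Sentence → ℝ) {f : ℕ → ℕ} (hf : ∀ i, i ≤ f i)
    (hdue : ∀ i n, B.due i n = true ↔ f i = n) (W : World L) (n : ℕ) :
    ∑ i ∈ Finset.Icc 1 n.succPNat, (B.trader i).value V i W.toReal =
      ∑ i ∈ Finset.range (n + 1), B.betValue V f W n i := by
  rw [sum_Icc_pnat fun i => (B.trader i).value V i W.toReal]
  simp only [value_trader, betValue, Finset.sum_sub_distrib]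
  congr 1
  have h1 : ∀ k ∈ Finset.range (n + 1), (∑ i ∈ Finset.range (k + 1), if B.due i k then
      B.stakeVal V i * B.hedgeVal V i k * (W.toReal (B.base i) - V k.succPNat (B.base i)) else 0) =
      ∑ i ∈ Finset.range (n + 1), if f i = k then B.stakeVal V i * B.hedgeVal V i (f i) *
        (W.toReal (B.base i) - V (f i).succPNat (B.base i)) else 0 := by
    intro k hk
    rw [Finset.mem_range] at hk
    rw [← Finset.sum_range_add_sum_Ico _ (show k + 1 ≤ n + 1 by omega)]
    rw [Finset.sum_eq_zero (s := Finset.Ico (k + 1) (n + 1)), add_zero]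
    · refine Finset.sum_congr rfl fun i _ => ?_
      by_cases h : f i = k
      · rw [if_pos ((hdue i k).2 h), if_pos h, h]
      · rw [if_neg h, if_neg fun h' => h ((hdue i k).1 h')]
    · intro i hi
      rw [Finset.mem_Ico] at hi
      have := hf i
      exact if_neg (by omega)
  rw [Finset.sum_congr rfl h1, Finset.sum_comm]
  refine Finset.sum_congr rfl fun i _ => ?_
  rw [Finset.sum_ite_eq]
  simp only [Finset.mem_range, Nat.lt_succ_iff]

theorem betValue_eq (V : ℕ+ → L.Sentence → ℝ) (f : ℕ → ℕ) (W : World L) (n i : ℕ) :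
    B.betValue V f W n i = B.stakeVal V i *
      (1 / ((i : ℝ) + 1) * ∑ j ∈ Finset.range (i + 1), W.toReal (B.bought i j) -
        B.ratioVal V i * (1 / ((i : ℝ) + 1) * ∑ j ∈ Finset.range (i + 1), W.toReal (B.sold i j)) +
        B.edge V i - if f i ≤ n then B.hedgeVal V i (f i) *
          (W.toReal (B.base i) - V (f i).succPNat (B.base i)) else 0) := by
  rw [betValue, edge, Finset.sum_sub_distrib, Finset.sum_sub_distrib]
  split <;> ring

theorem hedgeVal_mem (V : ℕ+ → L.Sentence → ℝ) (i n : ℕ) :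
    0 ≤ B.hedgeVal V i n ∧ B.hedgeVal V i n ≤ 1 :=
  ⟨le_min zero_le_one (le_max_left _ _), min_le_left _ _⟩

/-- The hedge is zero unless the price exceeds the ratio; `base i` is never sold below `p`. -/
theorem hedgeVal_mul_nonneg (V : ℕ+ → L.Sentence → ℝ) {i : ℕ} (hs : 0 < B.slope i) (n : ℕ) :
    0 ≤ B.hedgeVal V i n * (V n.succPNat (B.base i) - B.ratioVal V i) := by
  have hs' : (0 : ℝ) < B.slope i := by exact_mod_cast hs
  rcases le_total 0 (V n.succPNat (B.base i) - B.ratioVal V i) with h | h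
  · exact mul_nonneg (B.hedgeVal_mem V i n).1 h
  · have : B.hedgeVal V i n = 0 := by
      rw [hedgeVal, max_eq_left (mul_nonpos_of_nonpos_of_nonneg h hs'.le), min_eq_right zero_le_one]
    rw [this, zero_mul]

/-- A betting plan exploits the prices if its bets are closed only when they have been won, and
profitable bets appear again and again. -/
theorem exploits (V : ℕ+ → L.Sentence → ℝ) (hV : ∀ n φ, 0 ≤ V n φ ∧ V n φ ≤ 1)
    (D : ℕ+ → Finset L.Sentence) (W₀ : World L) (hW₀ : ∀ n, W₀ ∈ pcWorlds (D n : Set L.Sentence))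
    {f : ℕ → ℕ} (hf : ∀ i, i ≤ f i) (hdue : ∀ i n, B.due i n = true ↔ f i = n)
    (hratio : ∀ k, 0 ≤ B.ratioVal V k ∧ B.ratioVal V k ≤ 1) (hslope : ∀ k, 0 < B.slope k)
    (hmargin : 0 < B.margin)
    (hmono : ∀ i m n, m ≤ n → B.closed i m = true → B.closed i n = true)
    (hclosed : ∀ i, ∃ n, B.closed i n = true)
    (hclosed_f : ∀ i n, B.closed i n = true → f i ≤ n)
    (hwon : ∀ i n, B.closed i n = true → ∀ W ∈ pcWorlds (D n.succPNat : Set L.Sentence),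
      ∃ c : ℝ, B.hedgeVal V i (f i) ≤ c ∧ c ≤ B.hedgeVal V i (f i) + 1 / ((i : ℝ) + 1) ∧
        1 / ((i : ℝ) + 1) * ∑ j ∈ Finset.range (i + 1), W.toReal (B.sold i j) = c ∧
        W.toReal (B.base i) * c ≤
          1 / ((i : ℝ) + 1) * ∑ j ∈ Finset.range (i + 1), W.toReal (B.bought i j))
    (hfreq : ∃ᶠ k in atTop, 2 * (B.margin : ℝ) ≤ B.edge V k) : Exploits B.trader V D := by
  have hm : (0 : ℝ) < B.margin := by exact_mod_cast hmargin
  set e : ℕ → ℝ := fun k => max 0 (B.edge V k - (B.margin + 1 / ((k : ℝ) + 1))) with he_def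
  have he : ∀ k, 0 ≤ e k ∧ e k ≤ 1 := by
    intro k
    refine ⟨le_max_left _ _, max_le zero_le_one ?_⟩
    have h1 := average_mem (n := k) fun j => hV k.succPNat (B.sold k j)
    have h2 := average_mem (n := k) fun j => hV k.succPNat (B.bought k j)
    have h3 := hratio k
    have h4 : (0 : ℝ) < 1 / ((k : ℝ) + 1) := by positivity
    rw [edge]
    nlinarith
  have hx : ∀ k, B.stakeVal V k = e k *
      (1 - ∑ i ∈ Finset.range k, if B.closed i k then 0 else B.stakeVal V i) := B.stakeVal_eq V
  have hopen := open_stakes_le he hx hmono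
  have hunb := unbounded_stakes he hx hmono hclosed (half_pos hm) (by
    refine (hfreq.and_eventually ((tendsto_one_div_add_atTop_nhds_zero_nat
      (𝕜 := ℝ)).eventually_lt_const (half_pos hm))).mono fun k hk => ?_
    exact le_max_of_le_right (by linarith [hk.1, hk.2]))
  -- A positive stake requires an edge of at least `margin + 1 / (i + 1)`; multiplying by the stake
  -- covers the days without a bet.
  have hedge : ∀ i, B.stakeVal V i * (B.margin + 1 / ((i : ℝ) + 1)) ≤
      B.stakeVal V i * B.edge V i := by
    intro i
    rcases le_total (B.edge V i - (B.margin + 1 / ((i : ℝ) + 1))) 0 with h | h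
    · have : B.stakeVal V i = 0 := by rw [hx]; simp only [he_def]; rw [max_eq_left h, zero_mul]
      simp [this]
    · exact mul_le_mul_of_nonneg_left (by linarith) (hopen i).1
  -- Per unit of stake, the sold sentences and the hedge can each cost at most `1`, and the edge is
  -- not negative where the stake is positive.
  have hlow : ∀ W : World L, ∀ n i, -2 * B.stakeVal V i ≤ B.betValue V f W n i := by
    intro W n i
    rw [betValue_eq]
    have h1 := average_mem (n := i) fun j => W.toReal_mem (B.sold i j)
    have h2 := average_mem (n := i) fun j => W.toReal_mem (B.bought i j)
    have h3 := hratio i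
    have h4 := (hopen i).1
    have h5 := hedge i
    have h6 : (0 : ℝ) < 1 / ((i : ℝ) + 1) := by positivity
    have h7 : 0 ≤ B.stakeVal V i * B.edge V i := le_trans (by positivity) h5
    have h8 : (if f i ≤ n then B.hedgeVal V i (f i) *
          (W.toReal (B.base i) - V (f i).succPNat (B.base i)) else 0) ≤ 1 := by
      split
      · have a1 := B.hedgeVal_mem V i (f i)
        have a2 := W.toReal_mem (B.base i)
        have a3 := hV (f i).succPNat (B.base i)
        nlinarith
      · exact zero_le_one
    have h9 : B.ratioVal V i * (1 / ((i : ℝ) + 1) * ∑ j ∈ Finset.range (i + 1),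
        W.toReal (B.sold i j)) ≤ 1 := mul_le_one₀ h3.2 h1.1 h1.2
    generalize (if f i ≤ n then B.hedgeVal V i (f i) *
          (W.toReal (B.base i) - V (f i).succPNat (B.base i)) else 0) = z at *
    generalize B.ratioVal V i * (1 / ((i : ℝ) + 1) * ∑ j ∈ Finset.range (i + 1),
        W.toReal (B.sold i j)) = y at *
    generalize 1 / ((i : ℝ) + 1) * ∑ j ∈ Finset.range (i + 1), W.toReal (B.bought i j) = x at *
    nlinarith [mul_nonneg h4 h2.1, mul_nonneg h4 (sub_nonneg.2 h8), mul_nonneg h4 (sub_nonneg.2 h9)]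
  have hhigh : ∀ n i, B.closed i n = true → ∀ W ∈ pcWorlds (D n.succPNat : Set L.Sentence),
      B.margin * B.stakeVal V i ≤ B.betValue V f W n i := by
    intro n i hcl W hW
    obtain ⟨c, hc1, hc2, hc3, hc4⟩ := hwon i n hcl W hW
    rw [betValue_eq, hc3, if_pos (hclosed_f i n hcl)]
    have h1 := hratio i
    have h2 := B.hedgeVal_mul_nonneg V (hslope i) (f i)
    have h3 := W.toReal_mem (B.base i)
    have h4 := (hopen i).1
    have h5 := hedge i
    generalize 1 / ((i : ℝ) + 1) * ∑ j ∈ Finset.range (i + 1), W.toReal (B.bought i j) = x at *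
    generalize B.hedgeVal V i (f i) = h at *
    generalize W.toReal (B.base i) = w at *
    generalize V (f i).succPNat (B.base i) = v at *
    generalize B.ratioVal V i = p at *
    -- As `x ≥ w * c`, the right side is at least `(c - h) * (w - p) + h * (v - p)`. Here `0 ≤ c - h
    -- ≤ 1 / (i + 1)` and `w - p ≥ -1`, and the last product is nonnegative. The rounding loss is
    -- covered by the summand `1 / (i + 1)` in the edge.
    have h6 : -(1 / ((i : ℝ) + 1)) ≤ x - p * c - h * (w - v) := by
      nlinarith [mul_nonneg (sub_nonneg.2 hc1) (show 0 ≤ w - p + 1 by linarith)]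
    nlinarith [mul_le_mul_of_nonneg_left h6 h4]
  refine ⟨⟨-2, ?_⟩, ?_⟩
  · rintro x ⟨n, W, hW, rfl⟩
    rw [← n.succPNat_natPred, B.sum_value_trader V hf hdue]
    rw [← n.succPNat_natPred] at hW
    have h1 : ∀ i ∈ Finset.range (n.natPred + 1), -2 * (if B.closed i n.natPred then 0 else
        B.stakeVal V i) ≤ B.betValue V f W n.natPred i := by
      intro i _
      by_cases h : B.closed i n.natPred = true
      · rw [if_pos h, mul_zero]
        exact le_trans (mul_nonneg hm.le (hopen i).1) (hhigh _ _ h W hW)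
      · rw [if_neg h]
        exact hlow W _ i
    refine le_trans ?_ (Finset.sum_le_sum h1)
    rw [← Finset.mul_sum]
    linarith [(hopen n.natPred).2]
  · rintro ⟨C, hC⟩
    -- If all bets are credited with `margin` times their stakes, the open ones must be charged `2 +
    -- margin` times theirs. Their total stake is at most `1`, so the stakes have to exceed this
    -- threshold.
    obtain ⟨n, hn⟩ := hunb ((C + 2 + B.margin) / B.margin)
    have h0 := hC ⟨n.succPNat, W₀, hW₀ _, rfl⟩
    rw [B.sum_value_trader V hf hdue] at h0
    have h1 : ∀ i ∈ Finset.range (n + 1), B.margin * B.stakeVal V i - (2 + B.margin) *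
        (if B.closed i n then 0 else B.stakeVal V i) ≤ B.betValue V f W₀ n i := by
      intro i _
      by_cases h : B.closed i n = true
      · rw [if_pos h, mul_zero, sub_zero]
        exact hhigh _ _ h W₀ (hW₀ _)
      · rw [if_neg h]
        linarith [hlow W₀ n i]
    have h2 := Finset.sum_le_sum h1
    rw [Finset.sum_sub_distrib, ← Finset.mul_sum, ← Finset.mul_sum, Finset.sum_range_succ] at h2
    have h3 := (hopen n).2
    have h4 := (hopen n).1
    rw [div_lt_iff₀ hm] at hn
    nlinarith

end BettingPlan

/-! ## The settlement of bets -/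

open PolyTime in
/-- The relation `f i = n` for a deferral function `f` can be decided in time polynomial in `n`. -/
theorem IsDeferral.exists_due {f : ℕ+ → ℕ+} (hf : IsDeferral f) : ∃ due : ℕ → ℕ → Bool,
    PolyTime (fun x : Unary × Unary => due x.1.val x.2.val) ∧
      ∀ i n, due i n = true ↔ (f i.succPNat).natPred = n := by
  obtain ⟨hlt, c, h, hc⟩ := hf
  have hrun : ∀ (a : Unary) (T : ℕ), h.eval (f a.val.succPNat : ℕ) + 4 * a.val + 4 ≤ T →
      -- Pairing with `nil` adds one to a unary number, i.e. passes from the number `a` to day `a +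
      -- 1`. Together with the composition it costs `4 * a + 4`.
      RunsIn (.comp c (.pair .nil .id)) (enc a) (enc (f a.val.succPNat)) T := by
    intro a T hT
    obtain ⟨t, ht, hr⟩ := hc a.val.succPNat
    refine ⟨_, ?_, .comp (.pair (.nil _) (.id _)) hr⟩
    have h1 : (enc a).size = 2 * a.val + 1 := encSize_unary a
    omega
  obtain ⟨t, ht, hpoly⟩ := exists_clocked (g := fun a : Unary => f a.val.succPNat)
    (.comp c (.pair .nil .id)) fun a => by
      obtain ⟨t, -, hr⟩ := hrun a _ le_rfl
      exact ⟨t, hr⟩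
  -- A deferral function is computed in time polynomial in its value. If the value is day `n + 1`,
  -- this fuel exceeds the cost; if the fuel runs out, the value is another day. The last unit of
  -- `5` makes the inequality strict.
  let fuel : ℕ → ℕ := fun n => h.eval (n + 1) + 4 * n + 5
  let due : ℕ → ℕ → Bool := fun i n =>
    (if t ⟨i⟩ < fuel n then [f i.succPNat] else []).any fun m => decide (m = n.succPNat)
  refine ⟨due, ?_, fun i n => ?_⟩
  · have h1 : PolyTime fun x : Unary × Unary => (⟨fuel x.2.val⟩ : Unary) :=
      (unaryAdd (unaryAdd (unaryPolynomial h (unarySucc snd)) (unaryMul (const ⟨4⟩) snd))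
        (const ⟨5⟩)).congr fun _ => rfl
    have h2 := hpoly.comp (g := fun x : Unary × Unary => ((⟨fuel x.2.val⟩ : Unary), x.1))
      (pair h1 fst)
    exact any (p := fun (x : Unary × Unary) m => decide (m = x.2.val.succPNat)) h2
      (eq_of_injective (fun a b hab => PNat.coe_injective (enc_nat_injective hab)) snd
        (succPNat (snd.comp fst)))
  · constructor
    · intro hd
      obtain ⟨m, hm, h1⟩ := List.any_eq_true.1 hd
      split at hm
      · rw [List.mem_singleton] at hm
        rw [← hm, of_decide_eq_true h1, Nat.natPred_succPNat]
      · simp at hm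
    · rintro rfl
      have h1 : (f i.succPNat).natPred + 1 = f i.succPNat := PNat.natPred_add_one _
      have h2 : i ≤ (f i.succPNat).natPred := by
        have h3 : (i.succPNat : ℕ) < f i.succPNat := hlt i.succPNat
        rw [Nat.succPNat_coe] at h3
        omega
      have h3 : t ⟨i⟩ < fuel (f i.succPNat).natPred := by
        refine Nat.lt_of_le_of_lt (ht ⟨i⟩ _ (hrun ⟨i⟩ _ le_rfl)) ?_
        simp only [fuel, h1]
        omega
      simp only [due, if_pos h3, List.any_cons, PNat.succPNat_natPred, decide_true, Bool.true_or]

section Settlement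

variable {L : FirstOrder.Language.{0, 0}} [∀ k, Encodable (L.Functions k)]
  [∀ k, Encodable (L.Relations k)]

open PolyTime in
/-- A deductive sequence is exhausted by an efficiently computable sequence of sets. -/
theorem IsDeductive.exists_polyTime {D : ℕ+ → Finset L.Sentence} (hD : IsDeductive D) :
    ∃ E : ℕ → List L.Sentence, PolyTime (fun k : Unary => E k.val) ∧
      (∀ k, ∀ φ ∈ E k, φ ∈ D k.succPNat) ∧ (∀ m n, m ≤ n → E m ⊆ E n) ∧
        ∀ n, ∀ φ ∈ D n, ∃ k, φ ∈ E k := by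
  obtain ⟨hmono, l, hl, c, hc⟩ := hD
  obtain ⟨t, -, hpoly⟩ := exists_clocked c hc
  -- At time `k`, collect those of the first `k + 1` sets whose computation costs less than `k`. The
  -- sequence may lag far behind `D` but loses nothing.
  let E : ℕ → List L.Sentence := fun k => (unaryRange (k + 1)).flatMap fun m =>
    (if t m.val.succPNat < k then [l m.val.succPNat] else []).flatMap fun x => x
  have hE : ∀ k φ, φ ∈ E k ↔ ∃ m ≤ k, t m.succPNat < k ∧ φ ∈ D m.succPNat := by
    intro k φ
    simp only [E, List.mem_flatMap, mem_unaryRange, Nat.lt_succ_iff]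
    constructor
    · rintro ⟨m, hm, x, hx, hφ⟩
      split at hx
      · rw [List.mem_singleton] at hx
        subst hx
        exact ⟨m.val, hm, by assumption, (hl _ _).1 hφ⟩
      · simp at hx
    · rintro ⟨m, hm, ht, hφ⟩
      exact ⟨⟨m⟩, hm, l m.succPNat, by simp [ht], (hl _ _).2 hφ⟩
  refine ⟨E, ?_, fun k φ hφ => ?_, fun m n hmn φ hφ => ?_, fun n φ hφ => ?_⟩
  · have h1 := hpoly.comp (g := fun x : Unary × Unary => (x.1, x.2.val.succPNat))
      (pair fst (succPNat snd))
    exact flatMap (range (unarySucc PolyTime.id)) (flatMap h1 snd)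
  · obtain ⟨m, hm, -, h1⟩ := (hE k φ).1 hφ
    exact hmono (Nat.succPNat_le_succPNat.2 hm) h1
  · obtain ⟨j, hj, h1, h2⟩ := (hE m φ).1 hφ
    exact (hE n φ).2 ⟨j, hj.trans hmn, h1.trans_le hmn, h2⟩
  · refine ⟨n.natPred + t n + 1, (hE _ _).2 ⟨n.natPred, by omega, ?_, ?_⟩⟩ <;>
      rw [PNat.succPNat_natPred]
    · omega
    · exact hφ

/-- On the assumptions `E`, the sentence `ψ` is decided, and it follows from `φ` and `ψ` that `χ`;
`n` tableau steps are enough to see this. -/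
noncomputable def settlesSentence (n : ℕ) (E : List L.Sentence) (φ ψ χ : L.Sentence) : Bool :=
  (refutes n ((true, ψ) :: E.map fun θ => (true, θ)) ||
    refutes n ((false, ψ) :: E.map fun θ => (true, θ))) &&
  refutes n ((true, φ) :: (true, ψ) :: (false, χ) :: E.map fun θ => (true, θ))

theorem refutes_sound_of_models {N : ℕ} {l : List (Signed L)} {E : List L.Sentence}
    (h : refutes N (l ++ E.map fun θ => (true, θ)) = true) {W : World L}
    (hW : W ∈ pcWorlds {θ | θ ∈ E}) : ∃ s ∈ l, W s.2 ≠ s.1 := by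
  obtain ⟨s, hs, h1⟩ := refutes_sound h hW.1
  rcases List.mem_append.1 hs with h2 | h2
  · exact ⟨s, h2, h1⟩
  · obtain ⟨θ, hθ, rfl⟩ := List.mem_map.1 h2
    exact absurd (hW.2 θ hθ) h1

theorem exists_refutes_of_models {l : List (Signed L)} {E : List L.Sentence}
    (h : ∀ W ∈ pcWorlds {θ | θ ∈ E}, ∃ s ∈ l, W s.2 ≠ s.1) :
    ∃ N, refutes N (l ++ E.map fun θ => (true, θ)) = true := by
  refine exists_refutes fun W hW => ?_
  by_cases h1 : ∀ θ ∈ E, W θ = true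
  · obtain ⟨s, hs, h2⟩ := h W ⟨hW, h1⟩
    exact ⟨s, List.mem_append_left _ hs, h2⟩
  · push Not at h1
    obtain ⟨θ, hθ, h2⟩ := h1
    exact ⟨(true, θ), List.mem_append_right _ (List.mem_map_of_mem hθ), h2⟩

theorem settlesSentence_mono {m n : ℕ} (hmn : m ≤ n) {E : List L.Sentence} {φ ψ χ : L.Sentence}
    (h : settlesSentence m E φ ψ χ = true) : settlesSentence n E φ ψ χ = true := by
  simp only [settlesSentence, Bool.and_eq_true, Bool.or_eq_true] at *
  exact ⟨h.1.imp (refutes_mono hmn) (refutes_mono hmn), refutes_mono hmn h.2⟩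

theorem settlesSentence_sound {n : ℕ} {E : List L.Sentence} {φ ψ χ : L.Sentence}
    (h : settlesSentence n E φ ψ χ = true) {W W' : World L} (hW : W ∈ pcWorlds {θ | θ ∈ E})
    (hW' : W' ∈ pcWorlds {θ | θ ∈ E}) : W ψ = W' ψ ∧ (W φ = true → W ψ = true → W χ = true) := by
  simp only [settlesSentence, Bool.and_eq_true, Bool.or_eq_true] at h
  constructor
  · rcases h.1 with h1 | h1
    · have h2 := refutes_sound_of_models (l := [(true, ψ)]) h1 hW
      have h3 := refutes_sound_of_models (l := [(true, ψ)]) h1 hW'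
      simp_all
    · have h2 := refutes_sound_of_models (l := [(false, ψ)]) h1 hW
      have h3 := refutes_sound_of_models (l := [(false, ψ)]) h1 hW'
      simp_all
  · intro h1 h2
    have h3 := refutes_sound_of_models (l := [(true, φ), (true, ψ), (false, χ)]) h.2 hW
    simpa [h1, h2] using h3

theorem exists_settlesSentence {E : List L.Sentence} {φ ψ χ : L.Sentence} {b : Bool}
    (h : ∀ W ∈ pcWorlds {θ | θ ∈ E}, W ψ = b ∧ (W φ = true → W ψ = true → W χ = true)) :
    ∃ n, settlesSentence n E φ ψ χ = true := by
  obtain ⟨N, hN⟩ := exists_refutes_of_models (l := [(!b, ψ)]) (E := E) fun W hW =>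
    ⟨_, List.mem_singleton_self _, by simp [(h W hW).1]⟩
  obtain ⟨N', hN'⟩ := exists_refutes_of_models (l := [(true, φ), (true, ψ), (false, χ)])
    (E := E) fun W hW => by
      by_contra! h1
      simp only [List.mem_cons, List.not_mem_nil, or_false, forall_eq_or_imp, forall_eq] at h1
      have := (h W hW).2 h1.1 h1.2.1
      rw [h1.2.2] at this
      cases this
  refine ⟨max N N', ?_⟩
  simp only [settlesSentence, Bool.and_eq_true, Bool.or_eq_true]
  refine ⟨?_, refutes_mono (le_max_right _ _) hN'⟩
  have h1 := refutes_mono (le_max_left N N') hN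
  cases b
  · exact Or.inl h1
  · exact Or.inr h1

/-- The day of the hedge of the `i`-th bet has come, and some set `E m` of known facts settles all
sentences of the `i`-th bet within `n` steps. -/
noncomputable def settled (due : ℕ → ℕ → Bool) (E : ℕ → List L.Sentence) (base : ℕ → L.Sentence)
    (sold bought : ℕ → ℕ → L.Sentence) (i n : ℕ) : Bool :=
  ((unaryRange (n + 1)).any fun m => due i m.val) &&
  (unaryRange (n + 1)).any fun m => (unaryRange (i + 1)).all fun j =>
    settlesSentence n (E m.val) (base i) (sold i j.val) (bought i j.val)

open PolyTime in
theorem PolyTime.settled {due : ℕ → ℕ → Bool} {E : ℕ → List L.Sentence} {base : ℕ → L.Sentence}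
    {sold bought : ℕ → ℕ → L.Sentence}
    (hdue : PolyTime fun x : Unary × Unary => due x.1.val x.2.val)
    (hE : PolyTime fun k : Unary => E k.val) (hbase : PolyTime fun k : Unary => base k.val)
    (hsold : PolyTime fun x : Unary × Unary => sold x.1.val x.2.val)
    (hbought : PolyTime fun x : Unary × Unary => bought x.1.val x.2.val) :
    PolyTime fun x : Unary × Unary => settled due E base sold bought x.1.val x.2.val := by
  have hr := range (unarySucc (snd (α := Unary) (β := Unary)))
  refine and (any (p := fun (x : Unary × Unary) (m : Unary) => due x.1.val m.val) hr
      (hdue.comp (g := fun y : (Unary × Unary) × Unary => (y.1.1, y.2)) (by fun_prop)))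
    (any (p := fun (x : Unary × Unary) (m : Unary) => (unaryRange (x.1.val + 1)).all fun j =>
        settlesSentence x.2.val (E m.val) (base x.1.val) (sold x.1.val j.val) (bought x.1.val j.val))
      hr (all (p := fun (y : (Unary × Unary) × Unary) (j : Unary) =>
        settlesSentence y.1.2.val (E y.2.val) (base y.1.1.val) (sold y.1.1.val j.val)
          (bought y.1.1.val j.val)) (range (unarySucc (by fun_prop))) ?_))
  have h1 : PolyTime fun z : ((Unary × Unary) × Unary) × Unary =>
      (E z.1.2.val).map fun θ => (true, θ) :=
    map (f := fun _ θ => (true, θ)) (hE.comp (by fun_prop)) (by fun_prop)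
  have h2 := hbase.comp (g := fun z : ((Unary × Unary) × Unary) × Unary => z.1.1.1) (by fun_prop)
  have h3 := hsold.comp (g := fun z : ((Unary × Unary) × Unary) × Unary => (z.1.1.1, z.2))
    (by fun_prop)
  have h4 := hbought.comp (g := fun z : ((Unary × Unary) × Unary) × Unary => (z.1.1.1, z.2))
    (by fun_prop)
  have h5 : PolyTime fun z : ((Unary × Unary) × Unary) × Unary => z.1.1.2 := by fun_prop
  exact and (or (PolyTime.refutes h5 (cons (pair (const true) h3) h1))
    (PolyTime.refutes h5 (cons (pair (const false) h3) h1)))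
    (PolyTime.refutes h5 (cons (pair (const true) h2) (cons (pair (const true) h3)
      (cons (pair (const false) h4) h1))))

/-! ### Settled bets: persistence, soundness and eventual settlement -/

section

variable {due : ℕ → ℕ → Bool} {E : ℕ → List L.Sentence} {base : ℕ → L.Sentence}
  {sold bought : ℕ → ℕ → L.Sentence}

theorem settled_iff {i n : ℕ} : settled due E base sold bought i n = true ↔
    (∃ m ≤ n, due i m = true) ∧ ∃ m ≤ n, ∀ j ≤ i,
      settlesSentence n (E m) (base i) (sold i j) (bought i j) = true := by
  simp only [settled, Bool.and_eq_true, List.any_eq_true, List.all_eq_true, mem_unaryRange,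
    Nat.lt_succ_iff]
  exact and_congr ⟨fun ⟨m, h⟩ => ⟨m.val, h⟩, fun ⟨m, h⟩ => ⟨⟨m⟩, h⟩⟩
    ⟨fun ⟨m, h1, h2⟩ => ⟨m.val, h1, fun j => h2 ⟨j⟩⟩, fun ⟨m, h1, h2⟩ => ⟨⟨m⟩, h1, fun j => h2 j.val⟩⟩

/-- The witness keeps its set of facts and only the step bound grows. If all facts known at time `n`
were used instead, this could fail, because a larger set may delay the refutation. -/
theorem settled_mono {i m n : ℕ} (hmn : m ≤ n) (h : settled due E base sold bought i m = true) :
    settled due E base sold bought i n = true := by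
  rw [settled_iff] at *
  obtain ⟨⟨k, h1, h2⟩, l, h3, h4⟩ := h
  exact ⟨⟨k, h1.trans hmn, h2⟩, l, h3.trans hmn, fun j hj => settlesSentence_mono hmn (h4 j hj)⟩

/-- Only agreement of worlds is recorded, not a truth value; the value is found later by comparison
with a world of `Γ`. -/
theorem settled_sound {D : ℕ+ → Finset L.Sentence} (hED : ∀ k, ∀ φ ∈ E k, φ ∈ D k.succPNat)
    (hD : Monotone D) {i n : ℕ} (h : settled due E base sold bought i n = true) {W W' : World L}
    (hW : W ∈ pcWorlds (D n.succPNat : Set L.Sentence))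
    (hW' : W' ∈ pcWorlds (D n.succPNat : Set L.Sentence)) {j : ℕ} (hj : j ≤ i) :
    W (sold i j) = W' (sold i j) ∧
      (W (base i) = true → W (sold i j) = true → W (bought i j) = true) := by
  obtain ⟨-, m, h1, h2⟩ := settled_iff.1 h
  have h3 : {θ | θ ∈ E m} ⊆ (D n.succPNat : Set L.Sentence) := fun θ hθ =>
    hD (Nat.succPNat_le_succPNat.2 h1) (hED m θ hθ)
  exact settlesSentence_sound (h2 j hj) (pcWorlds_anti h3 hW) (pcWorlds_anti h3 hW')

theorem exists_settled {Γ : L.Theory} (hE : ∀ m n, m ≤ n → E m ⊆ E n)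
    (hΓ : pcWorlds (⋃ k, {θ | θ ∈ E k}) ⊆ pcWorlds Γ) {i n₀ : ℕ} (hdue : due i n₀ = true)
    (h1 : ∀ j, Proves Γ (sold i j) ∨ Proves Γ ∼(sold i j))
    (h2 : ∀ j, Proves Γ (base i ⟹ (sold i j ⟹ bought i j))) :
    ∃ n, settled due E base sold bought i n = true := by
  have key : ∀ j, ∃ b, ∃ m, ∀ W ∈ pcWorlds {θ | θ ∈ E m}, W (sold i j) = b ∧
      (W (base i) = true → W (sold i j) = true → W (bought i j) = true) := by
    intro j
    have hdec : ∃ b, ∀ W ∈ pcWorlds Γ, W (sold i j) = b := by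
      rcases h1 j with h | h
      · exact ⟨true, fun W hW => h.sound hW⟩
      · refine ⟨false, fun W hW => ?_⟩
        have h3 := h.sound hW
        have h4 : (!W (sold i j) || W ⊥) = true := (hW.1.2 (sold i j) ⊥).symm.trans h3
        simpa [hW.1.1] using h4
    obtain ⟨b, hb⟩ := hdec
    refine ⟨b, ?_⟩
    -- Otherwise every `E m` has a world that violates the claim. The violating worlds form a closed
    -- set, so by compactness some world of the union, hence of `Γ`, violates it too.
    by_contra! hne
    have hcl : IsClosed {W : World L | ¬ (W (sold i j) = b ∧
        (W (base i) = true → W (sold i j) = true → W (bought i j) = true))} := by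
      have hclopen : ∀ (φ : L.Sentence) (b : Bool), IsClopen {W : World L | W φ = b} := fun φ b =>
        (isClopen_discrete {b}).preimage (continuous_apply φ)
      have h3 : {W : World L | ¬ (W (sold i j) = b ∧
          (W (base i) = true → W (sold i j) = true → W (bought i j) = true))} =
          ({W | W (sold i j) = b} ∩ ({W | W (base i) = true}ᶜ ∪ ({W | W (sold i j) = true}ᶜ ∪
            {W | W (bought i j) = true})))ᶜ := by
        ext W
        simp only [Set.mem_ofPred_eq, Set.mem_compl_iff, Set.mem_inter_iff, Set.mem_union]
        tauto
      rw [h3]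
      exact ((hclopen _ _).inter ((hclopen _ _).compl.union
        ((hclopen _ _).compl.union (hclopen _ _)))).compl.1
    obtain ⟨W, hW, hW'⟩ := exists_mem_pcWorlds_iUnion (fun k => {θ | θ ∈ E k})
      (Monotone.directed_le fun m n hmn => hE m n hmn) _ hcl fun m => by
        obtain ⟨W, hW, h3⟩ := hne m
        refine ⟨W, hW, fun h4 => ?_⟩
        obtain ⟨h5, h6, h7⟩ := h3 h4.1
        exact h7 (h4.2 h5 h6)
    refine hW' ⟨hb W (hΓ hW), fun h3 h4 => ?_⟩
    simpa [(hΓ hW).1.2, h3, h4] using (h2 j).sound (hΓ hW)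
  choose b m hm using key
  -- A bet involves finitely many sentences, so one set of facts and one number of steps serve for
  -- all of them.
  have h3 : ∀ j ≤ i, m j ≤ (Finset.range (i + 1)).sup m := fun j hj =>
    Finset.le_sup (Finset.mem_range.2 (Nat.lt_succ_of_le hj))
  set M := (Finset.range (i + 1)).sup m
  have h4 : ∀ j, ∃ n, j ≤ i →
      settlesSentence n (E M) (base i) (sold i j) (bought i j) = true := by
    intro j
    by_cases hj : j ≤ i
    · obtain ⟨n, hn⟩ := exists_settlesSentence (E := E M) (φ := base i) (ψ := sold i j)
        (χ := bought i j) fun W hW => hm j W (pcWorlds_anti (hE _ _ (h3 j hj)) hW)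
      exact ⟨n, fun _ => hn⟩
    · exact ⟨0, fun h => absurd h hj⟩
  choose N hN using h4
  refine ⟨max n₀ (max M ((Finset.range (i + 1)).sup N)), settled_iff.2
    ⟨⟨n₀, le_max_left _ _, hdue⟩, M, (le_max_left _ _).trans (le_max_right _ _), fun j hj => ?_⟩⟩
  refine settlesSentence_mono (le_trans ?_ ((le_max_right _ _).trans (le_max_right _ _))) (hN j hj)
  exact Finset.le_sup (f := N) (Finset.mem_range.2 (Nat.lt_succ_of_le hj))

end

end Settlement

/-! ## Numerical estimates -/

/-- The expectation of a determinate quantity `a` is `a`, up to the precision. -/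
theorem average_lt_mem {a : ℝ} (h0 : 0 ≤ a) (h1 : a ≤ 1) (n : ℕ) :
    a ≤ 1 / ((n : ℝ) + 1) * ∑ j ∈ Finset.range (n + 1),
        (if (j : ℝ) / ((n : ℝ) + 1) < a then (1 : ℝ) else 0) ∧
      1 / ((n : ℝ) + 1) * ∑ j ∈ Finset.range (n + 1),
        (if (j : ℝ) / ((n : ℝ) + 1) < a then (1 : ℝ) else 0) ≤ a + 1 / ((n : ℝ) + 1) := by
  have hn : (0 : ℝ) < (n : ℝ) + 1 := by positivity
  -- The grid points below `a` are those with `j < ⌈a (n + 1)⌉`, and all these `j` are in the range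
  -- because `a ≤ 1`.
  have h2 : ∑ j ∈ Finset.range (n + 1), (if (j : ℝ) / ((n : ℝ) + 1) < a then (1 : ℝ) else 0) =
      ⌈a * ((n : ℝ) + 1)⌉₊ := by
    rw [Finset.sum_boole]
    congr 1
    have h3 : (Finset.range (n + 1)).filter (fun j : ℕ => (j : ℝ) / ((n : ℝ) + 1) < a) =
        Finset.range ⌈a * ((n : ℝ) + 1)⌉₊ := by
      ext j
      rw [Finset.mem_filter, Finset.mem_range, Finset.mem_range, Nat.lt_ceil, div_lt_iff₀ hn]
      refine ⟨fun h => h.2, fun h => ⟨?_, h⟩⟩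
      have : (j : ℝ) < ((n + 1 : ℕ) : ℝ) := by push_cast; nlinarith
      exact_mod_cast this
    rw [h3, Finset.card_range]
  rw [h2, one_div, inv_mul_eq_div, le_div_iff₀ hn, div_le_iff₀ hn, add_mul, inv_mul_cancel₀ hn.ne']
  exact ⟨Nat.le_ceil _, (Nat.ceil_lt_add_one (by positivity)).le⟩

/-- The clipped linear form is the one that a feature can compute; it identifies the indicator with
a hedge of slope `δ⁻¹`. -/
theorem ctsInd_eq {δ : ℚ} (hδ : 0 < δ) (x y : ℚ) :
    ctsInd δ x y = min 1 (max 0 ((x - y) * δ⁻¹)) := by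
  rw [ctsInd, ← div_eq_mul_inv]
  split_ifs with h1 h2
  · rw [max_eq_left (div_nonpos_of_nonpos_of_nonneg (by linarith) hδ.le), min_eq_right zero_le_one]
  · rw [max_eq_right (div_nonneg (by linarith) hδ.le),
      min_eq_right ((div_le_one hδ).2 (by linarith))]
  · have h3 : 1 ≤ (x - y) / δ := (one_le_div hδ).2 (by linarith)
    rw [max_eq_right (by linarith), min_eq_left h3]

/-- With `ε` as the margin of the bets, the factor `2` leaves an excess of at least `ε / 2` over `ε
+ 1 / (k + 1)` once `1 / (k + 1) < ε / 2`. -/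
theorem exists_frequently_of_not_asympGE {x y : ℕ+ → ℝ} (h : ¬ AsympGE x y) :
    ∃ ε : ℚ, 0 < ε ∧ ∃ᶠ k : ℕ in atTop, 2 * (ε : ℝ) ≤ y k.succPNat - x k.succPNat := by
  rw [AsympGE, not_le] at h
  obtain ⟨r, h1, h2⟩ := EReal.exists_rat_btwn_of_lt h
  have h3 := frequently_lt_of_liminf_lt (by isBoundedDefault) h1
  have h4 : ((r : ℝ) : EReal) < ((0 : ℝ) : EReal) := h2
  rw [EReal.coe_lt_coe_iff] at h4
  have h5 : r < 0 := by exact_mod_cast h4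
  refine ⟨-r / 2, by linarith, frequently_atTop.2 fun N => ?_⟩
  obtain ⟨n, hn, h6⟩ := frequently_atTop.1 h3 N.succPNat
  have h6' : (((x n - y n : ℝ)) : EReal) < ((r : ℝ) : EReal) := h6
  rw [EReal.coe_lt_coe_iff] at h6'
  refine ⟨n.natPred, ?_, ?_⟩
  · rw [← n.succPNat_natPred, Nat.succPNat_le_succPNat] at hn
    exact hn
  · rw [n.succPNat_natPred]
    push_cast
    linarith

theorem QuoteSystem.dayExpectation_succPNat {L : FirstOrder.Language.{0, 0}} (Q : QuoteSystem L)
    (P : ℕ+ → L.Sentence → ℚ) (k : ℕ) (X : L.Formula (Fin 1)) :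
    Q.dayExpectation P k.succPNat X = 1 / ((k : ℝ) + 1) * ∑ j ∈ Finset.range (k + 1),
      realPrices P k.succPNat (Q.gt X ((j : ℚ) / ((k + 1 : ℕ) : ℚ))) := by
  rw [QuoteSystem.dayExpectation, QuoteSystem.expectation, ← Finset.mul_sum, Nat.succPNat_coe,
    Nat.succ_eq_add_one, Nat.cast_add_one]

end LogicalInduction

/-! ### The self-trust theorem -/

theorem mainTheorem12 {L : FirstOrder.Language.{0, 0}}
    [∀ k, Encodable (L.Functions k)] [∀ k, Encodable (L.Relations k)]
    (Γ : L.Theory) (hcons : IsConsistent Γ) (hlogic : ContainsLogic Γ)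
    (Q : QuoteSystem L) (hQ : Q.Adequate Γ)
    (D : ℕ+ → Finset L.Sentence) (hD : IsDeductive D) (hcomplete : IsCompleteFor D Γ)
    (P : ℕ+ → L.Sentence → ℚ) (hP : IsMarket P) (hLI : IsLogicalInductor P D)
    (f : ℕ+ → ℕ+) (hf : IsDeferral f)
    (φ : ℕ+ → L.Sentence) (hφ : EffComputable φ)
    (δ : ℕ+ → ℚ) (hδ : EffComputable δ) (hδpos : ∀ n, 0 < δ n)
    (p : ℕ+ → ℚ) (hp : IsGenerable P p) (hp01 : ∀ n, 0 ≤ p n ∧ p n ≤ 1)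
    (γf : L.Formula (Fin 2)) (γP : L.Formula (Fin 3)) (γp : L.Formula (Fin 2))
    (γI : L.Formula (Fin 4))
    (hγf : Q.Represents Γ γf (fun n : ℕ+ => ![enc n]) (fun n => enc (f n)))
    (hγP : Q.Represents Γ γP (fun x : ℕ+ × L.Sentence => ![enc x.1, enc x.2])
      (fun x => enc (P x.1 x.2)))
    (hγp : Q.Represents Γ γp (fun n : ℕ+ => ![enc n]) (fun n => enc (p n)))
    (hγI : Q.Represents Γ γI
      (fun x : {d : ℚ // 0 < d} × ℚ × ℚ => ![enc x.1.1, enc x.2.1, enc x.2.2])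
      (fun x => enc (ctsInd x.1.1 x.2.1 x.2.2))) :
    AsympGE
      (fun n => Q.dayExpectation P n
        (Q.prod (Q.indicator (φ n)) (Q.futureIndicator γf γP γp γI n (φ n) (δ n))))
      (fun n => (p n : ℝ) * Q.dayExpectation P n
        (Q.futureIndicator γf γP γp γI n (φ n) (δ n))) := by
  by_contra hneg
  obtain ⟨ε, hε, hfreq⟩ := exists_frequently_of_not_asympGE hneg
  obtain ⟨ξ, hξ, hξP⟩ := hp
  obtain ⟨due, hdue, hdue_iff⟩ := hf.exists_due
  obtain ⟨E, hE, hED, hEmono, hDE⟩ := hD.exists_polyTime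
  obtain ⟨W₀, hW₀⟩ := hcons.nonempty_pcWorlds
  have hmem : ∀ n, W₀ ∈ pcWorlds (D n : Set L.Sentence) := fun n => by
    rw [← hcomplete] at hW₀
    exact pcWorlds_anti (Set.subset_iUnion (fun n => (D n : Set L.Sentence)) n) hW₀
  let A : ℕ → L.Formula (Fin 1) := fun k =>
    Q.futureIndicator γf γP γp γI k.succPNat (φ k.succPNat) (δ k.succPNat)
  let sold : ℕ → ℕ → L.Sentence := fun k j => Q.gt (A k) ((j : ℚ) / ((k + 1 : ℕ) : ℚ))
  let bought : ℕ → ℕ → L.Sentence := fun k j =>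
    Q.gt (Q.prod (Q.indicator (φ k.succPNat)) (A k)) ((j : ℚ) / ((k + 1 : ℕ) : ℚ))
  let base : ℕ → L.Sentence := fun k => φ k.succPNat
  let a : ℕ → ℚ := fun k =>
    ctsInd (δ k.succPNat) (P (f k.succPNat) (φ k.succPNat)) (p k.succPNat)
  let B : BettingPlan L.Sentence :=
    { ratio := fun k => ξ k.succPNat
      bought := bought
      sold := sold
      base := base
      slope := fun k => (δ k.succPNat)⁻¹
      margin := ε
      closed := settled due E base sold bought
      due := due }
  have hA : ∀ k, ∀ (M : Type) [L.Structure M], (∀ ψ, Proves Γ ψ → M ⊨ ψ) →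
      Q.Defines M (A k) (a k) := fun k M _ hM =>
    defines_futureIndicator hM hγf hγP hγp hγI _ _ (hδpos _)
  have hratio : ∀ k, B.ratioVal (realPrices P) k = p k.succPNat := fun k => (hξP _).2
  -- The hedge, read off the prices on the day to which it is deferred, equals the value that `Γ`
  -- proves for the indicator.
  have hhedge : ∀ i, B.hedgeVal (realPrices P) i (f i.succPNat).natPred = a i := by
    intro i
    rw [BettingPlan.hedgeVal, hratio, PNat.succPNat_natPred]
    simp only [a, ctsInd_eq (hδpos _), B, base, realPrices]
    push_cast
    rfl
  have hpoly : B.IsPoly := by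
    have h1 : PolyTime fun x : Unary × Unary => (x.1.val.succPNat : ℕ+) := .succPNat .fst
    have h2 := hφ.polyTime.comp (PolyTime.fst (α := Unary) (β := Unary))
    have h3 := hδ.polyTime.comp (PolyTime.fst (α := Unary) (β := Unary))
    have h4 := PolyFormula.futureIndicator hQ γf γP γp γI h1 h2 h3
    have h5 := PolyTime.ratDiv (PolyTime.snd (α := Unary) (β := Unary)) .fst
    have hb : PolyTime fun x : Unary × Unary => bought x.1.val x.2.val :=
      PolyFormula.gt hQ ((PolyFormula.indicator h2).prod h4) h5
    have hs : PolyTime fun x : Unary × Unary => sold x.1.val x.2.val := PolyFormula.gt hQ h4 h5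
    exact ⟨hξ.polyTime, hb, hs, hφ.polyTime, hδ.polyTime.ratInv fun _ => hδpos _,
      hdue.settled hE hφ.polyTime hs hb, hdue⟩
  refine hLI B.trader (B.isTrader fun k => (hξP _).1) hpoly.effComputable_trader
    (B.exploits (realPrices P) ?_ D W₀ hmem (f := fun i => (f i.succPNat).natPred) ?_ hdue_iff ?_
      (fun k => inv_pos.2 (hδpos _)) hε (fun i m n => settled_mono) ?_ ?_ ?_ ?_)
  · intro n ψ
    rw [realPrices]
    exact ⟨by exact_mod_cast (hP.1 n ψ).1, by exact_mod_cast (hP.1 n ψ).2⟩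
  · intro i
    have h1 : i.succPNat < f i.succPNat := hf.1 _
    rw [← PNat.succPNat_natPred (f i.succPNat), Nat.succPNat_lt_succPNat] at h1
    exact h1.le
  · intro k
    rw [hratio]
    exact ⟨by exact_mod_cast (hp01 _).1, by exact_mod_cast (hp01 _).2⟩
  · intro i
    refine exists_settled (Γ := Γ) hEmono ?_ ((hdue_iff i _).2 rfl) (fun j => ?_) fun j =>
      proves_gt_prod_indicator hlogic hQ (hA i) _ _
    · rw [← hcomplete]
      refine pcWorlds_anti fun ψ hψ => ?_
      obtain ⟨n, hn⟩ := Set.mem_iUnion.1 hψ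
      obtain ⟨k, hk⟩ := hDE n ψ hn
      exact Set.mem_iUnion.2 ⟨k, hk⟩
    · by_cases h : (j : ℚ) / ((i + 1 : ℕ) : ℚ) < a i
      · exact Or.inl (proves_gt hlogic hQ (hA i) h)
      · exact Or.inr (proves_not_gt hlogic hQ (hA i) h)
  · intro i n h
    obtain ⟨⟨m, hm, h1⟩, -⟩ := settled_iff.1 h
    rw [hdue_iff] at h1
    exact h1.trans_le hm
  · intro i n h W hW
    have h0 := B.hedgeVal_mem (realPrices P) i (f i.succPNat).natPred
    rw [hhedge] at h0
    have h1 := average_lt_mem h0.1 h0.2 i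
    -- `Γ` decides every sold sentence by comparing the grid point with `a i`, and `W₀` is a world
    -- of `Γ`.
    have h2 : ∀ j, W₀.toReal (sold i j) =
        if (j : ℝ) / ((i : ℝ) + 1) < a i then (1 : ℝ) else 0 := by
      intro j
      have h3 : (j : ℝ) / ((i : ℝ) + 1) < a i ↔ (j : ℚ) / ((i + 1 : ℕ) : ℚ) < a i := by
        rw [← Rat.cast_lt (K := ℝ)]
        push_cast
        rfl
      by_cases h4 : (j : ℚ) / ((i + 1 : ℕ) : ℚ) < a i
      · rw [if_pos (h3.2 h4), World.toReal, if_pos ((proves_gt hlogic hQ (hA i) h4).sound hW₀)]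
      · have h5 : W₀ (sold i j) = false := by
          have h6 := (proves_not_gt hlogic hQ (hA i) h4).sound hW₀
          have h7 : (!W₀ (sold i j) || W₀ ⊥) = true := (hW₀.1.2 (sold i j) ⊥).symm.trans h6
          simpa [hW₀.1.1] using h7
        rw [if_neg (mt h3.1 h4), World.toReal, h5, if_neg Bool.false_ne_true]
    -- After settlement all plausible worlds agree on the sold sentences, so their values can be
    -- taken from `W₀`, which is plausible on every day.
    have h3 : ∀ j ∈ Finset.range (i + 1), W.toReal (sold i j) =
        if (j : ℝ) / ((i : ℝ) + 1) < a i then (1 : ℝ) else 0 := by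
      intro j hj
      rw [← h2, World.toReal, World.toReal,
        (settled_sound hED hD.1 h hW (hmem _) (Nat.lt_succ_iff.1 (Finset.mem_range.1 hj))).1]
    rw [← Finset.sum_congr rfl h3, ← hhedge] at h1
    refine ⟨_, h1.1, h1.2, rfl, ?_⟩
    -- The inequality holds grid point by grid point: by settlement, `base i` and a sold sentence
    -- imply the corresponding bought one.
    rw [mul_left_comm, Finset.mul_sum]
    refine mul_le_mul_of_nonneg_left (Finset.sum_le_sum fun j hj => ?_) (by positivity)
    have h4 := (settled_sound hED hD.1 h hW (hmem _) (Nat.lt_succ_iff.1 (Finset.mem_range.1 hj))).2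
    have h5 := W.toReal_mem (bought i j)
    change W.toReal (base i) * W.toReal (sold i j) ≤ W.toReal (bought i j)
    by_cases h6 : W (base i) = true
    · by_cases h7 : W (sold i j) = true
      · simp [World.toReal, h6, h7, h4 h6 h7]
      · simpa [World.toReal, h7] using h5.1
    · simpa [World.toReal, h6] using h5.1
  · refine hfreq.mono fun k hk => ?_
    rw [QuoteSystem.dayExpectation_succPNat, QuoteSystem.dayExpectation_succPNat] at hk
    rw [BettingPlan.edge, hratio]
    exact hk
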